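/- Let $0<a<b<\infty$, let $M\ge 1$ be an integer, let $W$ be a bounded nondecreasing function with at least $M+1$ points of increase on $[a,b]$, and let $f(x)=\int_a^b e^{-xt}\,dW(t)$. Let $\varphi:[-1,1]\to\mathbb{R}$ be continuous and strictly increasing with $\varphi(-1)=a/b$ and $\varphi(1)=1$. For $1<\rho<\infty$ let $\mathbb{E}_\rho$ be the open Bernstein ellipse $$\mathbb{E}_\rho=\Bigl\{z\in\mathbb{C} : \frac{(\operatorname{Re} z)^2}{((\rho+\rho^{-1})/2)^2}+\frac{(\operatorname{Im} z)^2}{((\rho-\rho^{-1})/2)^2}<1\Bigr\},$$ and let $\mathbb{E}_\infty=\mathbb{C}$. Let $\rho_A\in[1,\infty]$ be the parameter of the largest $\mathbb{E}_\rho$ to which $\varphi$ can be continued analytically ($\rho_A=1$ if there is none), and assume $\rho_A>1$; denote the continuation to $\mathbb{E}_{\rho_A}$ again by $\varphi$. Put $m(\rho)=\inf_{u\in\mathbb{E}_\rho}\operatorname{Re}\varphi(u)\in[-\infty,\infty)$ for $1<\rho\le\rho_A$. Let $I=(1,\rho_A)$ if $m(\rho_A)=-\infty$ and $I=(1,\rho_A]$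 otherwise. Let $\hat\rho=\rho_A$ if $m(\rho_A)\ge 0$; if $m(\rho_A)<0$, let $\hat\rho$ be the unique $\rho\in(1,\rho_A)$ with $m(\rho)=0$. Then the $M$-point Gaussian quadrature for $\int_{-1}^1 p(u)\,dW(b\varphi(u))$ exists, i.e. there are nodes $-1<u_1<\dots<u_M<1$ and weights $c_\nu>0$ with $\int_{-1}^1 p(u)\,dW(b\varphi(u))=\sum_{\nu=1}^M c_\nu p(u_\nu)$ for all real polynomials $p$ of degree at most $2M-1$. For all such nodes and weights, the maximum below is attained and $$0<\max_{0\le x<\infty}\Bigl|f(x)-\sum_{\nu=1}^M c_\nu e^{-b\varphi(u_\nu)x}\Bigr|<\frac{16}{\pi}\,\hat\rho^{-2M}f(0).$$ Moreover, the upper bound is the best uniform bound obtainable from the Achieser–Stenger estimates $$\Bigl|f(x)-\sum_{\nu=1}^M c_\nu e^{-b\varphi(u_\nu)x}\Bigr|<\frac{16}{\pi}\,\rho^{-2M}e^{-bx\,m(\rho)}f(0),\qquad \rho\in I,\ 0<x<\infty,$$ that is, these estimates hold and $$\sup_{0<x<\infty}\ \inf_{\rho\in I}\ \frac{16}{\pi}\,\rho^{-2M}e^{-bx\,m(\rho)}f(0)=\frac{16}{\pi}\,\hat\rho^{-2M}f(0).$$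 -/

import Mathlib

open Set MeasureTheory Polynomial

noncomputable section

/-- The Lebesgue-Stieltjes measure `dα` on `[a, b]` of a function `α` that is nondecreasing on
`[a, b]` (only the values of `α` on `[a, b]` matter).  The function is extended by the constants
`α a` to the left of `a` and `α b` to the right of `b`, so that the mass of `{a}` is `α(a+) - α(a)`,
the mass of `{b}` is `α(b) - α(b-)`, the total mass is `α b - α a`, and the integral of a continuous
function with respect to this measure is its Stieltjes integral over `[a, b]`. -/
def stieltjesMeasure (α : ℝ → ℝ) (a b : ℝ) : Measure ℝ :=
  open Classical in
  if h : Monotone (fun t : ℝ => α (max a (min b t))) then h.stieltjesFunction.measure else 0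

/-- `t` is a point of increase of the function `α` on `[a, b]`: `α` is not constant on any relative
neighbourhood of `t` in `[a, b]` (for `α` nondecreasing). -/
def IsPointOfIncrease (α : ℝ → ℝ) (a b t : ℝ) : Prop :=
  t ∈ Icc a b ∧ ∀ ε > 0, ∃ s₁ ∈ Icc a b, ∃ s₂ ∈ Icc a b,
    t - ε < s₁ ∧ s₁ ≤ t ∧ t ≤ s₂ ∧ s₂ < t + ε ∧ α s₁ < α s₂

/-- The finite Laplace-Stieltjes transform `f(x) = ∫_a^b e^{-xt} dW(t)`. -/
def laplaceStieltjes (W : ℝ → ℝ) (a b x : ℝ) : ℝ :=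
  ∫ t, Real.exp (-x * t) ∂(stieltjesMeasure W a b)

/-- Increasing variable transformations of `[-1, 1]` onto `[r, 1]`. -/
structure IsVariableTransformation (r : ℝ) (φ : ℝ → ℝ) : Prop where
  left : φ (-1) = r
  right : φ 1 = 1
  continuousOn : ContinuousOn φ (Icc (-1) 1)
  strictMonoOn : StrictMonoOn φ (Icc (-1) 1)

/-- `u` and `c` are the nodes and weights of the `M`-point Gaussian quadrature for `∫_{-1}^1 · dα`:
it is exact for the real polynomials of degree at most `2M - 1`. -/
structure IsGaussQuadrature (M : ℕ) (α : ℝ → ℝ) (u c : Fin M → ℝ) : Prop where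
  strictMono : StrictMono u
  mem_Ioo : ∀ ν, u ν ∈ Ioo (-1 : ℝ) 1
  weight_pos : ∀ ν, 0 < c ν
  exact : ∀ p : ℝ[X], p.natDegree < 2 * M →
    ∫ s, p.eval s ∂(stieltjesMeasure α (-1) 1) = ∑ ν, c ν * p.eval (u ν)

/-- The open Bernstein ellipse `𝔼_ρ` for `1 < ρ ≤ ∞`, with `𝔼_∞ = ℂ`. -/
def bernsteinEllipse (ρ : EReal) : Set ℂ :=
  {z | ρ = ⊤ ∨ z.re ^ 2 / ((ρ.toReal + ρ.toReal⁻¹) / 2) ^ 2 +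
    z.im ^ 2 / ((ρ.toReal - ρ.toReal⁻¹) / 2) ^ 2 < 1}

/-- `g` is an analytic continuation to `U` of the function `F` on `[-1, 1]`. -/
def IsAnalyticContinuation (F : ℝ → ℝ) (g : ℂ → ℂ) (U : Set ℂ) : Prop :=
  AnalyticOnNhd ℂ g U ∧ ∀ s ∈ Icc (-1 : ℝ) 1, g s = F s

/-- `ρ_A[F] ∈ [1, ∞]`, the parameter of the largest open Bernstein ellipse to which the function `F`
on `[-1, 1]` can be continued analytically; it is `1` if there is no such ellipse. -/
def rhoA (F : ℝ → ℝ) : EReal :=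
  sSup ({1} ∪ {ρ : EReal | 1 < ρ ∧ ∃ g, IsAnalyticContinuation F g (bernsteinEllipse ρ)})

/-- The analytic continuation of `F` to `𝔼_{ρ_A[F]}` (if `ρ_A[F] > 1`; it is unique there). -/
def analyticContinuation (F : ℝ → ℝ) : ℂ → ℂ :=
  Classical.epsilon fun g => IsAnalyticContinuation F g (bernsteinEllipse (rhoA F))

/-- `inf_{u ∈ 𝔼_ρ} Re F(u)`, an extended real number. -/
def infRe (F : ℝ → ℝ) (ρ : EReal) : EReal :=
  ⨅ z ∈ bernsteinEllipse ρ, ((analyticContinuation F z).re : EReal)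

/-- The interval `I_F`: `(1, ρ_A[F])`, together with the endpoint `ρ_A[F]` if the infimum of the
real part on `𝔼_{ρ_A[F]}` is not `-∞`. -/
def rhoInterval (F : ℝ → ℝ) : Set ℝ :=
  {ρ : ℝ | 1 < ρ ∧ ((ρ : EReal) < rhoA F ∨ ((ρ : EReal) = rhoA F ∧ infRe F (rhoA F) ≠ ⊥))}

/-- `ρ₀[F]`, the number in `(1, ρ_A[F])` with `inf_{u ∈ 𝔼_ρ} Re F(u) = 0`. -/
def rhoZero (F : ℝ → ℝ) : ℝ :=
  Classical.epsilon fun ρ : ℝ => 1 < ρ ∧ (ρ : EReal) < rhoA F ∧ infRe F ρ = 0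

/-- `ρ̂[F]`. -/
def rhoHat (F : ℝ → ℝ) : ℝ :=
  open Classical in
  if 0 ≤ infRe F (rhoA F) then (rhoA F).toReal else rhoZero F

/-- The error at `x` of the exponential sum `∑ c_ν e^{-b φ(u_ν) x}` as an approximation of
`∫_a^b e^{-xt} dW(t)`. -/
def expSumError (W : ℝ → ℝ) (a b : ℝ) (φ : ℝ → ℝ) {M : ℕ} (u c : Fin M → ℝ) (x : ℝ) : ℝ :=
  laplaceStieltjes W a b x - ∑ ν, c ν * Real.exp (-b * φ (u ν) * x)

/-- The Achieser-Stenger bound at `x`, with parameter `ρ`, for the error of the `M`-point Gaussian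
quadrature of `∫_{-1}^1 e^{-b x φ(u)} dW(b φ(u))`:
`(16 / π) ρ^{-2M} e^{-b x inf_{u ∈ 𝔼_ρ} Re φ(u)} f(0)`. -/
def achieserStengerBound (W : ℝ → ℝ) (a b : ℝ) (φ : ℝ → ℝ) (M : ℕ) (ρ x : ℝ) : ℝ :=
  16 / Real.pi * ρ ^ (-(2 * (M : ℤ))) * Real.exp (-b * x * (infRe φ ρ).toReal) *
    laplaceStieltjes W a b 0

end

/-! Transport `dW` to `[-1, 1]` by `t = b φ(s)`. Gaussian quadrature is exact below degree `2M` and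
both the measure and the positive weights have total mass `f(0)`. Hence, if a polynomial of degree
below `2M` is within `ε` of `s ↦ e^{-b x φ(s)}` on `[-1, 1]`, the quadrature error at `x` is at most
`2 ε f(0)` (`IsGaussQuadrature.abs_expSumError_le`). It remains to approximate a function bounded on
a Bernstein ellipse with constant `8/π`.

Put `z = cos ζ`: the ellipse becomes the strip `|Im ζ| < log ρ`, and the integrand an even periodic
function with cosine coefficients `b_k`. On the line `Im ζ = h` its real part has coefficients `b_k
(s⁻¹ + s) / 2`, where `s = r ^ k` and `r = e^{-h}`. Achieser's exact kernel, with coefficients `2s /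
(1 + s²) = 2s - 2s³ + ⋯`, leads to elliptic functions; here it is truncated. Take kernels `A`, `B`
with coefficients `2s - 2s³` and `s⁴` for `k ≥ n`. Since `(s⁻¹ + s)/2 · (2s - 2s³) + s⁴ = 1`,
convolving the values on the shifted line with `A` and those on the real line with `B` reproduces
all frequencies `k ≥ n`, and the rest is a polynomial of degree below `n` in `cos θ`. Both kernels
are `cos nt` times Poisson kernels. `A` has the sign of `cos nt`, so its `L¹` norm follows from the
Fourier series of `|cos|`. The result is `(8/π) x (1 - x²/10)` with `x = r ^ n ≤ 1/2`
(`exists_polynomial_approx_cosine_series`); the factor below one survives the limit `h → log ρ` and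
makes the estimate strict. If `ρ^{-2M} ≥ 1/2`, the zero polynomial suffices.

At `ρ̂` one has `m(ρ̂) ≥ 0`, so the Achieser–Stenger bound is uniform in `x ≥ 0`. For optimality,
the three lines theorem makes `h ↦ -m(e^h)` convex (`convexOn_neg_infRe`). If `m(ρ_A) < 0`, a
supporting line at `log ρ̂` of positive slope `k` shows that at `x = 2M/(bk)` no `ρ` beats `ρ̂`. If
`m(ρ_A) ≥ 0`, then `ρ̂ = ρ_A` is the largest parameter, and letting `x → 0` suffices.

The maximum is positive because vanishing error at `x = 0, 1, 2, …` would equate the moments in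
`e^{-t}` of `dW` with those of `M` atoms. -/

/-! ### Stieltjes measures and their change of variable -/

/-- The extension of `W` from `[a, b]` by constants. -/
noncomputable def clampExtend (W : ℝ → ℝ) (a b : ℝ) : ℝ → ℝ := fun t => W (max a (min b t))

lemma clampExtend_monotone {W : ℝ → ℝ} {a b : ℝ} (hab : a ≤ b) (hW : MonotoneOn W (Icc a b)) :
    Monotone (clampExtend W a b) := by
  intro s t hst
  apply hW
  · exact ⟨le_max_left _ _, max_le hab (min_le_left _ _)⟩
  · exact ⟨le_max_left _ _, max_le hab (min_le_left _ _)⟩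
  · exact max_le_max le_rfl (min_le_min le_rfl hst)

lemma stieltjesMeasure_eq {W : ℝ → ℝ} {a b : ℝ} (h : Monotone (clampExtend W a b)) :
    stieltjesMeasure W a b = h.stieltjesFunction.measure := by
  unfold stieltjesMeasure
  exact dif_pos h

lemma stieltjesFunction_clampExtend_of_lt {W : ℝ → ℝ} {a b t : ℝ} (hab : a ≤ b)
    (h : Monotone (clampExtend W a b)) (ht : t < a) : h.stieltjesFunction t = W a := by
  rw [Monotone.stieltjesFunction_eq]
  have : ContinuousAt (clampExtend W a b) t := by
    apply ContinuousAt.congr (f := fun _ => W a) continuousAt_const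
    filter_upwards [Iio_mem_nhds ht] with s hs
    simp only [clampExtend]
    rw [min_eq_right (hs.le.trans hab), max_eq_left (le_of_lt hs)]
  rw [this.continuousWithinAt.rightLim_eq]
  simp only [clampExtend]
  rw [min_eq_right (ht.le.trans hab), max_eq_left ht.le]

lemma stieltjesFunction_clampExtend_of_ge {W : ℝ → ℝ} {a b t : ℝ} (hab : a ≤ b)
    (h : Monotone (clampExtend W a b)) (ht : b ≤ t) : h.stieltjesFunction t = W b := by
  rw [Monotone.stieltjesFunction_eq]
  have key : ∀ s, b ≤ s → clampExtend W a b s = W b := fun s hs => by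
    simp only [clampExtend]
    rw [min_eq_left hs, max_eq_right hab]
  apply rightLim_eq_of_tendsto
  apply tendsto_const_nhds.congr'
  filter_upwards [self_mem_nhdsWithin] with s hs
  exact (key s (ht.trans (le_of_lt hs))).symm

lemma tendsto_atBot_stieltjesFunction_clampExtend {W : ℝ → ℝ} {a b : ℝ} (hab : a ≤ b)
    (h : Monotone (clampExtend W a b)) :
    Filter.Tendsto h.stieltjesFunction Filter.atBot (nhds (W a)) := by
  apply tendsto_const_nhds.congr'
  filter_upwards [Filter.Iio_mem_atBot a] with t ht
  exact (stieltjesFunction_clampExtend_of_lt hab h ht).symm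

lemma tendsto_atTop_stieltjesFunction_clampExtend {W : ℝ → ℝ} {a b : ℝ} (hab : a ≤ b)
    (h : Monotone (clampExtend W a b)) :
    Filter.Tendsto h.stieltjesFunction Filter.atTop (nhds (W b)) := by
  apply tendsto_const_nhds.congr'
  filter_upwards [Filter.Ici_mem_atTop b] with t ht
  exact (stieltjesFunction_clampExtend_of_ge hab h ht).symm

lemma isFiniteMeasure_stieltjesMeasure {W : ℝ → ℝ} {a b : ℝ} (hab : a ≤ b)
    (hW : MonotoneOn W (Icc a b)) : IsFiniteMeasure (stieltjesMeasure W a b) := by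
  have h := clampExtend_monotone hab hW
  rw [stieltjesMeasure_eq h]
  exact StieltjesFunction.isFiniteMeasure _ (tendsto_atBot_stieltjesFunction_clampExtend hab h)
    (tendsto_atTop_stieltjesFunction_clampExtend hab h)

lemma stieltjesMeasure_compl_Icc {W : ℝ → ℝ} {a b : ℝ} (hab : a ≤ b)
    (hW : MonotoneOn W (Icc a b)) : stieltjesMeasure W a b (Icc a b)ᶜ = 0 := by
  have h := clampExtend_monotone hab hW
  rw [stieltjesMeasure_eq h]
  have : (Icc a b)ᶜ = Iio a ∪ Ioi b := by
    ext t; simp only [mem_compl_iff, mem_Icc, not_and_or, not_le, mem_union, mem_Iio, mem_Ioi]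
  rw [this]
  apply measure_union_null
  · rw [StieltjesFunction.measure_Iio _ (tendsto_atBot_stieltjesFunction_clampExtend hab h)]
    have : Function.leftLim h.stieltjesFunction a = W a := by
      apply leftLim_eq_of_tendsto
      apply tendsto_const_nhds.congr'
      filter_upwards [self_mem_nhdsWithin] with t ht
      exact (stieltjesFunction_clampExtend_of_lt hab h ht).symm
    simp [this]
  · rw [StieltjesFunction.measure_Ioi _ (tendsto_atTop_stieltjesFunction_clampExtend hab h),
      stieltjesFunction_clampExtend_of_ge hab h le_rfl]
    simp

lemma ae_mem_Icc_stieltjesMeasure {W : ℝ → ℝ} {a b : ℝ} (hab : a ≤ b)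
    (hW : MonotoneOn W (Icc a b)) : ∀ᵐ t ∂(stieltjesMeasure W a b), t ∈ Icc a b := by
  rw [ae_iff]
  exact stieltjesMeasure_compl_Icc hab hW

/-- The neighbourhood contains some closed `[s₁, s₂]`, whose mass, jumps at both ends included, is
at least `W s₂ - W s₁`. -/
lemma IsPointOfIncrease.measure_pos {W : ℝ → ℝ} {a b t : ℝ} (hab : a ≤ b)
    (hW : MonotoneOn W (Icc a b)) (ht : IsPointOfIncrease W a b t) {U : Set ℝ} (hU : U ∈ nhds t) :
    0 < stieltjesMeasure W a b U := by
  have h := clampExtend_monotone hab hW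
  obtain ⟨ε, hε, hball⟩ := Metric.mem_nhds_iff.1 hU
  obtain ⟨s₁, hs₁, s₂, hs₂, h1, h2, h3, h4, h5⟩ := ht.2 ε hε
  have hsub : Icc s₁ s₂ ⊆ U := fun s hs => hball (by
    rw [Real.ball_eq_Ioo]; exact ⟨h1.trans_le hs.1, hs.2.trans_lt h4⟩)
  refine lt_of_lt_of_le ?_ (measure_mono hsub)
  rw [stieltjesMeasure_eq h, StieltjesFunction.measure_Icc, ENNReal.ofReal_pos, sub_pos]
  have key : ∀ s ∈ Icc a b, clampExtend W a b s = W s := fun s hs => by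
    simp only [clampExtend]
    rw [min_eq_right hs.2, max_eq_right hs.1]
  calc Function.leftLim h.stieltjesFunction s₁ ≤ clampExtend W a b s₁ := by
        apply le_of_tendsto (h.stieltjesFunction.mono.tendsto_leftLim s₁)
        filter_upwards [self_mem_nhdsWithin] with t ht
        rw [Monotone.stieltjesFunction_eq]
        exact h.rightLim_le ht
    _ < clampExtend W a b s₂ := by rw [key _ hs₁, key _ hs₂]; exact h5
    _ ≤ _ := by
        rw [Monotone.stieltjesFunction_eq]; exact h.le_rightLim le_rfl

/-- This is the form in which the `M + 1` points of increase enter everywhere: no `M` points carry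
all the mass. -/
lemma stieltjesMeasure_compl_finset_pos {W : ℝ → ℝ} {a b : ℝ} (hab : a ≤ b)
    (hW : MonotoneOn W (Icc a b)) {M : ℕ}
    (hinc : ((M + 1 : ℕ) : ℕ∞) ≤ {t | IsPointOfIncrease W a b t}.encard) (F : Finset ℝ)
    (hF : F.card ≤ M) : 0 < stieltjesMeasure W a b (F : Set ℝ)ᶜ := by
  have : ∃ t, IsPointOfIncrease W a b t ∧ t ∉ F := by
    by_contra! hcon
    have h1 : {t | IsPointOfIncrease W a b t}.encard ≤ (F : Set ℝ).encard :=
      encard_le_encard fun t ht => hcon t ht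
    rw [encard_coe_eq_coe_finsetCard] at h1
    have := Nat.cast_le.1 (hinc.trans h1)
    omega
  obtain ⟨t, ht, htF⟩ := this
  exact ht.measure_pos hab hW (F.finite_toSet.isClosed.isOpen_compl.mem_nhds htF)

/-- The order isomorphism of the line that extends `s ↦ b φ(s)` by linear functions. -/
lemma exists_orderIso_extension {r b : ℝ} (hb : 0 < b) {φ : ℝ → ℝ}
    (hφ : IsVariableTransformation r φ) :
    ∃ e : ℝ ≃o ℝ, (∀ s ∈ Icc (-1 : ℝ) 1, e s = b * φ s) ∧ e (-1) = b * r ∧ e 1 = b := by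
  let cl : ℝ → ℝ := fun s => max (-1) (min 1 s)
  have hcl : ∀ s, cl s ∈ Icc (-1 : ℝ) 1 := fun s =>
    ⟨le_max_left _ _, max_le (by norm_num) (min_le_left _ _)⟩
  have hclm : Monotone cl := fun s t hst => max_le_max le_rfl (min_le_min le_rfl hst)
  have hcc : Continuous cl := by fun_prop
  have hcl_eq : ∀ s ∈ Icc (-1 : ℝ) 1, cl s = s := fun s hs => by
    simp only [cl]; rw [min_eq_right hs.2, max_eq_right hs.1]
  -- The summand `s - cl s` has slope one outside `[-1, 1]` and vanishes inside, which makes `f`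
  -- strictly increasing and onto.
  let f : ℝ → ℝ := fun s => b * φ (cl s) + (s - cl s)
  have hrest : Monotone fun s => s - cl s := by
    intro s t hst
    simp only [cl]
    rcases le_total 1 s with h1 | h1 <;> rcases le_total 1 t with h2 | h2 <;>
    rcases le_total (-1) s with h3 | h3 <;> rcases le_total (-1) t with h4 | h4 <;>
    simp [*] <;> linarith
  have hφm : Monotone fun s => b * φ (cl s) := fun s t hst =>
    mul_le_mul_of_nonneg_left (hφ.strictMonoOn.monotoneOn (hcl _) (hcl _) (hclm hst)) hb.le
  have hf : StrictMono f := by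
    intro s t hst
    have h1 : s - cl s ≤ t - cl t := hrest hst.le
    have h2 : b * φ (cl s) ≤ b * φ (cl t) := hφm hst.le
    rcases (hclm hst.le).lt_or_eq with h | h
    · have := mul_lt_mul_of_pos_left (hφ.strictMonoOn (hcl s) (hcl t) h) hb
      simp only [f]; linarith
    · simp only [f, h]; linarith
  have hfc : Continuous f := by
    have : Continuous fun s => φ (cl s) :=
      hφ.continuousOn.comp_continuous hcc hcl
    exact (continuous_const.mul this).add (continuous_id.sub hcc)
  have hsurj : Function.Surjective f := by
    apply hfc.surjective
    · apply Filter.tendsto_atTop_mono' (f₁ := fun s => s + (b - 1))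
      · filter_upwards [Filter.Ici_mem_atTop 1] with s hs
        have : cl s = 1 := by simp only [cl]; rw [min_eq_left hs]; norm_num
        simp only [f, this, hφ.right]; linarith
      · exact Filter.tendsto_atTop_add_const_right _ _ Filter.tendsto_id
    · apply Filter.tendsto_atBot_mono' _ (f₁ := fun s => s + (b * r + 1))
      · filter_upwards [Filter.Iic_mem_atBot (-1)] with s hs
        have : cl s = -1 := by
          simp only [cl]
          rw [min_eq_right (le_trans hs (by norm_num)), max_eq_left hs]
        simp only [f, this, hφ.left]; linarith
      · exact Filter.tendsto_atBot_add_const_right _ _ Filter.tendsto_id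
  have h1 : ∀ s ∈ Icc (-1 : ℝ) 1, f s = b * φ s := fun s hs => by simp [f, hcl_eq s hs]
  refine ⟨hf.orderIsoOfSurjective f hsurj, h1, ?_, ?_⟩
  · rw [StrictMono.coe_orderIsoOfSurjective, h1 _ (by norm_num), hφ.left]
  · rw [StrictMono.coe_orderIsoOfSurjective, h1 _ (by norm_num), hφ.right, mul_one]

/-- An order isomorphism commutes with `max` and `min`, so clamping to `[-1, 1]` before `e` is
clamping to `[a, b]` after it. -/
lemma clampExtend_comp {a b : ℝ} (W : ℝ → ℝ) {φ : ℝ → ℝ} (e : ℝ ≃o ℝ)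
    (he : ∀ s ∈ Icc (-1 : ℝ) 1, e s = b * φ s) (h1 : e (-1) = a) (h2 : e 1 = b) :
    clampExtend (fun s => W (b * φ s)) (-1) 1 = clampExtend W a b ∘ e := by
  ext s
  simp only [clampExtend, Function.comp]
  rw [← he _ ⟨le_max_left _ _, max_le (by norm_num) (min_le_left _ _)⟩, e.monotone.map_max,
    e.monotone.map_min, h1, h2]

lemma rightLim_comp_orderIso {f : ℝ → ℝ} (hf : Monotone f) (e : ℝ ≃o ℝ) (s : ℝ) :
    Function.rightLim (f ∘ e) s = Function.rightLim f (e s) := by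
  apply rightLim_eq_of_tendsto
  apply (hf.tendsto_rightLim (e s)).comp
  apply tendsto_nhdsWithin_of_tendsto_nhds_of_eventually_within
  · exact (e.continuous.tendsto s).mono_left nhdsWithin_le_nhds
  · filter_upwards [self_mem_nhdsWithin] with t ht using e.strictMono ht

/-- The measure of `s ↦ W (b φ s)` on `[-1, 1]` is carried to the measure of `W` on `[a, b]`. -/
lemma map_stieltjesMeasure_comp {a b : ℝ} (hab : a ≤ b) {W : ℝ → ℝ}
    (hW : MonotoneOn W (Icc a b)) {φ : ℝ → ℝ} (e : ℝ ≃o ℝ)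
    (he : ∀ s ∈ Icc (-1 : ℝ) 1, e s = b * φ s) (h1 : e (-1) = a) (h2 : e 1 = b) :
    (stieltjesMeasure (fun s => W (b * φ s)) (-1) 1).map e = stieltjesMeasure W a b := by
  have h := clampExtend_monotone hab hW
  have hcomp := clampExtend_comp W e he h1 h2
  have h' : Monotone (clampExtend (fun s => W (b * φ s)) (-1) 1) := by
    rw [hcomp]; exact h.comp e.monotone
  rw [stieltjesMeasure_eq h, stieltjesMeasure_eq h']
  have hme : Measurable e := e.continuous.measurable
  symm
  apply Measure.ext_of_Ioc
  intro x y hxy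
  rw [Measure.map_apply hme measurableSet_Ioc, OrderIso.preimage_Ioc, StieltjesFunction.measure_Ioc,
    StieltjesFunction.measure_Ioc]
  simp only [Monotone.stieltjesFunction_eq, hcomp]
  rw [rightLim_comp_orderIso h, rightLim_comp_orderIso h]
  simp

lemma monotoneOn_comp_transformation {a b : ℝ} {W : ℝ → ℝ}
    (hW : MonotoneOn W (Icc a b)) {φ : ℝ → ℝ} (e : ℝ ≃o ℝ)
    (he : ∀ s ∈ Icc (-1 : ℝ) 1, e s = b * φ s) (h1 : e (-1) = a) (h2 : e 1 = b) :
    MonotoneOn (fun s => W (b * φ s)) (Icc (-1) 1) := by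
  intro s hs t ht hst
  simp only [← he s hs, ← he t ht]
  apply hW
  · rw [← h1, ← h2]; exact ⟨e.monotone hs.1, e.monotone hs.2⟩
  · rw [← h1, ← h2]; exact ⟨e.monotone ht.1, e.monotone ht.2⟩
  · exact e.monotone hst

/-! ### Existence of Gaussian quadrature -/

lemma integrable_of_continuous_of_ae_mem_Icc {μ : Measure ℝ} [IsFiniteMeasure μ] {a b : ℝ}
    (hμ : ∀ᵐ t ∂μ, t ∈ Icc a b) {f : ℝ → ℝ} (hf : Continuous f) : Integrable f μ := by
  obtain ⟨C, hC⟩ := (isCompact_Icc (a := a) (b := b)).exists_bound_of_continuousOn hf.continuousOn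
  exact Integrable.of_bound hf.aestronglyMeasurable C (hμ.mono fun t ht => hC t ht)

/-- The linear functional `p ↦ ∫ p dμ` on polynomials, for a measure on a compact interval. -/
noncomputable def polynomialIntegral (μ : Measure ℝ) [IsFiniteMeasure μ] {a b : ℝ}
    (hμ : ∀ᵐ t ∂μ, t ∈ Icc a b) : ℝ[X] →ₗ[ℝ] ℝ where
  toFun p := ∫ t, p.eval t ∂μ
  map_add' p q := by
    simp only [eval_add]
    exact integral_add (integrable_of_continuous_of_ae_mem_Icc hμ p.continuous)
      (integrable_of_continuous_of_ae_mem_Icc hμ q.continuous)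
  map_smul' c p := by
    simp only [eval_smul, smul_eq_mul, RingHom.id_apply]
    exact integral_const_mul c _

lemma integral_pos_of_card_zeros_le {μ : Measure ℝ} [IsFiniteMeasure μ] {a b : ℝ}
    (hμ : ∀ᵐ t ∂μ, t ∈ Icc a b) {M : ℕ}
    (hpos : ∀ F : Finset ℝ, F.card ≤ M → 0 < μ (F : Set ℝ)ᶜ) {f : ℝ → ℝ} (hf : Continuous f)
    (hf0 : ∀ t ∈ Icc a b, 0 ≤ f t) (F : Finset ℝ) (hF : F.card ≤ M) (hz : ∀ t, f t = 0 → t ∈ F) :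
    0 < ∫ t, f t ∂μ := by
  rw [integral_pos_iff_support_of_nonneg_ae (hμ.mono hf0)
    (integrable_of_continuous_of_ae_mem_Icc hμ hf)]
  refine (hpos F hF).trans_le (measure_mono fun t ht => ?_)
  rw [Function.mem_support]
  exact fun h => ht (hz t h)

/-- Existence of the orthogonal polynomial of degree `M`. -/
lemma exists_monic_orthogonal {μ : Measure ℝ} [IsFiniteMeasure μ] {a b : ℝ}
    (hμ : ∀ᵐ t ∂μ, t ∈ Icc a b) {M : ℕ}
    (hpos : ∀ F : Finset ℝ, F.card ≤ M → 0 < μ (F : Set ℝ)ᶜ) :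
    ∃ p : ℝ[X], p.Monic ∧ p.natDegree = M ∧
      ∀ q : ℝ[X], q.degree < M → ∫ t, (p * q).eval t ∂μ = 0 := by
  let L := polynomialIntegral μ hμ
  let B : ℝ[X] →ₗ[ℝ] ℝ[X] →ₗ[ℝ] ℝ := (LinearMap.mul ℝ ℝ[X]).compr₂ L
  have hB : ∀ p q, B p q = ∫ t, (p * q).eval t ∂μ := fun p q => rfl
  let V := degreeLT ℝ M
  have : FiniteDimensional ℝ V := Module.Finite.equiv (degreeLTEquiv ℝ M).symm
  let T : V →ₗ[ℝ] Module.Dual ℝ V := B.domRestrict₁₂ V V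
  have hT : ∀ r s : V, T r s = B r s := fun r s => rfl
  -- The form `∫ r s dμ` is definite below degree `M`, since `r²` has fewer than `M` distinct zeros.
  -- In finite dimension it therefore represents `q ↦ ∫ X ^ M q dμ` by some `r`, and `X ^ M - r` is
  -- orthogonal.
  have hinj : Function.Injective T := by
    rw [← LinearMap.ker_eq_bot, LinearMap.ker_eq_bot']
    intro r hr
    by_contra hr0
    have hr0' : (r : ℝ[X]) ≠ 0 := fun h => hr0 (Subtype.ext h)
    have h1 : T r r = 0 := by rw [hr]; rfl
    rw [hT, hB] at h1
    have hdeg : (r : ℝ[X]).natDegree < M :=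
      (natDegree_lt_iff_degree_lt hr0').2 (mem_degreeLT.1 r.2)
    refine (integral_pos_of_card_zeros_le hμ hpos (Polynomial.continuous _) ?_
      (r : ℝ[X]).roots.toFinset ?_ ?_).ne' h1
    · intro t _; rw [eval_mul]; exact mul_self_nonneg _
    · exact ((Multiset.toFinset_card_le _).trans (card_roots' _)).trans hdeg.le
    · intro t ht
      rw [eval_mul, mul_self_eq_zero] at ht
      rw [Multiset.mem_toFinset, mem_roots hr0']
      exact ht
  have hsurj : Function.Surjective T :=
    (LinearMap.injective_iff_surjective_of_finrank_eq_finrank Subspace.dual_finrank_eq.symm).1 hinj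
  obtain ⟨r, hr⟩ := hsurj ((B (X ^ M)).domRestrict V)
  have hrdeg : (r : ℝ[X]).degree < M := mem_degreeLT.1 r.2
  refine ⟨X ^ M - (r : ℝ[X]), ?_, ?_, fun q hq => ?_⟩
  · exact monic_X_pow_sub hrdeg
  · exact natDegree_eq_of_degree_eq_some (by
      rw [degree_sub_eq_left_of_degree_lt (by rwa [degree_X_pow]), degree_X_pow])
  · rw [← hB, map_sub, LinearMap.sub_apply, sub_eq_zero]
    have := LinearMap.congr_fun hr ⟨q, mem_degreeLT.2 hq⟩
    rw [hT] at this
    exact this.symm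

/-- `S` consists of the roots of odd multiplicity in the open interval; multiplying by their linear
factors makes every multiplicity even. The induction divides out one root at a time and toggles its
membership in `S`. -/
lemma exists_finset_roots_const_sign (p : ℝ[X]) (hp : p ≠ 0) {a b : ℝ} (hab : a < b) :
    ∃ S : Finset ℝ, (∀ r ∈ S, r ∈ Ioo a b ∧ p.IsRoot r) ∧
      ((∀ t ∈ Icc a b, 0 ≤ (p * ∏ r ∈ S, (X - C r)).eval t) ∨
        (∀ t ∈ Icc a b, (p * ∏ r ∈ S, (X - C r)).eval t ≤ 0)) := by
  induction hn : p.natDegree using Nat.strong_induction_on generalizing p with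
  | _ n ih =>
  by_cases hr : ∃ r ∈ Ioo a b, p.IsRoot r
  · obtain ⟨r, hrI, hr⟩ := hr
    obtain ⟨q, rfl⟩ := dvd_iff_isRoot.2 hr
    have hq : q ≠ 0 := right_ne_zero_of_mul hp
    have hdeg : q.natDegree < n := by
      rw [natDegree_mul (X_sub_C_ne_zero r) hq, natDegree_X_sub_C] at hn
      omega
    obtain ⟨S, hS, hsign⟩ := ih _ hdeg q hq rfl
    by_cases hrS : r ∈ S
    · refine ⟨S.erase r, fun s hs => ⟨(hS s (Finset.mem_of_mem_erase hs)).1, ?_⟩, ?_⟩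
      · exact root_mul_left_of_isRoot _ (hS s (Finset.mem_of_mem_erase hs)).2
      · have : (X - C r) * q * ∏ s ∈ S.erase r, (X - C s) = q * ∏ s ∈ S, (X - C s) := by
          rw [← Finset.mul_prod_erase S _ hrS]; ring
        rwa [this]
    · refine ⟨insert r S, fun s hs => ?_, ?_⟩
      · rcases Finset.mem_insert.1 hs with rfl | hs
        · exact ⟨hrI, hr⟩
        · exact ⟨(hS s hs).1, root_mul_left_of_isRoot _ (hS s hs).2⟩
      · have : (X - C r) * q * ∏ s ∈ insert r S, (X - C s) =
            (X - C r) ^ 2 * (q * ∏ s ∈ S, (X - C s)) := by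
          rw [Finset.prod_insert hrS]; ring
        rw [this]
        refine hsign.imp (fun h t ht => ?_) (fun h t ht => ?_) <;> rw [eval_mul, eval_pow]
        · exact mul_nonneg (sq_nonneg _) (h t ht)
        · exact mul_nonpos_of_nonneg_of_nonpos (sq_nonneg _) (h t ht)
  · push Not at hr
    refine ⟨∅, by simp, ?_⟩
    simp only [Finset.prod_empty, mul_one]
    have hpre : IsPreconnected (Ioo a b) := isPreconnected_Ioo
    have hIoo : (∀ t ∈ Ioo a b, 0 ≤ p.eval t) ∨ (∀ t ∈ Ioo a b, p.eval t ≤ 0) := by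
      by_contra! hcon
      obtain ⟨⟨s, hs, hs'⟩, t, ht, ht'⟩ := hcon
      obtain ⟨z, hz, hz0⟩ := hpre.intermediate_value hs ht p.continuous.continuousOn
        ⟨hs'.le, ht'.le⟩
      exact hr z hz hz0
    have hcl : Icc a b ⊆ closure (Ioo a b) := (closure_Ioo hab.ne).ge
    refine hIoo.imp (fun h t ht => ?_) (fun h t ht => ?_)
    · exact (closure_minimal h (isClosed_le continuous_const p.continuous)) (hcl ht)
    · exact (closure_minimal h (isClosed_le p.continuous continuous_const)) (hcl ht)

/-- The orthogonal polynomial of degree `M` has `M` distinct roots inside the interval. -/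
lemma exists_finset_orthogonal {μ : Measure ℝ} [IsFiniteMeasure μ] {a b : ℝ} (hab : a < b)
    (hμ : ∀ᵐ t ∂μ, t ∈ Icc a b) {M : ℕ}
    (hpos : ∀ F : Finset ℝ, F.card ≤ M → 0 < μ (F : Set ℝ)ᶜ) :
    ∃ S : Finset ℝ, S.card = M ∧ (∀ r ∈ S, r ∈ Ioo a b) ∧
      ∀ q : ℝ[X], q.degree < M → ∫ t, ((∏ r ∈ S, (X - C r)) * q).eval t ∂μ = 0 := by
  obtain ⟨p, hpm, hpd, horth⟩ := exists_monic_orthogonal hμ hpos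
  obtain ⟨S, hS, hsign⟩ := exists_finset_roots_const_sign p hpm.ne_zero hab
  have hsub : S ⊆ p.roots.toFinset := fun r hr => by
    rw [Multiset.mem_toFinset, mem_roots hpm.ne_zero]; exact (hS r hr).2
  have hroots : p.roots.toFinset.card ≤ M :=
    ((Multiset.toFinset_card_le _).trans (card_roots' _)).trans hpd.le
  have hQm : (∏ r ∈ S, (X - C r)).Monic := monic_prod_of_monic _ _ fun r _ => monic_X_sub_C r
  have hQd : (∏ r ∈ S, (X - C r)).natDegree = S.card := by
    rw [natDegree_prod_of_monic _ _ fun r _ => monic_X_sub_C r]; simp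
  have hle : S.card ≤ M := (Finset.card_le_card hsub).trans hroots
  have hcard : S.card = M := by
    -- With fewer than `M` factors the product would be an admissible test polynomial; but `p` times
    -- it has constant sign and at most `M` zeros, so its integral cannot vanish.
    refine hle.antisymm (not_lt.1 fun hlt => ?_)
    have h0 := horth (∏ r ∈ S, (X - C r))
      (by rw [degree_eq_natDegree hQm.ne_zero, hQd]; exact_mod_cast hlt)
    have hz : ∀ t, (p * ∏ r ∈ S, (X - C r)).eval t = 0 → t ∈ p.roots.toFinset := by
      intro t ht
      rw [eval_mul, mul_eq_zero] at ht
      rcases ht with ht | ht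
      · rw [Multiset.mem_toFinset, mem_roots hpm.ne_zero]; exact ht
      · rw [eval_prod, Finset.prod_eq_zero_iff] at ht
        obtain ⟨r, hr, hrt⟩ := ht
        rw [eval_sub, eval_X, eval_C, sub_eq_zero] at hrt
        exact hrt ▸ hsub hr
    rcases hsign with h | h
    · exact (integral_pos_of_card_zeros_le hμ hpos (Polynomial.continuous _) h _ hroots hz).ne' h0
    · have := integral_pos_of_card_zeros_le hμ hpos (f := fun t =>
        -(p * ∏ r ∈ S, (X - C r)).eval t) (Polynomial.continuous _).neg
        (fun t ht => neg_nonneg.2 (h t ht)) _ hroots (fun t ht => hz t (neg_eq_zero.1 ht))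
      rw [integral_neg, h0] at this
      simp at this
  have hdvd : (∏ r ∈ S, (X - C r)) ∣ p := by
    have h1 : S.val ≤ p.roots :=
      (Multiset.le_iff_subset S.nodup).2 fun r hr => Multiset.mem_toFinset.1 (hsub hr)
    exact (Multiset.prod_X_sub_C_dvd_iff_le_roots hpm.ne_zero S.val).2 h1
  have hpeq : p = ∏ r ∈ S, (X - C r) := by
    refine (eq_of_monic_of_dvd_of_natDegree_le hQm hpm hdvd ?_)
    rw [hpd, hQd, hcard]
  exact ⟨S, hcard, fun r hr => (hS r hr).1, hpeq ▸ horth⟩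

/-- Existence of the Gaussian quadrature of a measure with more than `M` points in its support. -/
lemma exists_gaussQuadrature {μ : Measure ℝ} [IsFiniteMeasure μ] {a b : ℝ} (hab : a < b)
    (hμ : ∀ᵐ t ∂μ, t ∈ Icc a b) {M : ℕ} (hM : 1 ≤ M)
    (hpos : ∀ F : Finset ℝ, F.card ≤ M → 0 < μ (F : Set ℝ)ᶜ) :
    ∃ u c : Fin M → ℝ, StrictMono u ∧ (∀ ν, u ν ∈ Ioo a b) ∧ (∀ ν, 0 < c ν) ∧
      ∀ p : ℝ[X], p.natDegree < 2 * M → ∫ s, p.eval s ∂μ = ∑ ν, c ν * p.eval (u ν) := by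
  obtain ⟨S, hcard, hS, horth⟩ := exists_finset_orthogonal hab hμ hpos
  let u : Fin M → ℝ := S.orderEmbOfFin hcard
  have hu : StrictMono u := (S.orderEmbOfFin hcard).strictMono
  have huinj : InjOn u (Finset.univ : Finset (Fin M)) := hu.injective.injOn
  let ℓ : Fin M → ℝ[X] := Lagrange.basis Finset.univ u
  let c : Fin M → ℝ := fun ν => ∫ t, (ℓ ν).eval t ∂μ
  set P : ℝ[X] := ∏ r ∈ S, (X - C r) with hP
  have hPm : P.Monic := monic_prod_of_monic _ _ fun r _ => monic_X_sub_C r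
  have hPd : P.natDegree = M := by
    rw [hP, natDegree_prod_of_monic _ _ fun r _ => monic_X_sub_C r]; simp [hcard]
  have hPu : ∀ ν, P.eval (u ν) = 0 := fun ν => by
    rw [hP, eval_prod]
    exact Finset.prod_eq_zero (Finset.orderEmbOfFin_mem S hcard ν) (by simp [u])
  have hlow : ∀ p : ℝ[X], p.degree < M → ∫ s, p.eval s ∂μ = ∑ ν, c ν * p.eval (u ν) := by
    intro p hp
    have h1 : p = ∑ ν, C (p.eval (u ν)) * ℓ ν := by
      have := Lagrange.eq_interpolate (s := Finset.univ) (f := p) huinj (by simpa using hp)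
      rwa [Lagrange.interpolate_apply] at this
    conv_lhs => rw [h1]
    simp only [eval_finsetSum, eval_mul, eval_C]
    rw [integral_finsetSum]
    · refine Finset.sum_congr rfl fun ν _ => ?_
      rw [integral_const_mul, mul_comm]
    · intro ν _
      exact (integrable_of_continuous_of_ae_mem_Icc hμ (ℓ ν).continuous).const_mul _
  -- Divide by the nodal polynomial `P`: the remainder has degree below `M`, the quotient too, so
  -- `P` times the quotient integrates to zero and vanishes at the nodes.
  have hex : ∀ p : ℝ[X], p.natDegree < 2 * M →
      ∫ s, p.eval s ∂μ = ∑ ν, c ν * p.eval (u ν) := by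
    intro p hp
    have hdiv := modByMonic_add_div p P
    have hr : (p %ₘ P).degree < M := by
      have := degree_modByMonic_lt p hPm
      rwa [degree_eq_natDegree hPm.ne_zero, hPd] at this
    have hq : (p /ₘ P).degree < M := by
      by_cases h0 : p /ₘ P = 0
      · rw [h0, degree_zero]; exact WithBot.bot_lt_coe _
      · rw [← natDegree_lt_iff_degree_lt h0, natDegree_divByMonic _ hPm, hPd]; omega
    calc ∫ s, p.eval s ∂μ = ∫ s, ((p %ₘ P).eval s + (P * (p /ₘ P)).eval s) ∂μ := by
          conv_lhs => rw [← hdiv]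
          simp only [eval_add]
      _ = ∫ s, (p %ₘ P).eval s ∂μ + ∫ s, (P * (p /ₘ P)).eval s ∂μ :=
          integral_add (integrable_of_continuous_of_ae_mem_Icc hμ (Polynomial.continuous _))
            (integrable_of_continuous_of_ae_mem_Icc hμ (Polynomial.continuous _))
      _ = ∑ ν, c ν * (p %ₘ P).eval (u ν) := by rw [horth _ hq, hlow _ hr, add_zero]
      _ = ∑ ν, c ν * p.eval (u ν) := by
          refine Finset.sum_congr rfl fun ν _ => ?_
          conv_rhs => rw [← hdiv]
          rw [eval_add, eval_mul, hPu, zero_mul, add_zero]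
  refine ⟨u, c, hu, fun ν => hS _ (Finset.orderEmbOfFin_mem S hcard ν), fun ν => ?_, hex⟩
  have hℓ0 : ℓ ν ≠ 0 := Lagrange.basis_ne_zero huinj (Finset.mem_univ ν)
  have hℓd : (ℓ ν).natDegree = M - 1 := by
    have := Lagrange.degree_basis huinj (Finset.mem_univ ν)
    rw [Finset.card_univ, Fintype.card_fin] at this
    exact natDegree_eq_of_degree_eq_some this
  -- The square of a Lagrange polynomial has degree `2M - 2`, so exactness identifies the weight
  -- with the integral of a square.
  have h1 := hex (ℓ ν * ℓ ν) (by rw [natDegree_mul hℓ0 hℓ0, hℓd]; omega)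
  have h2 : ∑ i, c i * (ℓ ν * ℓ ν).eval (u i) = c ν := by
    rw [Finset.sum_eq_single ν]
    · rw [eval_mul, Lagrange.eval_basis_self huinj (Finset.mem_univ ν)]; ring
    · intro i _ hi
      rw [eval_mul, Lagrange.eval_basis_of_ne hi.symm (Finset.mem_univ i)]; ring
    · simp
  rw [h2] at h1
  rw [← h1]
  refine integral_pos_of_card_zeros_le hμ hpos (Polynomial.continuous _) ?_
      (ℓ ν).roots.toFinset ?_ ?_
  · intro t _; rw [eval_mul]; exact mul_self_nonneg _
  · exact ((Multiset.toFinset_card_le _).trans (card_roots' _)).trans (by omega)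
  · intro t ht
    rw [eval_mul, mul_self_eq_zero] at ht
    rw [Multiset.mem_toFinset, mem_roots hℓ0]
    exact ht

/-! ### The quadrature error: reduction to approximation, positivity, attainment -/

section Quadrature

variable {a b : ℝ} {M : ℕ} {W φ : ℝ → ℝ}

lemma laplaceStieltjes_zero_pos (hab : a < b) (hW : MonotoneOn W (Icc a b))
    (hinc : ((M + 1 : ℕ) : ℕ∞) ≤ {t | IsPointOfIncrease W a b t}.encard) :
    0 < laplaceStieltjes W a b 0 := by
  have := isFiniteMeasure_stieltjesMeasure hab.le hW
  unfold laplaceStieltjes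
  refine integral_pos_of_card_zeros_le (ae_mem_Icc_stieltjesMeasure hab.le hW)
    (stieltjesMeasure_compl_finset_pos hab.le hW hinc) (by fun_prop)
    (fun t _ => (Real.exp_pos _).le) ∅ (by simp) (fun t ht => absurd ht (Real.exp_ne_zero _))

lemma exists_isGaussQuadrature (hb : 0 < b) (hab : a < b) (hM : 1 ≤ M)
    (hW : MonotoneOn W (Icc a b))
    (hinc : ((M + 1 : ℕ) : ℕ∞) ≤ {t | IsPointOfIncrease W a b t}.encard)
    (hφ : IsVariableTransformation (a / b) φ) :
    ∃ u c : Fin M → ℝ, IsGaussQuadrature M (fun s => W (b * φ s)) u c := by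
  obtain ⟨e, he, h1, h2⟩ := exists_orderIso_extension hb hφ
  rw [mul_div_cancel₀ _ hb.ne'] at h1
  have hmono := monotoneOn_comp_transformation hW e he h1 h2
  have hfin := isFiniteMeasure_stieltjesMeasure (by norm_num : (-1 : ℝ) ≤ 1) hmono
  obtain ⟨u, c, hu, hmem, hc, hex⟩ := exists_gaussQuadrature (by norm_num : (-1 : ℝ) < 1)
    (ae_mem_Icc_stieltjesMeasure (by norm_num) hmono) hM (fun F hF => by
      have h := stieltjesMeasure_compl_finset_pos hab.le hW hinc (F.map e.toEmbedding)
        (by rwa [Finset.card_map])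
      rw [← map_stieltjesMeasure_comp hab.le hW e he h1 h2,
        Measure.map_apply e.continuous.measurable (Finset.measurableSet _).compl] at h
      convert h using 2
      ext s
      simp)
  exact ⟨u, c, hu, hmem, hc, hex⟩

lemma laplaceStieltjes_eq_integral_comp (hab : a ≤ b) (hW : MonotoneOn W (Icc a b)) (e : ℝ ≃o ℝ)
    (he : ∀ s ∈ Icc (-1 : ℝ) 1, e s = b * φ s) (h1 : e (-1) = a) (h2 : e 1 = b) (x : ℝ) :
    laplaceStieltjes W a b x =
      ∫ s, Real.exp (-x * e s) ∂(stieltjesMeasure (fun s => W (b * φ s)) (-1) 1) := by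
  unfold laplaceStieltjes
  rw [← map_stieltjesMeasure_comp hab hW e he h1 h2,
    integral_map e.continuous.measurable.aemeasurable]
  exact Continuous.aestronglyMeasurable (by fun_prop)

lemma IsGaussQuadrature.sum_weights {u c : Fin M → ℝ} (hb : 0 < b) (hab : a < b) (hM : 1 ≤ M)
    (hW : MonotoneOn W (Icc a b)) (hφ : IsVariableTransformation (a / b) φ)
    (hQ : IsGaussQuadrature M (fun s => W (b * φ s)) u c) :
    ∑ ν, c ν = laplaceStieltjes W a b 0 := by
  obtain ⟨e, he, h1, h2⟩ := exists_orderIso_extension hb hφ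
  rw [mul_div_cancel₀ _ hb.ne'] at h1
  have := hQ.exact 1 (by rw [natDegree_one]; omega)
  rw [laplaceStieltjes_eq_integral_comp hab.le hW e he h1 h2]
  simpa using this.symm

/-- The quadrature error is at most twice the error of polynomial approximation. -/
lemma IsGaussQuadrature.abs_expSumError_le {u c : Fin M → ℝ} (hb : 0 < b) (hab : a < b)
    (hM : 1 ≤ M) (hW : MonotoneOn W (Icc a b)) (hφ : IsVariableTransformation (a / b) φ)
    (hQ : IsGaussQuadrature M (fun s => W (b * φ s)) u c) {x ε : ℝ} {p : ℝ[X]}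
    (hp : p.natDegree < 2 * M)
    (hε : ∀ s ∈ Icc (-1 : ℝ) 1, |Real.exp (-b * φ s * x) - p.eval s| ≤ ε) :
    |expSumError W a b φ u c x| ≤ 2 * ε * laplaceStieltjes W a b 0 := by
  have hsum := hQ.sum_weights hb hab hM hW hφ
  obtain ⟨e, he, h1, h2⟩ := exists_orderIso_extension hb hφ
  rw [mul_div_cancel₀ _ hb.ne'] at h1
  have hmono := monotoneOn_comp_transformation hW e he h1 h2
  have hfin := isFiniteMeasure_stieltjesMeasure (by norm_num : (-1 : ℝ) ≤ 1) hmono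
  have hae := ae_mem_Icc_stieltjesMeasure (by norm_num : (-1 : ℝ) ≤ 1) hmono
  have hf0 := laplaceStieltjes_eq_integral_comp hab.le hW e he h1 h2 0
  have hfx := laplaceStieltjes_eq_integral_comp hab.le hW e he h1 h2 x
  set μ := stieltjesMeasure (fun s => W (b * φ s)) (-1) 1 with hμ
  have hmass : μ.real univ = laplaceStieltjes W a b 0 := by rw [hf0]; simp
  have hg : ∀ s ∈ Icc (-1 : ℝ) 1, Real.exp (-x * e s) = Real.exp (-b * φ s * x) := fun s hs => by
    rw [he s hs]; ring_nf
  -- By exactness `p` may be subtracted from the integrand on both sides; each of the two remaining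
  -- terms is at most `ε` times the mass `f(0)`.
  have hsplit : expSumError W a b φ u c x = ∫ s, (Real.exp (-x * e s) - p.eval s) ∂μ -
      ∑ ν, c ν * (Real.exp (-b * φ (u ν) * x) - p.eval (u ν)) := by
    rw [integral_sub (integrable_of_continuous_of_ae_mem_Icc hae (by fun_prop))
      (integrable_of_continuous_of_ae_mem_Icc hae p.continuous), hQ.exact p hp, expSumError, hfx]
    simp only [mul_sub, Finset.sum_sub_distrib]
    ring
  have hint : |∫ s, (Real.exp (-x * e s) - p.eval s) ∂μ| ≤ ε * laplaceStieltjes W a b 0 := by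
    rw [← hmass, ← Real.norm_eq_abs]
    refine norm_integral_le_of_norm_le_const (hae.mono fun s hs => ?_)
    rw [hg s hs]
    exact hε s hs
  have hfinsum : |∑ ν, c ν * (Real.exp (-b * φ (u ν) * x) - p.eval (u ν))| ≤
      ε * laplaceStieltjes W a b 0 := by
    rw [← hsum, Finset.mul_sum]
    refine (Finset.abs_sum_le_sum_abs _ _).trans (Finset.sum_le_sum fun ν _ => ?_)
    rw [abs_mul, abs_of_pos (hQ.weight_pos ν), mul_comm]
    exact mul_le_mul_of_nonneg_right (hε _ (Ioo_subset_Icc_self (hQ.mem_Ioo ν)))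
      (hQ.weight_pos ν).le
  rw [hsplit]
  calc _ ≤ _ := abs_sub _ _
    _ ≤ _ := add_le_add hint hfinsum
    _ = _ := by ring

/-- Otherwise the error vanishes at all `x = k ∈ ℕ`, so `dW` integrates polynomials in `e^{-t}` like
a sum over `M` points. The product of the squares `(X - y_ν)²` is then integrated to zero, though it
is nonnegative with at most `M` zeros in `t`. -/
lemma exists_expSumError_ne_zero (hab : a < b) (hW : MonotoneOn W (Icc a b))
    (hinc : ((M + 1 : ℕ) : ℕ∞) ≤ {t | IsPointOfIncrease W a b t}.encard) (u c : Fin M → ℝ) :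
    ∃ x ≥ 0, expSumError W a b φ u c x ≠ 0 := by
  by_contra! hcon
  have := isFiniteMeasure_stieltjesMeasure hab.le hW
  have hae := ae_mem_Icc_stieltjesMeasure hab.le hW
  let y : Fin M → ℝ := fun ν => Real.exp (-(b * φ (u ν)))
  have hpow : ∀ k : ℕ, ∫ t, Real.exp (-t) ^ k ∂(stieltjesMeasure W a b) = ∑ ν, c ν * y ν ^ k := by
    intro k
    have := hcon k (Nat.cast_nonneg k)
    rw [expSumError, sub_eq_zero, laplaceStieltjes] at this
    convert this using 3 with t
    · rw [← Real.exp_nat_mul]; ring_nf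
    · simp only [y]
      rw [← Real.exp_nat_mul]; ring_nf
  have hpoly : ∀ P : ℝ[X], ∫ t, P.eval (Real.exp (-t)) ∂(stieltjesMeasure W a b) =
      ∑ ν, c ν * P.eval (y ν) := by
    intro P
    simp only [eval_eq_sum_range, Finset.mul_sum]
    rw [integral_finsetSum, Finset.sum_comm]
    · refine Finset.sum_congr rfl fun k _ => ?_
      rw [integral_const_mul, hpow, Finset.mul_sum]
      refine Finset.sum_congr rfl fun ν _ => ?_
      ring
    · intro k _
      exact integrable_of_continuous_of_ae_mem_Icc hae (by fun_prop)
  have h0 := hpoly (∏ ν, (X - C (y ν)) ^ 2)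
  rw [Finset.sum_eq_zero] at h0
  · refine (integral_pos_of_card_zeros_le hae
      (stieltjesMeasure_compl_finset_pos hab.le hW hinc) (by fun_prop) (fun t _ => ?_)
      (Finset.univ.image fun ν => b * φ (u ν)) ?_ (fun t ht => ?_)).ne' h0
    · rw [eval_prod]
      exact Finset.prod_nonneg fun ν _ => by rw [eval_pow]; exact sq_nonneg _
    · exact Finset.card_image_le.trans (by simp)
    · rw [eval_prod, Finset.prod_eq_zero_iff] at ht
      obtain ⟨ν, _, hν⟩ := ht
      rw [eval_pow, sq_eq_zero_iff, eval_sub, eval_X, eval_C, sub_eq_zero, Real.exp_eq_exp,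
        neg_inj] at hν
      exact Finset.mem_image.2 ⟨ν, Finset.mem_univ _, hν.symm⟩
  · intro ν _
    rw [eval_prod, Finset.prod_eq_zero (Finset.mem_univ ν), mul_zero]
    simp

lemma continuousOn_laplaceStieltjes (ha : 0 < a) (hab : a < b) (hW : MonotoneOn W (Icc a b)) :
    ContinuousOn (laplaceStieltjes W a b) (Ici 0) := by
  have := isFiniteMeasure_stieltjesMeasure hab.le hW
  have hae := ae_mem_Icc_stieltjesMeasure hab.le hW
  refine continuousOn_of_dominated (bound := fun _ => 1) ?_ ?_ ?_ ?_
  · exact fun x _ => Continuous.aestronglyMeasurable (by fun_prop)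
  · intro x hx
    refine hae.mono fun t ht => ?_
    rw [Real.norm_eq_abs, abs_of_pos (Real.exp_pos _), Real.exp_le_one_iff]
    have : 0 ≤ x * t := mul_nonneg hx (ha.le.trans ht.1)
    linarith
  · exact integrable_const _
  · exact Filter.Eventually.of_forall fun t => by fun_prop

lemma tendsto_laplaceStieltjes_atTop (ha : 0 < a) (hab : a < b) (hW : MonotoneOn W (Icc a b)) :
    Filter.Tendsto (laplaceStieltjes W a b) Filter.atTop (nhds 0) := by
  have := isFiniteMeasure_stieltjesMeasure hab.le hW
  have hae := ae_mem_Icc_stieltjesMeasure hab.le hW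
  have : Filter.Tendsto (fun x => Real.exp (-(x * a)) * (stieltjesMeasure W a b).real univ)
      Filter.atTop (nhds 0) := by
    rw [← zero_mul ((stieltjesMeasure W a b).real univ)]
    exact (Real.tendsto_exp_neg_atTop_nhds_zero.comp
      (Filter.tendsto_id.atTop_mul_const ha)).mul_const _
  refine squeeze_zero_norm' ?_ this
  filter_upwards [Filter.Ici_mem_atTop (0 : ℝ)] with x hx
  refine norm_integral_le_of_norm_le_const (hae.mono fun t ht => ?_)
  rw [Real.norm_eq_abs, abs_of_pos (Real.exp_pos _), Real.exp_le_exp]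
  have := mul_le_mul_of_nonneg_left ht.1 hx
  linarith

/-- The maximum error of the exponential sum exists and is positive. -/
lemma exists_isGreatest_abs_expSumError (ha : 0 < a) (hab : a < b)
    (hW : MonotoneOn W (Icc a b))
    (hinc : ((M + 1 : ℕ) : ℕ∞) ≤ {t | IsPointOfIncrease W a b t}.encard)
    {u c : Fin M → ℝ} (hφ : ∀ ν, 0 < φ (u ν)) :
    ∃ m, IsGreatest ((fun x => |expSumError W a b φ u c x|) '' Ici 0) m ∧ 0 < m := by
  have hb : 0 < b := ha.trans hab
  set E : ℝ → ℝ := fun x => |expSumError W a b φ u c x| with hE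
  have hcont : ContinuousOn E (Ici 0) := by
    refine ((continuousOn_laplaceStieltjes ha hab hW).sub ?_).abs
    exact Continuous.continuousOn (by fun_prop)
  have hlim : Filter.Tendsto E Filter.atTop (nhds 0) := by
    rw [← abs_zero, ← sub_zero (0 : ℝ)]
    refine ((tendsto_laplaceStieltjes_atTop ha hab hW).sub ?_).abs
    rw [← Finset.sum_const_zero (ι := Fin M) (s := Finset.univ)]
    refine tendsto_finsetSum _ fun ν _ => ?_
    rw [← mul_zero (c ν)]
    refine Filter.Tendsto.const_mul _ ?_
    have h1 : (fun x => Real.exp (-b * φ (u ν) * x)) =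
        (fun x => Real.exp (-x)) ∘ fun x => b * φ (u ν) * x := by
      ext x; simp
    rw [h1]
    exact Real.tendsto_exp_neg_atTop_nhds_zero.comp
      (Filter.tendsto_id.const_mul_atTop (mul_pos hb (hφ ν)))
  obtain ⟨x₀, hx₀, hne⟩ := exists_expSumError_ne_zero (φ := φ) hab hW hinc u c
  have hpos : 0 < E x₀ := abs_pos.2 hne
  -- Beyond `R` the error stays below its value at `x₀`, so the maximum over a compact interval
  -- containing `x₀` is global.
  obtain ⟨R, hR⟩ := Filter.eventually_atTop.1 (hlim.eventually (gt_mem_nhds hpos))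
  have hx₀R : x₀ ≤ max R x₀ := le_max_right _ _
  obtain ⟨x₁, hx₁, hmax⟩ := (isCompact_Icc (a := 0) (b := max R x₀)).exists_isMaxOn
    ⟨x₀, hx₀, hx₀R⟩ (hcont.mono fun x hx => hx.1)
  have h01 : E x₀ ≤ E x₁ := hmax ⟨hx₀, hx₀R⟩
  refine ⟨E x₁, ⟨⟨x₁, hx₁.1, rfl⟩, ?_⟩, hpos.trans_le h01⟩
  rintro _ ⟨x, hx, rfl⟩
  rcases le_total x (max R x₀) with h | h
  · exact hmax ⟨hx, h⟩
  · exact (hR x ((le_max_left _ _).trans h)).le.trans h01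

end Quadrature

/-! ### Bernstein ellipses as images of strips under the cosine -/

lemma one_lt_eReal_cases {ρ : EReal} (h : 1 < ρ) : ρ = ⊤ ∨ ∃ r : ℝ, 1 < r ∧ ρ = r := by
  induction ρ with
  | bot => exact absurd h (by simp)
  | top => exact Or.inl rfl
  | coe r => exact Or.inr ⟨r, by exact_mod_cast h, rfl⟩

lemma bernsteinEllipse_top : bernsteinEllipse ⊤ = univ := by
  ext z; simp [bernsteinEllipse]

/-- With `h = log ρ` the semi-axes are `cosh h` and `sinh h`, and `cos (x + iy)` has coordinates
`cos x cosh y`, `-sin x sinh y`. The defining expression is the average, with weights `cos² x` and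
`sin² x`, of `cosh² y / cosh² h` and `sinh² y / sinh² h`, which are both below one exactly when `|y|
< h`. -/
lemma cos_mem_bernsteinEllipse_coe {ρ : ℝ} (hρ : 1 < ρ) (ζ : ℂ) :
    Complex.cos ζ ∈ bernsteinEllipse ρ ↔ Real.exp |ζ.im| < ρ := by
  have hρ0 : 0 < ρ := by linarith
  set h := Real.log ρ with hh
  have hpos : 0 < h := Real.log_pos hρ
  have he : ρ = Real.exp h := (Real.exp_log hρ0).symm
  have hc : (ρ + ρ⁻¹) / 2 = Real.cosh h := by rw [Real.cosh_eq, Real.exp_neg, ← he]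
  have hs : (ρ - ρ⁻¹) / 2 = Real.sinh h := by rw [Real.sinh_eq, Real.exp_neg, ← he]
  have hre : (Complex.cos ζ).re = Real.cos ζ.re * Real.cosh ζ.im := by
    rw [Complex.cos_eq]; simp [← Complex.ofReal_cos, ← Complex.ofReal_cosh, ← Complex.ofReal_sin,
      ← Complex.ofReal_sinh]
  have him : (Complex.cos ζ).im = -(Real.sin ζ.re * Real.sinh ζ.im) := by
    rw [Complex.cos_eq]; simp [← Complex.ofReal_cos, ← Complex.ofReal_cosh, ← Complex.ofReal_sin,
      ← Complex.ofReal_sinh]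
  have hmem : Complex.cos ζ ∈ bernsteinEllipse ρ ↔ Real.cos ζ.re ^ 2 *
      (Real.cosh ζ.im ^ 2 / Real.cosh h ^ 2) + Real.sin ζ.re ^ 2 *
      (Real.sinh ζ.im ^ 2 / Real.sinh h ^ 2) < 1 := by
    simp only [bernsteinEllipse, mem_ofPred_eq, EReal.coe_ne_top, false_or, EReal.toReal_coe, hc, hs,
      hre, him]
    ring_nf
  have hcs := Real.cos_sq_add_sin_sq ζ.re
  have hch : 0 < Real.cosh h ^ 2 := pow_pos (Real.cosh_pos h) 2
  have hsh : 0 < Real.sinh h ^ 2 := pow_pos (Real.sinh_pos_iff.2 hpos) 2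
  rw [hmem, he, Real.exp_lt_exp]
  constructor
  · intro hlt
    by_contra! hge
    have h1 : 1 ≤ Real.cosh ζ.im ^ 2 / Real.cosh h ^ 2 := by
      rw [one_le_div hch]
      exact pow_le_pow_left₀ (Real.cosh_pos h).le
        (Real.cosh_le_cosh.2 (by rwa [abs_of_pos hpos])) 2
    have h2 : 1 ≤ Real.sinh ζ.im ^ 2 / Real.sinh h ^ 2 := by
      rw [one_le_div hsh, ← sq_abs (Real.sinh ζ.im), Real.abs_sinh]
      exact pow_le_pow_left₀ (Real.sinh_nonneg_iff.2 hpos.le) (Real.sinh_le_sinh.2 hge) 2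
    nlinarith [sq_nonneg (Real.cos ζ.re), sq_nonneg (Real.sin ζ.re)]
  · intro hlt
    have h1 : Real.cosh ζ.im ^ 2 / Real.cosh h ^ 2 < 1 := by
      rw [div_lt_one hch]
      exact pow_lt_pow_left₀ (Real.cosh_lt_cosh.2 (by rwa [abs_of_pos hpos]))
        (Real.cosh_pos _).le two_ne_zero
    have h2 : Real.sinh ζ.im ^ 2 / Real.sinh h ^ 2 < 1 := by
      rw [div_lt_one hsh, ← sq_abs (Real.sinh ζ.im), Real.abs_sinh]
      exact pow_lt_pow_left₀ (Real.sinh_lt_sinh.2 hlt)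
        (Real.sinh_nonneg_iff.2 (abs_nonneg _)) two_ne_zero
    rcases le_total (Real.cosh ζ.im ^ 2 / Real.cosh h ^ 2) (Real.sinh ζ.im ^ 2 / Real.sinh h ^ 2)
      with h3 | h3
    · nlinarith [sq_nonneg (Real.cos ζ.re)]
    · nlinarith [sq_nonneg (Real.sin ζ.re)]

/-- Membership in the Bernstein ellipse in the parametrization by the cosine. -/
lemma cos_mem_bernsteinEllipse {ρ : EReal} (hρ : 1 < ρ) (ζ : ℂ) :
    Complex.cos ζ ∈ bernsteinEllipse ρ ↔ ((Real.exp |ζ.im| : ℝ) : EReal) < ρ := by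
  rcases one_lt_eReal_cases hρ with rfl | ⟨r, hr, rfl⟩
  · simp [bernsteinEllipse_top, EReal.coe_lt_top]
  · rw [cos_mem_bernsteinEllipse_coe hr, EReal.coe_lt_coe_iff]

lemma mem_bernsteinEllipse_iff {ρ : EReal} (hρ : 1 < ρ) (z : ℂ) :
    z ∈ bernsteinEllipse ρ ↔ ∃ ζ, Complex.cos ζ = z ∧ ((Real.exp |ζ.im| : ℝ) : EReal) < ρ := by
  constructor
  · intro hz
    obtain ⟨ζ, rfl⟩ := Complex.cos_surjective z
    exact ⟨ζ, rfl, (cos_mem_bernsteinEllipse hρ ζ).1 hz⟩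
  · rintro ⟨ζ, rfl, h⟩
    exact (cos_mem_bernsteinEllipse hρ ζ).2 h

lemma bernsteinEllipse_mono {ρ₁ ρ₂ : EReal} (h1 : 1 < ρ₁) (h : ρ₁ ≤ ρ₂) :
    bernsteinEllipse ρ₁ ⊆ bernsteinEllipse ρ₂ := by
  intro z hz
  obtain ⟨ζ, rfl, hζ⟩ := (mem_bernsteinEllipse_iff h1 z).1 hz
  exact (cos_mem_bernsteinEllipse (h1.trans_le h) ζ).2 (hζ.trans_le h)

lemma isOpen_bernsteinEllipse {ρ : EReal} (hρ : 1 < ρ) : IsOpen (bernsteinEllipse ρ) := by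
  rcases one_lt_eReal_cases hρ with rfl | ⟨r, hr, rfl⟩
  · rw [bernsteinEllipse_top]; exact isOpen_univ
  · simp only [bernsteinEllipse, EReal.coe_ne_top, false_or, EReal.toReal_coe]
    exact isOpen_lt (by fun_prop) continuous_const

lemma isPreconnected_bernsteinEllipse {ρ : EReal} (hρ : 1 < ρ) :
    IsPreconnected (bernsteinEllipse ρ) := by
  have h : bernsteinEllipse ρ = Complex.cos '' {ζ | ((Real.exp |ζ.im| : ℝ) : EReal) < ρ} := by
    ext z
    rw [mem_bernsteinEllipse_iff hρ]
    exact ⟨fun ⟨ζ, h1, h2⟩ => ⟨ζ, h2, h1⟩, fun ⟨ζ, h2, h1⟩ => ⟨ζ, h1, h2⟩⟩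
  rw [h]
  refine IsPreconnected.image ?_ _ Complex.continuous_cos.continuousOn
  rcases one_lt_eReal_cases hρ with rfl | ⟨r, hr, rfl⟩
  · simp only [EReal.coe_lt_top, ofPred_true]; exact isPreconnected_univ
  · simp only [EReal.coe_lt_coe_iff]
    have : {ζ : ℂ | Real.exp |ζ.im| < r} = Complex.imLm ⁻¹' Ioo (-Real.log r) (Real.log r) := by
      ext ζ
      rw [mem_ofPred_eq, ← Real.lt_log_iff_exp_lt (by linarith), abs_lt]
      rfl
    rw [this]
    exact ((convex_Ioo _ _).linear_preimage Complex.imLm).isPreconnected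

lemma real_mem_bernsteinEllipse {ρ : EReal} (hρ : 1 < ρ) {s : ℝ} (hs : s ∈ Icc (-1 : ℝ) 1) :
    (s : ℂ) ∈ bernsteinEllipse ρ := by
  rw [← Real.cos_arccos hs.1 hs.2, Complex.ofReal_cos, cos_mem_bernsteinEllipse hρ]
  simpa using hρ

/-- Every point of a Bernstein ellipse lies in a smaller finite one. -/
lemma exists_coe_lt_mem_bernsteinEllipse {ρ : EReal} (hρ : 1 < ρ) {z : ℂ}
    (hz : z ∈ bernsteinEllipse ρ) : ∃ r : ℝ, 1 < r ∧ (r : EReal) < ρ ∧ z ∈ bernsteinEllipse r := by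
  obtain ⟨ζ, rfl, hζ⟩ := (mem_bernsteinEllipse_iff hρ z).1 hz
  obtain ⟨r, hr1, hr2⟩ := EReal.lt_iff_exists_real_btwn.1 hζ
  have hr : 1 < r := (Real.one_le_exp (abs_nonneg _)).trans_lt (EReal.coe_lt_coe_iff.1 hr1)
  exact ⟨r, hr, hr2, (cos_mem_bernsteinEllipse (by exact_mod_cast hr) ζ).2 hr1⟩

/-- Identity theorem on a connected ellipse: the two functions agree on `(0, 1)`, which accumulates
at `0`. -/
lemma IsAnalyticContinuation.eqOn {F : ℝ → ℝ} {g₁ g₂ : ℂ → ℂ} {ρ : EReal} (hρ : 1 < ρ)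
    (h1 : IsAnalyticContinuation F g₁ (bernsteinEllipse ρ))
    (h2 : IsAnalyticContinuation F g₂ (bernsteinEllipse ρ)) : EqOn g₁ g₂ (bernsteinEllipse ρ) := by
  refine h1.1.eqOn_of_preconnected_of_frequently_eq h2.1 (isPreconnected_bernsteinEllipse hρ)
    (z₀ := 0) (by exact_mod_cast real_mem_bernsteinEllipse hρ (s := 0) (by norm_num)) ?_
  have ht : Filter.Tendsto (fun s : ℝ => (s : ℂ)) (nhdsWithin 0 (Ioi 0)) (nhdsWithin 0 {0}ᶜ) := by
    apply tendsto_nhdsWithin_of_tendsto_nhds_of_eventually_within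
    · exact (Complex.continuous_ofReal.tendsto' 0 0 (by simp)).mono_left nhdsWithin_le_nhds
    · filter_upwards [self_mem_nhdsWithin] with s hs
      simpa using (ne_of_gt hs : s ≠ 0)
  refine ht.frequently (Filter.Eventually.frequently ?_)
  filter_upwards [Ioo_mem_nhdsGT (zero_lt_one' ℝ)] with s hs
  have hs' : s ∈ Icc (-1 : ℝ) 1 := ⟨by linarith [hs.1], hs.2.le⟩
  rw [h1.2 s hs', h2.2 s hs']

lemma IsAnalyticContinuation.mono {F : ℝ → ℝ} {g : ℂ → ℂ} {U V : Set ℂ}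
    (h : IsAnalyticContinuation F g V) (hUV : U ⊆ V) : IsAnalyticContinuation F g U :=
  ⟨h.1.mono hUV, h.2⟩

lemma exists_continuation_of_lt_rhoA {F : ℝ → ℝ} {r : EReal} (h1 : 1 < r) (hr : r < rhoA F) :
    ∃ g, IsAnalyticContinuation F g (bernsteinEllipse r) := by
  obtain ⟨ρ, hρ, hrρ⟩ := lt_sSup_iff.1 hr
  rcases hρ with hρ | ⟨-, g, hg⟩
  · rw [mem_singleton_iff] at hρ
    exact absurd (h1.trans hrρ) (by rw [hρ]; exact lt_irrefl _)
  · exact ⟨g, hg.mono (bernsteinEllipse_mono h1 hrρ.le)⟩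

/-- The continuations to the smaller ellipses glue to one to the largest ellipse. -/
lemma isAnalyticContinuation_analyticContinuation {F : ℝ → ℝ} (hρ : 1 < rhoA F) :
    IsAnalyticContinuation F (analyticContinuation F) (bernsteinEllipse (rhoA F)) := by
  refine Classical.epsilon_spec
    (p := fun g => IsAnalyticContinuation F g (bernsteinEllipse (rhoA F))) ?_
  have hex : ∀ r : ℝ, ∃ g, 1 < r → (r : EReal) < rhoA F →
      IsAnalyticContinuation F g (bernsteinEllipse r) := by
    intro r
    by_cases h : 1 < r ∧ (r : EReal) < rhoA F
    · obtain ⟨g, hg⟩ := exists_continuation_of_lt_rhoA (by exact_mod_cast h.1) h.2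
      exact ⟨g, fun _ _ => hg⟩
    · exact ⟨0, fun h1 h2 => absurd ⟨h1, h2⟩ h⟩
  choose g hg using hex
  have hR : ∀ z : ℂ, ∃ r : ℝ, z ∈ bernsteinEllipse (rhoA F) →
      1 < r ∧ (r : EReal) < rhoA F ∧ z ∈ bernsteinEllipse r := by
    intro z
    by_cases hz : z ∈ bernsteinEllipse (rhoA F)
    · obtain ⟨r, hr⟩ := exists_coe_lt_mem_bernsteinEllipse hρ hz
      exact ⟨r, fun _ => hr⟩
    · exact ⟨0, fun h => absurd h hz⟩
  choose R hR using hR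
  -- The supremum defining `rhoA` need not be attained a priori. The ellipses are nested, so by
  -- uniqueness the value does not depend on the ellipse `R z` chosen around `z`.
  have hglue : ∀ r : ℝ, 1 < r → (r : EReal) < rhoA F → ∀ z ∈ bernsteinEllipse r,
      g (R z) z = g r z := by
    intro r hr1 hr2 z hz
    obtain ⟨h1, h2, h3⟩ := hR z (bernsteinEllipse_mono (by exact_mod_cast hr1) hr2.le hz)
    have h1' : (1 : EReal) < R z := by exact_mod_cast h1
    have hr1' : (1 : EReal) < r := by exact_mod_cast hr1
    rcases le_total (R z) r with hle | hle
    · exact (hg _ h1 h2).eqOn h1' ((hg r hr1 hr2).mono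
        (bernsteinEllipse_mono h1' (by exact_mod_cast hle))) h3
    · exact ((hg _ h1 h2).mono
        (bernsteinEllipse_mono hr1' (by exact_mod_cast hle))).eqOn hr1' (hg r hr1 hr2) hz
  refine ⟨fun z => g (R z) z, fun z hz => ?_, fun s hs => ?_⟩
  · obtain ⟨h1, h2, h3⟩ := hR z hz
    refine ((hg _ h1 h2).1 z h3).congr ?_
    filter_upwards [(isOpen_bernsteinEllipse (by exact_mod_cast h1)).mem_nhds h3] with w hw
    exact (hglue _ h1 h2 w hw).symm
  · obtain ⟨h1, h2, h3⟩ := hR s (real_mem_bernsteinEllipse hρ hs)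
    exact (hg _ h1 h2).2 s hs

/-- Periodicity reduces a horizontal strip to a rectangle, where compactness is available. -/
lemma exists_cos_eq_re_mem_Icc (ζ : ℂ) : ∃ ζ' : ℂ, Complex.cos ζ' = Complex.cos ζ ∧
    ζ'.im = ζ.im ∧ ζ'.re ∈ Icc 0 (2 * Real.pi) := by
  have h := toIcoMod_mem_Ico Real.two_pi_pos 0 ζ.re
  refine ⟨ζ - toIcoDiv Real.two_pi_pos 0 ζ.re * (2 * Real.pi), Complex.cos_sub_int_mul_two_pi _ _,
    ?_, ?_⟩
  · simp
  · rw [toIcoMod, zsmul_eq_mul, zero_add] at h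
    have : (ζ - toIcoDiv Real.two_pi_pos 0 ζ.re * (2 * Real.pi)).re =
        ζ.re - toIcoDiv Real.two_pi_pos 0 ζ.re * (2 * Real.pi) := by simp
    rw [this]
    exact Ico_subset_Icc_self h

/-! ### The infimum of the real part: convexity, its zero, its supporting line -/

section InfRe

variable {F : ℝ → ℝ}

lemma infRe_le {ρ : EReal} {z : ℂ} (hz : z ∈ bernsteinEllipse ρ) :
    infRe F ρ ≤ ((analyticContinuation F z).re : EReal) := iInf₂_le z hz

lemma infRe_antitone {ρ₁ ρ₂ : EReal} (h1 : 1 < ρ₁) (h : ρ₁ ≤ ρ₂) : infRe F ρ₂ ≤ infRe F ρ₁ :=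
  le_iInf₂ fun _ hz => infRe_le (bernsteinEllipse_mono h1 h hz)

lemma analyticContinuation_ofReal (hF : 1 < rhoA F) {s : ℝ} (hs : s ∈ Icc (-1 : ℝ) 1) :
    analyticContinuation F s = F s :=
  (isAnalyticContinuation_analyticContinuation hF).2 s hs

lemma infRe_le_apply (hF : 1 < rhoA F) {ρ : EReal} (hρ : 1 < ρ) {s : ℝ}
    (hs : s ∈ Icc (-1 : ℝ) 1) : infRe F ρ ≤ (F s : EReal) := by
  have := infRe_le (F := F) (real_mem_bernsteinEllipse hρ hs)
  rwa [analyticContinuation_ofReal hF hs, Complex.ofReal_re] at this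

lemma differentiableAt_continuation_cos (hF : 1 < rhoA F) {ζ : ℂ}
    (hζ : ((Real.exp |ζ.im| : ℝ) : EReal) < rhoA F) :
    DifferentiableAt ℂ (fun ζ => analyticContinuation F (Complex.cos ζ)) ζ :=
  (((isAnalyticContinuation_analyticContinuation hF).1 _
    ((cos_mem_bernsteinEllipse hF ζ).2 hζ)).differentiableAt).comp ζ
    (Complex.differentiable_cos ζ)

/-- Below `rhoA F` the closed strip `|Im ζ| ≤ log r` still lies in the domain of analyticity, and
modulo `2π` it is compact. -/
lemma infRe_ne_bot (hF : 1 < rhoA F) {r : ℝ} (hr1 : 1 < r) (hr : (r : EReal) < rhoA F) :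
    infRe F r ≠ ⊥ := by
  set K : Set ℂ := Icc 0 (2 * Real.pi) ×ℂ Icc (-Real.log r) (Real.log r) with hK
  have hKc : IsCompact K := isCompact_Icc.reProdIm isCompact_Icc
  have habs : ∀ y : ℝ, |y| ≤ Real.log r ↔ Real.exp |y| ≤ r := fun y => by
    rw [Real.le_log_iff_exp_le (by linarith)]
  have hcont : ContinuousOn (fun ζ => (analyticContinuation F (Complex.cos ζ)).re) K := by
    intro ζ hζ
    refine (Complex.continuous_re.continuousAt.comp
      (differentiableAt_continuation_cos hF ?_).continuousAt).continuousWithinAt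
    have : Real.exp |ζ.im| ≤ r := (habs _).1 (abs_le.2 (Complex.mem_reProdIm.1 hζ).2)
    exact lt_of_le_of_lt (by exact_mod_cast this) hr
  obtain ⟨C, hC⟩ := hKc.bddBelow_image hcont
  have : (C : EReal) ≤ infRe F r := by
    refine le_iInf₂ fun z hz => ?_
    obtain ⟨ζ, rfl, hζ⟩ := (mem_bernsteinEllipse_iff (by exact_mod_cast hr1) z).1 hz
    obtain ⟨ζ', h1, h2, h3⟩ := exists_cos_eq_re_mem_Icc ζ
    have hmem : ζ' ∈ K := by
      refine Complex.mem_reProdIm.2 ⟨h3, abs_le.1 ?_⟩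
      rw [habs, h2]
      exact (EReal.coe_lt_coe_iff.1 hζ).le
    rw [← h1]
    exact_mod_cast hC ⟨ζ', hmem, rfl⟩
  exact ne_bot_of_le_ne_bot (EReal.coe_ne_bot C) this

/-- On `rhoInterval F` the infimum is finite, so `toReal` never takes its default value; at the
endpoint `rhoA F` this is built into the definition of the interval. -/
lemma coe_infRe_toReal (hF : 1 < rhoA F) {r : ℝ} (hr : r ∈ rhoInterval F) :
    (((infRe F r).toReal : ℝ) : EReal) = infRe F r := by
  have h1 : (1 : EReal) < r := by exact_mod_cast hr.1
  refine EReal.coe_toReal (ne_top_of_le_ne_top (EReal.coe_ne_top _)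
    (infRe_le_apply hF h1 (s := 1) (by norm_num))) ?_
  rcases hr.2 with h | ⟨h, h'⟩
  · exact infRe_ne_bot hF hr.1 h
  · rwa [h]

lemma infRe_toReal_le (hF : 1 < rhoA F) {r : ℝ} (hr : r ∈ rhoInterval F) {z : ℂ}
    (hz : z ∈ bernsteinEllipse r) : (infRe F r).toReal ≤ (analyticContinuation F z).re := by
  have := infRe_le (F := F) hz
  rw [← coe_infRe_toReal hF hr] at this
  exact_mod_cast this

lemma le_infRe_toReal (hF : 1 < rhoA F) {r : ℝ} (hr : r ∈ rhoInterval F) {c : ℝ}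
    (hc : ∀ z ∈ bernsteinEllipse r, c ≤ (analyticContinuation F z).re) :
    c ≤ (infRe F r).toReal := by
  have : (c : EReal) ≤ infRe F r := le_iInf₂ fun z hz => by exact_mod_cast hc z hz
  rw [← coe_infRe_toReal hF hr] at this
  exact_mod_cast this

lemma infRe_toReal_le_apply (hF : 1 < rhoA F) {r : ℝ} (hr : r ∈ rhoInterval F) {s : ℝ}
    (hs : s ∈ Icc (-1 : ℝ) 1) : (infRe F r).toReal ≤ F s := by
  have := infRe_le_apply hF (ρ := r) (by exact_mod_cast hr.1) hs
  rw [← coe_infRe_toReal hF hr] at this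
  exact_mod_cast this

lemma infRe_toReal_antitone (hF : 1 < rhoA F) {r₁ r₂ : ℝ} (h1 : r₁ ∈ rhoInterval F)
    (h2 : r₂ ∈ rhoInterval F) (h : r₁ ≤ r₂) : (infRe F r₂).toReal ≤ (infRe F r₁).toReal := by
  have := infRe_antitone (F := F) (ρ₁ := r₁) (ρ₂ := r₂) (by exact_mod_cast h1.1)
    (by exact_mod_cast h)
  rw [← coe_infRe_toReal hF h1, ← coe_infRe_toReal hF h2] at this
  exact_mod_cast this

lemma coe_le_rhoA_of_mem {r : ℝ} (hr : r ∈ rhoInterval F) : (r : EReal) ≤ rhoA F :=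
  hr.2.elim le_of_lt fun h => h.1.le

/-- Three lines theorem for the real part of an analytic function on Bernstein ellipses. -/
lemma three_lines_infRe (hF : 1 < rhoA F) {h₁ h₃ : ℝ} (hlt : h₁ < h₃)
    (hm1 : Real.exp h₁ ∈ rhoInterval F) (hm3 : Real.exp h₃ ∈ rhoInterval F) {δ : ℝ} (hδ : 0 < δ)
    (hδ1 : δ < h₁) {ζ : ℂ} (hζ : ζ.im ∈ Icc (h₁ - δ) (h₃ - δ)) :
    (1 - (ζ.im - (h₁ - δ)) / (h₃ - h₁)) * (infRe F (Real.exp h₁)).toReal +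
      (ζ.im - (h₁ - δ)) / (h₃ - h₁) * (infRe F (Real.exp h₃)).toReal ≤
      (analyticContinuation F (Complex.cos ζ)).re := by
  set G := analyticContinuation F with hG
  set m₁ := (infRe F (Real.exp h₁)).toReal
  set m₃ := (infRe F (Real.exp h₃)).toReal
  -- The modulus of `f` is `e^{-Re G}`, so upper bounds for it are lower bounds for `Re G`; the
  -- factor `I` turns horizontal strips into the vertical ones of Hadamard's theorem.
  let f : ℂ → ℂ := fun w => Complex.exp (-G (Complex.cos (Complex.I * w)))
  have him : ∀ w : ℂ, (Complex.I * w).im = w.re := fun w => by simp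
  have hfn : ∀ w, ‖f w‖ = Real.exp (-(G (Complex.cos (Complex.I * w))).re) := fun w => by
    simp [f, Complex.norm_exp]
  have hcos : ∀ {h : ℝ} (_ : Real.exp h ∈ rhoInterval F) {w : ℂ}, |w.re| < h →
      Complex.cos (Complex.I * w) ∈ bernsteinEllipse (Real.exp h) := by
    intro h hh w hw
    rw [cos_mem_bernsteinEllipse_coe hh.1, him, Real.exp_lt_exp]
    exact hw
  -- Shifting the lines by `δ` keeps them inside the open ellipses. On the line at height `h₃`
  -- itself nothing is known, since `e^{h₃}` may equal `rhoA F`.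
  have hb3 : ∀ w ∈ Complex.HadamardThreeLines.verticalClosedStrip (h₁ - δ) (h₃ - δ),
      ‖f w‖ ≤ Real.exp (-m₃) := by
    intro w hw
    rw [hfn, Real.exp_le_exp, neg_le_neg_iff]
    refine infRe_toReal_le hF hm3 (hcos hm3 ?_)
    have h1 : h₁ - δ ≤ w.re := hw.1
    have h2 : w.re ≤ h₃ - δ := hw.2
    rw [abs_of_nonneg (by linarith)]; linarith
  have hclosure : closure (Complex.HadamardThreeLines.verticalStrip (h₁ - δ) (h₃ - δ)) ⊆
      Complex.HadamardThreeLines.verticalClosedStrip (h₁ - δ) (h₃ - δ) :=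
    closure_minimal (preimage_mono Ioo_subset_Icc_self)
      (isClosed_Icc.preimage Complex.continuous_re)
  have hd : DiffContOnCl ℂ f (Complex.HadamardThreeLines.verticalStrip (h₁ - δ) (h₃ - δ)) := by
    refine DifferentiableOn.diffContOnCl fun w hw => ?_
    have hw' := hclosure hw
    have h1 : h₁ - δ ≤ w.re := hw'.1
    have h2 : w.re ≤ h₃ - δ := hw'.2
    have h3 : ((Real.exp |(Complex.I * w).im| : ℝ) : EReal) < rhoA F := by
      refine lt_of_lt_of_le ?_ (coe_le_rhoA_of_mem hm3)
      rw [EReal.coe_lt_coe_iff, Real.exp_lt_exp, him, abs_of_nonneg (by linarith)]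
      linarith
    have h4 : DifferentiableAt ℂ (fun w : ℂ => Complex.I * w) w := by fun_prop
    exact ((DifferentiableAt.comp w (differentiableAt_continuation_cos hF h3)
      h4).neg.cexp).differentiableWithinAt
  have hkey := Complex.HadamardThreeLines.norm_le_interp_of_mem_verticalClosedStrip'
    (f := f) (z := -Complex.I * ζ) (a := Real.exp (-m₁)) (b := Real.exp (-m₃))
    (l := h₁ - δ) (u := h₃ - δ) (by linarith)
    (by simpa [Complex.HadamardThreeLines.verticalClosedStrip] using hζ) hd
    ⟨Real.exp (-m₃), by rintro _ ⟨w, hw, rfl⟩; exact hb3 w hw⟩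
    (fun w hw => by
      rw [hfn, Real.exp_le_exp, neg_le_neg_iff]
      refine infRe_toReal_le hF hm1 (hcos hm1 ?_)
      have : w.re = h₁ - δ := hw
      rw [this, abs_of_nonneg (by linarith)]; linarith)
    (fun w hw => hb3 w (by
      have : w.re = h₃ - δ := hw
      exact ⟨by linarith, this.le⟩))
  have h5 : Complex.I * (-Complex.I * ζ) = ζ := by
    rw [← mul_assoc, mul_neg, Complex.I_mul_I, neg_neg, one_mul]
  have h6 : (-Complex.I * ζ).re = ζ.im := by simp
  rw [hfn, h5, h6, ← Real.exp_mul, ← Real.exp_mul, ← Real.exp_add, Real.exp_le_exp] at hkey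
  have h7 : h₃ - δ - (h₁ - δ) = h₃ - h₁ := by ring
  rw [h7] at hkey
  linarith

lemma ordConnected_log_rhoInterval : OrdConnected {h : ℝ | Real.exp h ∈ rhoInterval F} := by
  refine ⟨fun x hx y hy t ht => ⟨hx.1.trans_le (Real.exp_le_exp.2 ht.1), ?_⟩⟩
  rcases ht.2.lt_or_eq with h | rfl
  · refine Or.inl (lt_of_lt_of_le ?_ (coe_le_rhoA_of_mem hy))
    exact_mod_cast Real.exp_lt_exp.2 h
  · exact hy.2

/-- Three lines theorem for `exp (-F)` on strips. A point of the ellipse at height `y < h₂` is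
either below `h₁`, where `m₁ ≥ m₃` bounds the real part, or it lies between the lines shifted by
`δ`. -/
lemma convexOn_neg_infRe (hF : 1 < rhoA F) :
    ConvexOn ℝ {h : ℝ | Real.exp h ∈ rhoInterval F} fun h => -(infRe F (Real.exp h)).toReal := by
  have hconv : Convex ℝ {h : ℝ | Real.exp h ∈ rhoInterval F} :=
    ordConnected_log_rhoInterval.convex
  refine LinearOrder.convexOn_of_lt hconv fun h₁ hm1 h₃ hm3 hlt α β hα hβ hαβ => ?_
  have hm2 : α * h₁ + β * h₃ ∈ {h : ℝ | Real.exp h ∈ rhoInterval F} :=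
    hconv hm1 hm3 hα.le hβ.le hαβ
  simp only [smul_eq_mul]
  set h₂ := α * h₁ + β * h₃ with hh2
  have hα' : α = 1 - β := by linarith
  have h12 : h₂ - h₁ = β * (h₃ - h₁) := by rw [hh2, hα']; ring
  have hlt' : 0 < h₃ - h₁ := sub_pos.2 hlt
  have hh1 : 0 < h₁ := Real.one_lt_exp_iff.1 hm1.1
  have h23 : h₂ ≤ h₃ := by nlinarith
  have hmono := infRe_toReal_antitone hF hm1 hm3 (Real.exp_le_exp.2 hlt.le)
  set m₁ := (infRe F (Real.exp h₁)).toReal with hmm1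
  set m₃ := (infRe F (Real.exp h₃)).toReal with hmm3
  suffices α * m₁ + β * m₃ ≤ (infRe F (Real.exp h₂)).toReal by linarith
  refine le_infRe_toReal hF hm2 fun z hz => ?_
  have hex : ∃ ζ : ℂ, Complex.cos ζ = z ∧ 0 ≤ ζ.im := by
    obtain ⟨ζ, hζ⟩ := Complex.cos_surjective z
    rcases le_total 0 ζ.im with h | h
    · exact ⟨ζ, hζ, h⟩
    · exact ⟨-ζ, by rw [Complex.cos_neg, hζ], by simpa using h⟩
  obtain ⟨ζ, rfl, hζ0⟩ := hex
  have hζ2 := (cos_mem_bernsteinEllipse_coe hm2.1 ζ).1 hz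
  rw [Real.exp_lt_exp, abs_of_nonneg hζ0] at hζ2
  rcases lt_or_ge ζ.im h₁ with hlt1 | hge1
  · have : m₁ ≤ (analyticContinuation F (Complex.cos ζ)).re := by
      refine infRe_toReal_le hF hm1 ((cos_mem_bernsteinEllipse_coe hm1.1 ζ).2 ?_)
      rwa [Real.exp_lt_exp, abs_of_nonneg hζ0]
    rw [hα']
    nlinarith
  -- The choice `δ < h₂ - Im ζ` makes the interpolation weight at most `β`, and since `m₃ ≤ m₁` a
  -- smaller weight on `m₃` only raises the lower bound.
  · obtain ⟨δ, hδ0, hδ⟩ := exists_between (lt_min hh1 (sub_pos.2 hζ2))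
    have hδ1 := hδ.trans_le (min_le_left _ _)
    have hδ2 := hδ.trans_le (min_le_right _ _)
    have h3l := three_lines_infRe hF hlt hm1 hm3 hδ0 hδ1 (ζ := ζ)
      ⟨by linarith, by linarith⟩
    rw [← hmm1, ← hmm3] at h3l
    refine le_trans ?_ h3l
    have ht : (ζ.im - (h₁ - δ)) / (h₃ - h₁) ≤ β := by
      rw [div_le_iff₀ hlt']; linarith
    set t := (ζ.im - (h₁ - δ)) / (h₃ - h₁)
    rw [hα']
    nlinarith

/-- The infimum of the real part is positive on small ellipses if `F` is positive. -/
lemma exists_infRe_pos (hF : 1 < rhoA F) {c : ℝ} (hc : 0 < c)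
    (hFc : ∀ s ∈ Icc (-1 : ℝ) 1, c ≤ F s) :
    ∃ r : ℝ, 1 < r ∧ (r : EReal) < rhoA F ∧ 0 < (infRe F r).toReal := by
  obtain ⟨r₀, h1, h2, -⟩ := exists_coe_lt_mem_bernsteinEllipse hF
    (real_mem_bernsteinEllipse hF (s := 0) (by norm_num))
  have hcont : ContinuousOn (fun ζ => (analyticContinuation F (Complex.cos ζ)).re)
      (Complex.cos ⁻¹' bernsteinEllipse (rhoA F)) := fun ζ hζ =>
    (Complex.continuous_re.continuousAt.comp (differentiableAt_continuation_cos hF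
      ((cos_mem_bernsteinEllipse hF ζ).1 hζ)).continuousAt).continuousWithinAt
  have hU := hcont.isOpen_inter_preimage
    ((isOpen_bernsteinEllipse hF).preimage Complex.continuous_cos) (isOpen_Ioi (a := c / 2))
  have hKc : IsCompact ((fun x : ℝ => (x : ℂ)) '' Icc 0 (2 * Real.pi)) :=
    isCompact_Icc.image Complex.continuous_ofReal
  -- The condition `Re F(cos ζ) > c / 2` is open and holds on one real period, hence on a
  -- neighbourhood of it of uniform width `δ`.
  obtain ⟨δ, hδ, hsub⟩ := hKc.exists_thickening_subset_open hU (by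
    rintro _ ⟨x, -, rfl⟩
    have hx : Real.cos x ∈ Icc (-1 : ℝ) 1 := Real.cos_mem_Icc x
    refine ⟨?_, ?_⟩
    · rw [mem_preimage, ← Complex.ofReal_cos]; exact real_mem_bernsteinEllipse hF hx
    · rw [mem_preimage, ← Complex.ofReal_cos, analyticContinuation_ofReal hF hx, Complex.ofReal_re,
        mem_Ioi]
      linarith [hFc _ hx])
  have hmin : 1 < min r₀ (Real.exp δ) := lt_min h1 (Real.one_lt_exp_iff.2 hδ)
  have hlt : ((min r₀ (Real.exp δ) : ℝ) : EReal) < rhoA F :=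
    lt_of_le_of_lt (by exact_mod_cast min_le_left _ _) h2
  refine ⟨_, hmin, hlt, (half_pos hc).trans_le (le_infRe_toReal hF ⟨hmin, Or.inl hlt⟩ ?_)⟩
  intro z hz
  obtain ⟨ζ, rfl⟩ := Complex.cos_surjective z
  have hζ := (cos_mem_bernsteinEllipse_coe hmin ζ).1 hz
  obtain ⟨ζ', h3, h4, h5⟩ := exists_cos_eq_re_mem_Icc ζ
  have hmem : ζ' ∈ Metric.thickening δ ((fun x : ℝ => (x : ℂ)) '' Icc 0 (2 * Real.pi)) := by
    rw [Metric.mem_thickening_iff]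
    refine ⟨_, ⟨ζ'.re, h5, rfl⟩, ?_⟩
    rw [Complex.dist_of_re_eq (by simp), Complex.ofReal_im, Real.dist_eq, sub_zero, h4]
    exact Real.exp_lt_exp.1 (hζ.trans_le (min_le_right _ _))
  rw [← h3]
  exact (hsub hmem).2.le

lemma exists_infRe_neg (hF : 1 < rhoA F) (hneg : ¬ 0 ≤ infRe F (rhoA F)) :
    ∃ r : ℝ, 1 < r ∧ (r : EReal) < rhoA F ∧ (infRe F r).toReal < 0 := by
  rw [infRe, le_iInf₂_iff] at hneg
  push Not at hneg
  obtain ⟨z, hz, hz0⟩ := hneg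
  obtain ⟨r, h1, h2, h3⟩ := exists_coe_lt_mem_bernsteinEllipse hF hz
  exact ⟨r, h1, h2, (infRe_toReal_le hF ⟨h1, Or.inl h2⟩ h3).trans_lt (by exact_mod_cast hz0)⟩

/-- Existence of the zero of the infimum of the real part. -/
lemma rhoZero_spec (hF : 1 < rhoA F) {c : ℝ} (hc : 0 < c)
    (hFc : ∀ s ∈ Icc (-1 : ℝ) 1, c ≤ F s) (hneg : ¬ 0 ≤ infRe F (rhoA F)) :
    1 < rhoZero F ∧ (rhoZero F : EReal) < rhoA F ∧ infRe F (rhoZero F) = 0 := by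
  refine Classical.epsilon_spec
    (p := fun ρ : ℝ => 1 < ρ ∧ (ρ : EReal) < rhoA F ∧ infRe F ρ = 0) ?_
  obtain ⟨r₁, h1, h1', hm1⟩ := exists_infRe_pos hF hc hFc
  obtain ⟨r₂, h2, h2', hm2⟩ := exists_infRe_neg hF hneg
  have h12 : r₁ ≤ r₂ := by
    by_contra! h
    have := infRe_toReal_antitone hF ⟨h2, Or.inl h2'⟩ ⟨h1, Or.inl h1'⟩ h.le
    linarith
  have he1 : Real.exp (Real.log r₁) = r₁ := Real.exp_log (by linarith)
  have he2 : Real.exp (Real.log r₂) = r₂ := Real.exp_log (by linarith)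
  -- A convex function is continuous on an open domain; the endpoint `log rhoA F` is left out for
  -- this reason. The intermediate value theorem then gives the zero.
  let D : Set ℝ := Ioi 0 ∩ (fun h => ((Real.exp h : ℝ) : EReal)) ⁻¹' Iio (rhoA F)
  have hDsub : D ⊆ {h : ℝ | Real.exp h ∈ rhoInterval F} := fun h hh =>
    ⟨Real.one_lt_exp_iff.2 hh.1, Or.inl hh.2⟩
  have hDo : IsOpen D := isOpen_Ioi.inter
    (isOpen_Iio.preimage (continuous_coe_real_ereal.comp Real.continuous_exp))
  have hDord : OrdConnected D := by
    refine ⟨fun x hx y hy t ht => ⟨lt_of_lt_of_le hx.1 ht.1, ?_⟩⟩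
    rw [mem_preimage, mem_Iio]
    refine lt_of_le_of_lt ?_ hy.2
    exact EReal.coe_le_coe_iff.2 (Real.exp_le_exp.2 ht.2)
  have hcont := ((convexOn_neg_infRe hF).subset hDsub hDord.convex).continuousOn hDo
  have hsub : Icc (Real.log r₁) (Real.log r₂) ⊆ D := hDord.out
    ⟨Real.log_pos h1, by simpa only [mem_preimage, mem_Iio, he1] using h1'⟩
    ⟨Real.log_pos h2, by simpa only [mem_preimage, mem_Iio, he2] using h2'⟩
  obtain ⟨h, hh, h0⟩ := intermediate_value_Icc (Real.log_le_log (by linarith) h12)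
    (hcont.mono hsub) (show (0 : ℝ) ∈ Icc _ _ from
      ⟨by simp only [he1]; linarith, by simp only [he2]; linarith⟩)
  have hD := hDsub (hsub hh)
  refine ⟨Real.exp h, hD.1, (hsub hh).2, ?_⟩
  rw [← coe_infRe_toReal hF hD, neg_eq_zero.1 h0, EReal.coe_zero]

/-- A supporting line of the convex function `h ↦ -m(e^h)` at its zero has positive slope. -/
lemma exists_slope_infRe (hF : 1 < rhoA F) {c : ℝ} (hc : 0 < c)
    (hFc : ∀ s ∈ Icc (-1 : ℝ) 1, c ≤ F s) (hneg : ¬ 0 ≤ infRe F (rhoA F)) :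
    ∃ k > 0, ∀ r ∈ rhoInterval F,
      k * (Real.log r - Real.log (rhoZero F)) ≤ -(infRe F r).toReal := by
  obtain ⟨hz1, hz2, hz0⟩ := rhoZero_spec hF hc hFc hneg
  obtain ⟨r₁, h1, h1', hm1⟩ := exists_infRe_pos hF hc hFc
  obtain ⟨r₂, h2, h2', hm2⟩ := exists_infRe_neg hF hneg
  have hconv := convexOn_neg_infRe hF
  set K : ℝ → ℝ := fun h => -(infRe F (Real.exp h)).toReal with hK
  set D := {h : ℝ | Real.exp h ∈ rhoInterval F} with hD
  set z := Real.log (rhoZero F) with hz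
  have hlogK : ∀ r : ℝ, 1 < r → K (Real.log r) = -(infRe F r).toReal := fun r hr => by
    simp only [hK, Real.exp_log (show 0 < r by linarith)]
  have hlogD : ∀ r ∈ rhoInterval F, Real.log r ∈ D := fun r hr => by
    rw [hD, mem_ofPred_eq, Real.exp_log (by linarith [hr.1])]; exact hr
  have hzm : rhoZero F ∈ rhoInterval F := ⟨hz1, Or.inl hz2⟩
  have h1m : r₁ ∈ rhoInterval F := ⟨h1, Or.inl h1'⟩
  have h2m : r₂ ∈ rhoInterval F := ⟨h2, Or.inl h2'⟩
  have hzero : (infRe F (rhoZero F)).toReal = 0 := by rw [hz0]; rfl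
  have hKz : K z = 0 := by rw [hz, hlogK _ hz1, hzero, neg_zero]
  have h1z : Real.log r₁ < z := by
    apply Real.log_lt_log (by linarith)
    by_contra! h
    have := infRe_toReal_antitone hF hzm h1m h
    linarith
  have hz2 : z < Real.log r₂ := by
    apply Real.log_lt_log (by linarith)
    by_contra! h
    have := infRe_toReal_antitone hF h2m hzm h
    linarith
  -- The slope is the infimum of the difference quotients to the right of the zero. Every quotient
  -- to the left is a lower bound, and the one at `log r₁` is positive because `m(r₁) > 0`.
  let S : Set ℝ := (fun y => (K y - K z) / (y - z)) '' (D ∩ Ioi z)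
  have hlow : ∀ x ∈ D, x < z → ∀ s ∈ S, (K z - K x) / (z - x) ≤ s := by
    rintro x hx hxz _ ⟨y, ⟨hy, hyz⟩, rfl⟩
    exact hconv.slope_mono_adjacent hx hy hxz hyz
  have hne : S.Nonempty := ⟨_, Real.log r₂, ⟨hlogD _ h2m, hz2⟩, rfl⟩
  have hbdd : BddBelow S := ⟨_, hlow _ (hlogD _ h1m) h1z⟩
  refine ⟨sInf S, ?_, fun r hr => ?_⟩
  · refine lt_of_lt_of_le ?_ (le_csInf hne (hlow _ (hlogD _ h1m) h1z))
    rw [hlogK _ h1, hKz]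
    exact div_pos (by linarith) (by linarith)
  · rw [← hlogK r hr.1]
    rcases lt_trichotomy (Real.log r) z with h | h | h
    · have := le_csInf hne (hlow _ (hlogD _ hr) h)
      rw [div_le_iff₀ (by linarith), hKz] at this
      linarith
    · rw [h, hKz]; simp
    · have := csInf_le hbdd ⟨Real.log r, ⟨hlogD _ hr, h⟩, rfl⟩
      rw [le_div_iff₀ (by linarith), hKz] at this
      linarith

/-- An entire function with nonnegative real part is constant. -/
lemma rhoA_ne_top_of_infRe_nonneg (hF : 1 < rhoA F) (hne : F (-1) ≠ F 1)
    (hpos : 0 ≤ infRe F (rhoA F)) : rhoA F ≠ ⊤ := by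
  intro htop
  have hcont := isAnalyticContinuation_analyticContinuation hF
  rw [htop, bernsteinEllipse_top] at hcont
  -- Liouville's theorem applies to `exp (-F)`, of modulus at most one; its real values at `±1` then
  -- force `F (-1) = F 1`.
  have hd : Differentiable ℂ fun z => Complex.exp (-analyticContinuation F z) := fun z =>
    ((hcont.1 z (mem_univ z)).differentiableAt).neg.cexp
  have hbd : Bornology.IsBounded (range fun z => Complex.exp (-analyticContinuation F z)) := by
    refine isBounded_iff_forall_norm_le.2 ⟨1, ?_⟩
    rintro _ ⟨z, rfl⟩
    rw [Complex.norm_exp, Complex.neg_re, Real.exp_le_one_iff, neg_nonpos]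
    have := hpos.trans (infRe_le (z := z) (by rw [htop, bernsteinEllipse_top]; trivial))
    exact_mod_cast this
  have := hd.apply_eq_apply_of_bounded hbd ((-1 : ℝ) : ℂ) ((1 : ℝ) : ℂ)
  simp only [analyticContinuation_ofReal hF (s := -1) (by norm_num),
    analyticContinuation_ofReal hF (s := 1) (by norm_num), ← Complex.ofReal_neg,
    ← Complex.ofReal_exp] at this
  exact hne (neg_injective (Real.exp_injective (Complex.ofReal_injective this)))

end InfRe

/-! ### Means over a period and the Poisson kernel -/

/-- The mean value of a function over `[0, 2π]`. -/
noncomputable def periodMean (f : ℝ → ℝ) : ℝ := (2 * Real.pi)⁻¹ * ∫ t in (0 : ℝ)..2 * Real.pi, f t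

lemma periodMean_add {f g : ℝ → ℝ} (hf : Continuous f) (hg : Continuous g) :
    periodMean (fun t => f t + g t) = periodMean f + periodMean g := by
  simp only [periodMean]
  rw [intervalIntegral.integral_add (hf.intervalIntegrable _ _) (hg.intervalIntegrable _ _), mul_add]

lemma periodMean_const_mul (c : ℝ) (f : ℝ → ℝ) :
    periodMean (fun t => c * f t) = c * periodMean f := by
  simp only [periodMean]
  rw [intervalIntegral.integral_const_mul]; ring

lemma periodMean_sub {f g : ℝ → ℝ} (hf : Continuous f) (hg : Continuous g) :
    periodMean (fun t => f t - g t) = periodMean f - periodMean g := by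
  simp only [periodMean]
  rw [intervalIntegral.integral_sub (hf.intervalIntegrable _ _) (hg.intervalIntegrable _ _), mul_sub]

lemma periodMean_const (c : ℝ) : periodMean (fun _ => c) = c := by
  simp only [periodMean, intervalIntegral.integral_const, smul_eq_mul, sub_zero]
  field_simp

lemma periodMean_mono {f g : ℝ → ℝ} (hf : Continuous f) (hg : Continuous g) (h : ∀ t, f t ≤ g t) :
    periodMean f ≤ periodMean g := by
  simp only [periodMean]
  exact mul_le_mul_of_nonneg_left (intervalIntegral.integral_mono Real.two_pi_pos.le
    (hf.intervalIntegrable _ _) (hg.intervalIntegrable _ _) h) (inv_nonneg.2 Real.two_pi_pos.le)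

lemma abs_periodMean_le {f : ℝ → ℝ} (hf : Continuous f) :
    |periodMean f| ≤ periodMean fun t => |f t| := by
  rw [abs_le, ← neg_one_mul, ← periodMean_const_mul]
  exact ⟨periodMean_mono (by fun_prop) hf fun t => by linarith [neg_abs_le (f t)],
    periodMean_mono hf (by fun_prop) fun t => le_abs_self _⟩

lemma HasSum.of_eq {f g : ℕ → ℝ} {a b : ℝ} (h : HasSum f a) (hfg : ∀ k, g k = f k) (hab : b = a) :
    HasSum g b := by
  rw [hab, funext hfg]; exact h

lemma hasSum_periodMean {F : ℕ → ℝ → ℝ} (hF : ∀ k, Continuous (F k)) {c : ℕ → ℝ} (hc : Summable c)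
    (hFc : ∀ k t, |F k t| ≤ c k) {f : ℝ → ℝ} (hf : ∀ t, HasSum (fun k => F k t) (f t)) :
    HasSum (fun k => periodMean (F k)) (periodMean f) := by
  refine HasSum.mul_left _ ?_
  refine intervalIntegral.hasSum_integral_of_dominated_convergence (fun k _ => c k)
    (fun k => (hF k).aestronglyMeasurable) ?_ ?_ ?_ ?_
  · exact fun k => Filter.Eventually.of_forall fun t _ => hFc k t
  · exact Filter.Eventually.of_forall fun t _ => hc
  · exact intervalIntegrable_const
  · exact Filter.Eventually.of_forall fun t _ => hf t

lemma periodMean_cos (j : ℤ) :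
    periodMean (fun t => Real.cos (j * t)) = if j = 0 then 1 else 0 := by
  split_ifs with h
  · simp [h, periodMean_const]
  · have hj : (j : ℝ) ≠ 0 := by exact_mod_cast h
    simp only [periodMean]
    rw [intervalIntegral.integral_comp_mul_left (fun t => Real.cos t) hj, integral_cos]
    have : Real.sin (j * (2 * Real.pi)) = 0 := by
      have := Real.sin_int_mul_pi (2 * j)
      push_cast at this
      rw [← this]; ring_nf
    simp [this]

lemma periodMean_cos_mul_cos (j k : ℕ) :
    periodMean (fun t => Real.cos (j * t) * Real.cos (k * t)) =
      ((if k = j then 1 else 0) + if j + k = 0 then 1 else 0) / 2 := by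
  have h : (fun t => Real.cos (j * t) * Real.cos (k * t)) = fun t =>
      (1 / 2) * (Real.cos (((k : ℤ) - (j : ℤ) : ℤ) * t) + Real.cos (((j : ℤ) + (k : ℤ) : ℤ) * t)) := by
    ext t
    push_cast
    rw [sub_mul, add_mul, Real.cos_sub, Real.cos_add]
    ring
  rw [h, periodMean_const_mul, periodMean_add (by fun_prop) (by fun_prop), periodMean_cos,
    periodMean_cos]
  have h1 : ((k : ℤ) - (j : ℤ) = 0) ↔ k = j := by omega
  have h2 : ((j : ℤ) + (k : ℤ) = 0) ↔ j + k = 0 := by omega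
  simp only [h1, h2]
  ring

/-- The Poisson kernel of the unit disc. -/
noncomputable def discPoissonKernel (r t : ℝ) : ℝ := (1 - r ^ 2) / (1 - 2 * r * Real.cos t + r ^ 2)

lemma discPoissonKernel_denom_pos {r : ℝ} (h0 : 0 ≤ r) (h1 : r < 1) (t : ℝ) :
    0 < 1 - 2 * r * Real.cos t + r ^ 2 := by
  nlinarith [Real.cos_le_one t, sq_nonneg (1 - r), mul_nonneg h0 (sub_nonneg.2 (Real.cos_le_one t)),
    mul_pos (sub_pos.2 h1) (sub_pos.2 h1)]

lemma discPoissonKernel_pos {r : ℝ} (h0 : 0 ≤ r) (h1 : r < 1) (t : ℝ) :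
    0 < discPoissonKernel r t :=
  div_pos (by nlinarith) (discPoissonKernel_denom_pos h0 h1 t)

@[fun_prop]
lemma continuous_discPoissonKernel {r : ℝ} (h0 : 0 ≤ r) (h1 : r < 1) :
    Continuous (discPoissonKernel r) :=
  Continuous.div (by fun_prop) (by fun_prop) fun t => (discPoissonKernel_denom_pos h0 h1 t).ne'

/-- Twice the real part of the geometric series in `w = r e^{it}`. The term `k = 0` of the kernel's
series is `1`, not `2`; this accounts for the added `1`. -/
lemma hasSum_discPoissonKernel {r : ℝ} (h0 : 0 ≤ r) (h1 : r < 1) (t : ℝ) :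
    HasSum (fun k : ℕ => 2 * r ^ k * Real.cos (k * t)) (discPoissonKernel r t + 1) := by
  set w : ℂ := r * Complex.exp (t * Complex.I) with hw
  have hwn : ‖w‖ < 1 := by
    rw [hw, norm_mul, Complex.norm_exp_ofReal_mul_I, mul_one, Complex.norm_real,
      Real.norm_of_nonneg h0]
    exact h1
  have h := (Complex.hasSum_re (hasSum_geometric_of_norm_lt_one hwn)).mul_left 2
  have hden := discPoissonKernel_denom_pos h0 h1 t
  have hre : w.re = r * Real.cos t := by
    rw [hw, Complex.re_ofReal_mul, Complex.exp_ofReal_mul_I_re]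
  have him : w.im = r * Real.sin t := by
    rw [hw, Complex.im_ofReal_mul, Complex.exp_ofReal_mul_I_im]
  refine h.of_eq (fun k => ?_) ?_
  · rw [hw, mul_pow, ← Complex.exp_nat_mul, ← Complex.ofReal_pow, Complex.re_ofReal_mul,
      ← mul_assoc (k : ℂ), ← Complex.ofReal_natCast, ← Complex.ofReal_mul,
      Complex.exp_ofReal_mul_I_re]
    ring
  · rw [Complex.inv_re, Complex.normSq_apply, Complex.sub_re, Complex.sub_im, Complex.one_re,
      Complex.one_im, hre, him, discPoissonKernel]
    have h2 : (1 - r * Real.cos t) * (1 - r * Real.cos t) + (0 - r * Real.sin t) *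
        (0 - r * Real.sin t) = 1 - 2 * r * Real.cos t + r ^ 2 := by
      nlinarith [Real.cos_sq_add_sin_sq t]
    rw [h2, ← mul_div_assoc, div_add_one hden.ne']
    ring

/-- The mean of a function against the Poisson kernel, in terms of its cosine coefficients. -/
lemma hasSum_periodMean_mul_discPoissonKernel {r : ℝ} (h0 : 0 ≤ r) (h1 : r < 1) {f : ℝ → ℝ}
    (hf : Continuous f) {C : ℝ} (hC : ∀ t, |f t| ≤ C) :
    HasSum (fun k : ℕ => 2 * r ^ k * periodMean fun t => f t * Real.cos (k * t))
      ((periodMean fun t => f t * discPoissonKernel r t) + periodMean f) := by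
  have hP := continuous_discPoissonKernel h0 h1
  rw [← periodMean_add (by fun_prop) hf]
  simp only [← periodMean_const_mul]
  refine hasSum_periodMean (fun k => by fun_prop)
    (((summable_geometric_of_lt_one h0 h1).mul_left 2).mul_right C) (fun k t => ?_) fun t => ?_
  · rw [abs_mul, abs_of_nonneg (by positivity), abs_mul]
    refine mul_le_mul_of_nonneg_left ?_ (by positivity)
    calc |f t| * |Real.cos (k * t)| ≤ |f t| * 1 :=
          mul_le_mul_of_nonneg_left (Real.abs_cos_le_one _) (abs_nonneg _)
      _ ≤ C := by rw [mul_one]; exact hC t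
  · have := (hasSum_discPoissonKernel h0 h1 t).mul_left (f t)
    exact this.of_eq (fun k => by ring) (by ring)

lemma periodMean_cos_mul_discPoissonKernel {r : ℝ} (h0 : 0 ≤ r) (h1 : r < 1) (j : ℕ) :
    periodMean (fun t => Real.cos (j * t) * discPoissonKernel r t) = r ^ j := by
  have h := hasSum_periodMean_mul_discPoissonKernel h0 h1 (f := fun t => Real.cos (j * t))
    (by fun_prop) (fun t => Real.abs_cos_le_one _)
  have hj := periodMean_cos j
  rw [Int.cast_natCast] at hj
  rw [hj] at h
  simp only [periodMean_cos_mul_cos] at h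
  have h2 := hasSum_ite_eq j (r ^ j)
  have h3 := hasSum_ite_eq (0 : ℕ) (if j = 0 then (1 : ℝ) else 0)
  have h4 := (h2.add h3).unique (h.of_eq (fun k => ?_) rfl)
  · have : ((j : ℤ) = 0) ↔ j = 0 := by omega
    simp only [this] at h4
    linarith
  · rcases eq_or_ne k j with rfl | hkj <;> rcases eq_or_ne k 0 with rfl | hk0
    · norm_num
    · simp [hk0]; ring
    · simp [hkj, hkj.symm]
    · simp [hkj, hk0]

/-- The right side equals `r ^ k (x⁻¹ + x) / 2` with `x = r ^ n` (for `r > 0`): for `k ≥ n` the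
kernel `cos nt · P_r` has coefficients proportional to `r ^ k`. -/
lemma periodMean_cos_mul_cos_mul_discPoissonKernel {r : ℝ} (h0 : 0 ≤ r) (h1 : r < 1) {n k : ℕ}
    (hnk : n ≤ k) :
    periodMean (fun t => Real.cos (k * t) * (Real.cos (n * t) * discPoissonKernel r t)) =
      (r ^ (k - n) + r ^ (k + n)) / 2 := by
  have hP := continuous_discPoissonKernel h0 h1
  have h : (fun t => Real.cos (k * t) * (Real.cos (n * t) * discPoissonKernel r t)) = fun t =>
      (1 / 2) * (Real.cos ((k - n : ℕ) * t) * discPoissonKernel r t +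
        Real.cos ((k + n : ℕ) * t) * discPoissonKernel r t) := by
    ext t
    push_cast [hnk]
    rw [sub_mul, add_mul, Real.cos_sub, Real.cos_add]
    ring
  rw [h, periodMean_const_mul, periodMean_add (by fun_prop) (by fun_prop),
    periodMean_cos_mul_discPoissonKernel h0 h1, periodMean_cos_mul_discPoissonKernel h0 h1]
  ring

lemma periodMean_comp_add {f : ℝ → ℝ} (hf : Function.Periodic f (2 * Real.pi)) (τ : ℝ) :
    periodMean (fun t => f (t + τ)) = periodMean f := by
  simp only [periodMean]
  rw [intervalIntegral.integral_comp_add_right, zero_add, add_comm (2 * Real.pi) τ,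
    hf.intervalIntegral_add_eq τ 0, zero_add]

lemma periodMean_comp_nat_mul {f : ℝ → ℝ} (hfc : Continuous f)
    (hf : Function.Periodic f (2 * Real.pi)) {n : ℕ} (hn : 1 ≤ n) :
    periodMean (fun t => f (n * t)) = periodMean f := by
  have hn0 : (n : ℝ) ≠ 0 := by exact_mod_cast (by omega : n ≠ 0)
  simp only [periodMean]
  have h := hf.intervalIntegral_add_zsmul_eq n 0 fun _ _ => hfc.intervalIntegrable _ _
  rw [intervalIntegral.integral_comp_mul_left _ hn0, mul_zero]
  simp only [zero_add, zsmul_eq_mul, Int.cast_natCast] at h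
  rw [h, smul_eq_mul, inv_mul_cancel_left₀ hn0]

/-! ### The mean of `|cos nt|` against the Poisson kernel -/

lemma abs_cos_add_nat_mul_pi_div (n : ℕ) (hn : 1 ≤ n) (t : ℝ) :
    |Real.cos (n * (t + Real.pi / n))| = |Real.cos (n * t)| := by
  have hn0 : (n : ℝ) ≠ 0 := by exact_mod_cast (by omega : n ≠ 0)
  rw [mul_add, mul_div_cancel₀ _ hn0, Real.cos_add_pi, abs_neg]

/-- The cosine coefficients of `|cos nt|` vanish at frequencies that are not multiples of `2n`. -/
lemma periodMean_abs_cos_mul_cos_eq_zero {n k : ℕ} (hn : 1 ≤ n) (hk : ¬ 2 * n ∣ k) :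
    (periodMean fun t => |Real.cos (n * t)| * Real.cos (k * t)) = 0 := by
  have hn0 : (n : ℝ) ≠ 0 := by exact_mod_cast (by omega : n ≠ 0)
  have hper : ∀ m : ℕ, ∀ t, (m : ℝ) * (t + 2 * Real.pi) = m * t + m * (2 * Real.pi) := by
    intro m t; ring
  have hpC : Function.Periodic (fun t => |Real.cos (n * t)| * Real.cos (k * t)) (2 * Real.pi) := by
    intro t
    simp only [hper, Real.cos_add_nat_mul_two_pi]
  have hpS : Function.Periodic (fun t => |Real.cos (n * t)| * Real.sin (k * t)) (2 * Real.pi) := by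
    intro t
    simp only [hper, Real.cos_add_nat_mul_two_pi, Real.sin_add_nat_mul_two_pi]
  -- The shift by `π / n` preserves `|cos nt|` and rotates the pair of cosine and sine coefficients
  -- by `α = kπ/n`. A vector fixed by a nontrivial rotation is zero, and the rotation is trivial
  -- only if `2n ∣ k`.
  have h1 := periodMean_comp_add hpC (Real.pi / n)
  have h2 := periodMean_comp_add hpS (Real.pi / n)
  simp only [abs_cos_add_nat_mul_pi_div n hn, mul_add (k : ℝ), Real.cos_add, Real.sin_add] at h1 h2
  set α := (k : ℝ) * (Real.pi / n) with hα
  set C := periodMean fun t => |Real.cos (n * t)| * Real.cos (k * t) with hC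
  set S := periodMean fun t => |Real.cos (n * t)| * Real.sin (k * t) with hS
  have e1 : (fun t => |Real.cos (n * t)| * (Real.cos (k * t) * Real.cos α -
      Real.sin (k * t) * Real.sin α)) = fun t => Real.cos α *
      (|Real.cos (n * t)| * Real.cos (k * t)) - Real.sin α *
      (|Real.cos (n * t)| * Real.sin (k * t)) := by
    ext t; ring
  have e2 : (fun t => |Real.cos (n * t)| * (Real.sin (k * t) * Real.cos α +
      Real.cos (k * t) * Real.sin α)) = fun t => Real.cos α *
      (|Real.cos (n * t)| * Real.sin (k * t)) + Real.sin α *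
      (|Real.cos (n * t)| * Real.cos (k * t)) := by
    ext t; ring
  rw [e1, periodMean_sub (by fun_prop) (by fun_prop), periodMean_const_mul, periodMean_const_mul,
    ← hC, ← hS] at h1
  rw [e2, periodMean_add (by fun_prop) (by fun_prop), periodMean_const_mul, periodMean_const_mul,
    ← hC, ← hS] at h2
  have hcos : Real.cos α ≠ 1 := by
    intro h
    obtain ⟨m, hm⟩ := (Real.cos_eq_one_iff _).1 h
    apply hk
    have h3 : (k : ℝ) = m * (2 * n) := by
      rw [hα] at hm
      field_simp at hm
      linarith
    have h4 : (k : ℤ) = m * (2 * n) := by exact_mod_cast h3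
    have h5 : ((2 * n : ℕ) : ℤ) ∣ (k : ℤ) := ⟨m, by rw [h4]; push_cast; ring⟩
    exact_mod_cast h5
  have hcs := Real.cos_sq_add_sin_sq α
  have h3 : C * (1 - Real.cos α) = 0 := by
    linear_combination (-1 / 2) * C * hcs - (1 / 2) * (1 - Real.cos α) * h1
      + (1 / 2) * Real.sin α * h2
  exact (mul_eq_zero.1 h3).resolve_right (sub_ne_zero.2 hcos.symm)

lemma periodMean_abs_cos_mul_cos_two_mul {n : ℕ} (hn : 1 ≤ n) (m : ℕ) :
    (periodMean fun t => |Real.cos (n * t)| * Real.cos ((2 * n * m : ℕ) * t)) =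
      periodMean fun t => |Real.cos t| * Real.cos ((2 * m : ℕ) * t) := by
  rw [← periodMean_comp_nat_mul (f := fun t => |Real.cos t| * Real.cos ((2 * m : ℕ) * t))
    (by fun_prop) _ hn]
  · congr 1
    ext t
    push_cast
    ring_nf
  · intro t
    have : ((2 * m : ℕ) : ℝ) * (t + 2 * Real.pi) = (2 * m : ℕ) * t + (2 * m : ℕ) * (2 * Real.pi) := by
      ring
    simp only [this, Real.cos_add_nat_mul_two_pi, Real.cos_add_two_pi]

lemma periodMean_abs_cos_mul {g : ℝ → ℝ} (hg : Continuous g)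
    (hp : Function.Periodic g Real.pi) :
    (periodMean fun t => |Real.cos t| * g t) =
      Real.pi⁻¹ * ∫ t in (-(Real.pi / 2))..(Real.pi / 2), Real.cos t * g t := by
  have hp' : Function.Periodic (fun t => |Real.cos t| * g t) Real.pi := by
    intro t
    simp only [Real.cos_add_pi, abs_neg, hp t]
  have hc : Continuous fun t => |Real.cos t| * g t := by fun_prop
  have h := hp'.intervalIntegral_add_zsmul_eq 2 0 fun _ _ => hc.intervalIntegrable _ _
  rw [hp'.intervalIntegral_add_eq 0 (-(Real.pi / 2))] at h
  have e1 : (0 : ℝ) + (2 : ℤ) • Real.pi = 2 * Real.pi := by simp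
  have e2 : -(Real.pi / 2) + Real.pi = Real.pi / 2 := by ring
  rw [e1, e2] at h
  simp only [periodMean]
  rw [h, zsmul_eq_mul]
  have h2 : ∫ t in (-(Real.pi / 2))..(Real.pi / 2), |Real.cos t| * g t =
      ∫ t in (-(Real.pi / 2))..(Real.pi / 2), Real.cos t * g t := by
    refine intervalIntegral.integral_congr fun t ht => ?_
    rw [uIcc_of_le (by linarith [Real.pi_pos])] at ht
    rw [abs_of_nonneg (Real.cos_nonneg_of_mem_Icc ht)]
  rw [h2]
  push_cast
  rw [mul_inv]
  ring

lemma periodMean_abs_cos : (periodMean fun t => |Real.cos t|) = 2 / Real.pi := by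
  have h := periodMean_abs_cos_mul (g := fun _ => 1) continuous_const fun _ => rfl
  simp only [mul_one] at h
  rw [h, integral_cos, Real.sin_neg, Real.sin_pi_div_two]
  ring

lemma periodMean_abs_cos_mul_cos_two :
    (periodMean fun t => |Real.cos t| * Real.cos (2 * t)) = 2 / (3 * Real.pi) := by
  rw [periodMean_abs_cos_mul (g := fun t => Real.cos (2 * t)) (by fun_prop) fun t => by
    simp only [mul_add, Real.cos_add_two_pi]]
  have hderiv : ∀ t ∈ uIcc (-(Real.pi / 2)) (Real.pi / 2),
      HasDerivAt (fun t => Real.sin t - 2 / 3 * Real.sin t ^ 3) (Real.cos t * Real.cos (2 * t)) t := by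
    intro t _
    have h := (Real.hasDerivAt_sin t).sub (((Real.hasDerivAt_sin t).pow 3).const_mul (2 / 3))
    refine h.congr_deriv ?_
    rw [Real.cos_two_mul]
    have := Real.cos_sq_add_sin_sq t
    push_cast
    linear_combination (-2) * Real.cos t * this
  have hc : Continuous fun t => Real.cos t * Real.cos (2 * t) := by fun_prop
  rw [intervalIntegral.integral_eq_sub_of_hasDerivAt hderiv (hc.intervalIntegrable _ _),
    Real.sin_neg, Real.sin_pi_div_two]
  field_simp
  norm_num

/-- The mean of `|cos nt|` against the Poisson kernel, up to fourth order in `x = r ^ n`. -/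
lemma abs_periodMean_abs_cos_mul_discPoissonKernel_sub_le {r : ℝ} (h0 : 0 ≤ r) (h1 : r < 1) {n : ℕ}
    (hn : 1 ≤ n) :
    |(periodMean fun t => |Real.cos (n * t)| * discPoissonKernel r t) -
      2 / Real.pi * (1 + 2 / 3 * (r ^ n) ^ 2)| ≤
      4 / Real.pi * ((r ^ n) ^ 4 / (1 - (r ^ n) ^ 2)) := by
  set x := r ^ n with hx
  have hx0 : 0 ≤ x := pow_nonneg h0 n
  have hx1 : x ^ 2 < 1 := by
    rw [hx, ← pow_mul]; exact pow_lt_one₀ h0 h1 (by omega)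
  have hs := hasSum_periodMean_mul_discPoissonKernel h0 h1 (f := fun t => |Real.cos (n * t)|)
    (by fun_prop) (C := 1) (fun t => by rw [abs_abs]; exact Real.abs_cos_le_one _)
  have hinj : Function.Injective fun m : ℕ => 2 * n * m := fun m m' h =>
    Nat.eq_of_mul_eq_mul_left (by omega) h
  -- Only the frequencies `k = 2nm` survive, so the sum becomes a power series in `x²`.
  rw [← hinj.hasSum_iff (fun k hk => by
    rw [periodMean_abs_cos_mul_cos_eq_zero hn fun ⟨m, hm⟩ => hk ⟨m, hm.symm⟩, mul_zero])] at hs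
  have hmean0 : (periodMean fun t => |Real.cos (n * t)|) = 2 / Real.pi := by
    have := periodMean_abs_cos_mul_cos_two_mul hn 0
    simpa [periodMean_abs_cos] using this
  rw [hmean0] at hs
  set γ : ℕ → ℝ := fun m => periodMean fun t => |Real.cos t| * Real.cos ((2 * m : ℕ) * t) with hγ
  have hs' : HasSum (fun m : ℕ => 2 * (x ^ 2) ^ m * γ m)
      ((periodMean fun t => |Real.cos (n * t)| * discPoissonKernel r t) + 2 / Real.pi) := by
    refine hs.of_eq (fun m => ?_) rfl
    simp only [Function.comp]
    rw [periodMean_abs_cos_mul_cos_two_mul hn, hx]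
    ring
  have hγ0 : γ 0 = 2 / Real.pi := by simp [hγ, periodMean_abs_cos]
  have hγ1 : γ 1 = 2 / (3 * Real.pi) := by
    simp only [hγ]
    rw [← periodMean_abs_cos_mul_cos_two]
    norm_num
  have hγm : ∀ m, |γ m| ≤ 2 / Real.pi := by
    intro m
    rw [← periodMean_abs_cos]
    refine (abs_periodMean_le (by fun_prop)).trans
      (periodMean_mono (by fun_prop) (by fun_prop) fun t => ?_)
    rw [abs_mul, abs_abs]
    exact mul_le_of_le_one_right (abs_nonneg _) (Real.abs_cos_le_one _)
  -- The terms `m = 0, 1` form the main part; since `|γ m| ≤ γ 0 = 2/π`, the rest is dominated by a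
  -- geometric series starting at `x⁴`.
  have htail := (hasSum_nat_add_iff' 2).2 hs'
  have hgeo : HasSum (fun m : ℕ => 4 / Real.pi * x ^ 4 * (x ^ 2) ^ m)
      (4 / Real.pi * x ^ 4 * (1 - x ^ 2)⁻¹) :=
    (hasSum_geometric_of_lt_one (sq_nonneg x) hx1).mul_left _
  have hle := htail.norm_le_of_bounded hgeo fun m => by
    rw [Real.norm_eq_abs, abs_mul, abs_of_nonneg (by positivity)]
    calc 2 * (x ^ 2) ^ (m + 2) * |γ (m + 2)| ≤ 2 * (x ^ 2) ^ (m + 2) * (2 / Real.pi) :=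
          mul_le_mul_of_nonneg_left (hγm _) (by positivity)
      _ = _ := by ring
  rw [Real.norm_eq_abs, Finset.sum_range_succ, Finset.sum_range_one, hγ0, hγ1] at hle
  convert hle using 1
  · congr 1
    field_simp
    ring
  · ring

/-! ### Achieser's approximation theorem with a truncated kernel -/

/-- Harnack's inequality for the two Poisson kernels. -/
lemma discPoissonKernel_cube_le {r : ℝ} (h0 : 0 ≤ r) (h1 : r < 1) (t : ℝ) :
    discPoissonKernel (r ^ 3) t ≤ 3 * discPoissonKernel r t := by
  have hr3 : r ^ 3 < 1 := pow_lt_one₀ h0 h1 (by norm_num)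
  have hD1 := discPoissonKernel_denom_pos h0 h1 t
  have hD3 := discPoissonKernel_denom_pos (pow_nonneg h0 3) hr3 t
  unfold discPoissonKernel
  rw [← mul_div_assoc, div_le_div_iff₀ hD3 hD1]
  have hc1 := Real.cos_le_one t
  have hc2 := Real.neg_one_le_cos t
  set c := Real.cos t
  -- After cancelling `1 - r²` from `1 - r⁶` the inequality is affine in `c = cos t`, so it suffices
  -- to check `c = 1` (`hA`) and `c = -1` (`hB`).
  have hA : 0 ≤ 3 * (1 - r ^ 3) ^ 2 - (1 + r ^ 2 + r ^ 4) * (1 - r) ^ 2 := by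
    have : 3 * (1 - r ^ 3) ^ 2 - (1 + r ^ 2 + r ^ 4) * (1 - r) ^ 2 =
        (1 - r) ^ 2 * (2 + 6 * r + 8 * r ^ 2 + 6 * r ^ 3 + 2 * r ^ 4) := by ring
    rw [this]; positivity
  have hB : 0 ≤ 3 * (1 + r ^ 3) ^ 2 - (1 + r ^ 2 + r ^ 4) * (1 + r) ^ 2 := by
    have : 3 * (1 + r ^ 3) ^ 2 - (1 + r ^ 2 + r ^ 4) * (1 + r) ^ 2 =
        (1 + r) ^ 2 * ((1 / 2 + (1 / 2) * (1 - r) ^ 2 + (1 / 2) * r ^ 2) * (2 * (1 - r) ^ 2)) := by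
      ring
    rw [this]; positivity
  have key : 0 ≤ 3 * (1 - 2 * r ^ 3 * c + (r ^ 3) ^ 2) -
      (1 + r ^ 2 + r ^ 4) * (1 - 2 * r * c + r ^ 2) := by
    have : 3 * (1 - 2 * r ^ 3 * c + (r ^ 3) ^ 2) -
        (1 + r ^ 2 + r ^ 4) * (1 - 2 * r * c + r ^ 2) =
        (1 + c) / 2 * (3 * (1 - r ^ 3) ^ 2 - (1 + r ^ 2 + r ^ 4) * (1 - r) ^ 2) +
        (1 - c) / 2 * (3 * (1 + r ^ 3) ^ 2 - (1 + r ^ 2 + r ^ 4) * (1 + r) ^ 2) := by ring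
    rw [this]
    exact add_nonneg (mul_nonneg (by linarith) hA) (mul_nonneg (by linarith) hB)
  have hr2 : 0 ≤ 1 - r ^ 2 := by nlinarith
  have := mul_nonneg hr2 key
  nlinarith

lemma discPoissonKernel_le {r : ℝ} (h0 : 0 ≤ r) (h1 : r < 1) (t : ℝ) :
    discPoissonKernel r t ≤ (1 - r ^ 2) / (1 - r) ^ 2 := by
  unfold discPoissonKernel
  refine div_le_div_of_nonneg_left (by nlinarith) (pow_pos (by linarith) 2) ?_
  nlinarith [mul_nonneg h0 (sub_nonneg.2 (Real.cos_le_one t))]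

/-- The even convolution of a cosine series with a bounded kernel. -/
lemma hasSum_periodMean_convolution {b : ℕ → ℝ} (hb : Summable fun k => |b k|) {u E : ℝ → ℝ}
    (hu : ∀ θ, HasSum (fun k : ℕ => b k * Real.cos (k * θ)) (u θ)) (hE : Continuous E) {C : ℝ}
    (hC : ∀ t, |E t| ≤ C) (θ : ℝ) :
    HasSum (fun k : ℕ => b k * Real.cos (k * θ) * periodMean fun t => Real.cos (k * t) * E t)
      (periodMean fun t => (u (θ - t) + u (θ + t)) / 2 * E t) := by
  simp only [← periodMean_const_mul]
  refine hasSum_periodMean (fun k => by fun_prop) (hb.mul_right C) (fun k t => ?_) fun t => ?_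
  · rw [abs_mul, abs_mul, abs_mul]
    have h1 := Real.abs_cos_le_one (k * θ)
    have h2 := Real.abs_cos_le_one (k * t)
    calc |b k| * |Real.cos (k * θ)| * (|Real.cos (k * t)| * |E t|)
        ≤ |b k| * 1 * (1 * C) := by gcongr; exact hC t
      _ = |b k| * C := by ring
  · refine ((((hu (θ - t)).add (hu (θ + t))).div_const 2).mul_right (E t)).of_eq (fun k => ?_) rfl
    rw [mul_sub, mul_add, Real.cos_sub, Real.cos_add]
    ring

lemma abs_periodMean_convolution_le {u E : ℝ → ℝ} (hu : Continuous u) (hE : Continuous E) {K : ℝ}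
    (hK : ∀ t, |u t| ≤ K) (θ : ℝ) :
    |periodMean fun t => (u (θ - t) + u (θ + t)) / 2 * E t| ≤ K * periodMean fun t => |E t| := by
  rw [← periodMean_const_mul]
  refine (abs_periodMean_le (by fun_prop)).trans
    (periodMean_mono (by fun_prop) (by fun_prop) fun t => ?_)
  rw [abs_mul]
  refine mul_le_mul_of_nonneg_right ?_ (abs_nonneg _)
  rw [abs_div, abs_two, div_le_iff₀ two_pos]
  linarith [abs_add_le (u (θ - t)) (u (θ + t)), hK (θ - t), hK (θ + t)]

/-- Bounds the sum of the `L¹` norms of the two kernels. In units of `(8/π) x³`, the terms beyond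
`(8/π) x` contribute at most `1/3` from `J₁`, `-9/10` from `J₃` and `2/5` from `2x⁴`; the total
`-1/6` is below the required `-1/10`. -/
lemma discPoissonKernel_bound_aux {x J₁ J₃ : ℝ} (hx0 : 0 < x) (hx : x ≤ 1 / 2)
    (h1 : |J₁ - 2 / Real.pi * (1 + 2 / 3 * x ^ 2)| ≤ 4 / Real.pi * (x ^ 4 / (1 - x ^ 2)))
    (h3 : |J₃ - 2 / Real.pi * (1 + 2 / 3 * (x ^ 3) ^ 2)| ≤
      4 / Real.pi * ((x ^ 3) ^ 4 / (1 - (x ^ 3) ^ 2))) :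
    4 * x / (1 + x ^ 2) * J₁ - 4 * x ^ 3 / (1 + x ^ 6) * J₃ + 2 * x ^ 4 ≤
      8 / Real.pi * x * (1 - x ^ 2 / 10) := by
  have hπ := Real.pi_pos
  have hy : x ^ 2 ≤ 1 / 4 := by nlinarith
  have hy0 : 0 < x ^ 2 := by positivity
  have hx6 : x ^ 6 ≤ 1 / 64 := by
    calc x ^ 6 = (x ^ 2) ^ 3 := by ring
      _ ≤ (1 / 4) ^ 3 := pow_le_pow_left₀ hy0.le hy 3
      _ = 1 / 64 := by norm_num
  have hx60 : 0 < x ^ 6 := by positivity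
  have b1 : x ^ 4 / (1 - x ^ 2) ≤ 4 / 3 * (x ^ 2) ^ 2 := by
    rw [div_le_iff₀ (by linarith)]; nlinarith [mul_pos hy0 hy0]
  have b3 : (x ^ 3) ^ 4 / (1 - (x ^ 3) ^ 2) ≤ 1 / 32 := by
    have e : (x ^ 3) ^ 2 = x ^ 6 := by ring
    have e' : (x ^ 3) ^ 4 = x ^ 6 * x ^ 6 := by ring
    rw [e, e', div_le_iff₀ (by linarith)]; nlinarith
  have hJ1 : J₁ ≤ 2 / Real.pi * ((1 + x ^ 2) * (1 + x ^ 2 / 3)) := by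
    have h := (abs_le.1 h1).2
    calc J₁ ≤ 2 / Real.pi * (1 + 2 / 3 * x ^ 2) + 4 / Real.pi * (4 / 3 * (x ^ 2) ^ 2) := by
          have := mul_le_mul_of_nonneg_left b1 (by positivity : 0 ≤ 4 / Real.pi)
          linarith
      _ = 2 / Real.pi * (1 + 2 / 3 * x ^ 2 + 8 / 3 * (x ^ 2) ^ 2) := by ring
      _ ≤ _ := by
          refine mul_le_mul_of_nonneg_left ?_ (by positivity)
          nlinarith
  have hJ3 : 2 / Real.pi * ((1 + x ^ 6) * (9 / 10)) ≤ J₃ := by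
    have h := (abs_le.1 h3).1
    calc 2 / Real.pi * ((1 + x ^ 6) * (9 / 10)) ≤ 2 / Real.pi * (15 / 16) :=
          mul_le_mul_of_nonneg_left (by linarith) (by positivity)
      _ = 2 / Real.pi * 1 - 4 / Real.pi * (1 / 32) := by ring
      _ ≤ 2 / Real.pi * (1 + 2 / 3 * (x ^ 3) ^ 2) -
          4 / Real.pi * ((x ^ 3) ^ 4 / (1 - (x ^ 3) ^ 2)) := by
          gcongr
          have : 0 ≤ (x ^ 3) ^ 2 := by positivity
          linarith
      _ ≤ J₃ := by linarith
  have t1 : 4 * x / (1 + x ^ 2) * J₁ ≤ 8 / Real.pi * x * (1 + x ^ 2 / 3) := by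
    calc 4 * x / (1 + x ^ 2) * J₁
        ≤ 4 * x / (1 + x ^ 2) * (2 / Real.pi * ((1 + x ^ 2) * (1 + x ^ 2 / 3))) :=
          mul_le_mul_of_nonneg_left hJ1 (by positivity)
      _ = _ := by field_simp; norm_num
  have t3 : 8 / Real.pi * x ^ 3 * (9 / 10) ≤ 4 * x ^ 3 / (1 + x ^ 6) * J₃ := by
    calc 8 / Real.pi * x ^ 3 * (9 / 10)
        = 4 * x ^ 3 / (1 + x ^ 6) * (2 / Real.pi * ((1 + x ^ 6) * (9 / 10))) := by
          field_simp; norm_num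
      _ ≤ _ := mul_le_mul_of_nonneg_left hJ3 (by positivity)
  have t4 : 2 * x ^ 4 ≤ 8 / Real.pi * x ^ 3 * (2 / 5) := by
    rw [div_mul_eq_mul_div, div_mul_eq_mul_div, le_div_iff₀ hπ]
    have hπ' := Real.pi_lt_d2
    have : x * Real.pi ≤ 8 / 5 := by nlinarith
    have hx3 : 0 < x ^ 3 := by positivity
    nlinarith
  have : 0 ≤ 8 / Real.pi * x ^ 3 := by positivity
  nlinarith

/-- Ensures that the kernel `A` below has the sign of `cos nt`. Harnack costs a factor `3`, absorbed
because `3x²(1 + x²) ≤ 15/16` for `x ≤ 1/2`. -/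
lemma discPoissonKernel_weighted_cube_le {r : ℝ} (h0 : 0 < r) (h1 : r < 1) {x : ℝ} (hx0 : 0 < x)
    (hx : x ≤ 1 / 2) (t : ℝ) :
    4 * x ^ 3 / (1 + x ^ 6) * discPoissonKernel (r ^ 3) t ≤
      4 * x / (1 + x ^ 2) * discPoissonKernel r t := by
  have hP := discPoissonKernel_pos h0.le h1 t
  have hy : x ^ 2 ≤ 1 / 4 := by nlinarith
  have hy0 : 0 < x ^ 2 := by positivity
  calc 4 * x ^ 3 / (1 + x ^ 6) * discPoissonKernel (r ^ 3) t
      ≤ 4 * x ^ 3 / (1 + x ^ 6) * (3 * discPoissonKernel r t) :=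
        mul_le_mul_of_nonneg_left (discPoissonKernel_cube_le h0.le h1 t) (by positivity)
    _ = 12 * x ^ 3 / (1 + x ^ 6) * discPoissonKernel r t := by ring
    _ ≤ _ := by
        refine mul_le_mul_of_nonneg_right ?_ hP.le
        rw [div_le_div_iff₀ (by positivity) (by positivity)]
        have h6 : 0 < x ^ 6 := by positivity
        have : 0 ≤ 4 * x * (1 + x ^ 6 - 3 * x ^ 2 * (1 + x ^ 2)) :=
          mul_nonneg (by positivity) (by nlinarith)
        nlinarith

/-- Achieser's estimate: polynomial approximation of a cosine series `G` whose harmonic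
continuation `u` to a horizontal line is bounded. -/
lemma exists_polynomial_approx_cosine_series {r : ℝ} (h0 : 0 < r) (h1 : r < 1) {n : ℕ} (hn : 1 ≤ n)
    (hx : r ^ n ≤ 1 / 2) {b : ℕ → ℝ} (hb : Summable fun k => |b k|)
    (hbw : Summable fun k => |b k * (((r ^ k)⁻¹ + r ^ k) / 2)|) {G u : ℝ → ℝ} (hGc : Continuous G)
    (huc : Continuous u) (hG : ∀ θ, HasSum (fun k : ℕ => b k * Real.cos (k * θ)) (G θ))
    (hu : ∀ θ, HasSum (fun k : ℕ => b k * (((r ^ k)⁻¹ + r ^ k) / 2) * Real.cos (k * θ)) (u θ))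
    {K : ℝ} (hK0 : 0 ≤ K) (hGK : ∀ θ, |G θ| ≤ K) (huK : ∀ θ, |u θ| ≤ K) :
    ∃ p : ℝ[X], p.natDegree < n ∧ ∀ θ, |G θ - p.eval (Real.cos θ)| ≤
      K * (8 / Real.pi * r ^ n * (1 - (r ^ n) ^ 2 / 10)) := by
  set x := r ^ n with hxdef
  have hx0 : 0 < x := pow_pos h0 n
  have h31 : r ^ 3 < 1 := pow_lt_one₀ h0.le h1 (by norm_num)
  have h41 : r ^ 4 < 1 := pow_lt_one₀ h0.le h1 (by norm_num)
  have h30 : 0 ≤ r ^ 3 := by positivity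
  have h40 : 0 ≤ r ^ 4 := by positivity
  have hc1 := continuous_discPoissonKernel h0.le h1
  have hc3 := continuous_discPoissonKernel h30 h31
  have hc4 := continuous_discPoissonKernel h40 h41
  set P := discPoissonKernel with hP
  -- The prefactors cancel `(x⁻¹ + x)/2` and its analogues for `x³` and `x⁴`, so that for `k ≥ n`
  -- the coefficients are `2 r^k - 2 r^{3k}` for `A` and `r^{4k}` for `B`.
  let A : ℝ → ℝ := fun t => 4 * x / (1 + x ^ 2) * (Real.cos (n * t) * P r t) -
    4 * x ^ 3 / (1 + x ^ 6) * (Real.cos (n * t) * P (r ^ 3) t)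
  let B : ℝ → ℝ := fun t => 2 * x ^ 4 / (1 + x ^ 8) * (Real.cos (n * t) * P (r ^ 4) t)
  have hAc : Continuous A := by fun_prop
  have hBc : Continuous B := by fun_prop
  have hAabs : ∀ t, |A t| = 4 * x / (1 + x ^ 2) * (|Real.cos (n * t)| * P r t) -
      4 * x ^ 3 / (1 + x ^ 6) * (|Real.cos (n * t)| * P (r ^ 3) t) := by
    intro t
    have e : A t = Real.cos (n * t) * (4 * x / (1 + x ^ 2) * P r t -
        4 * x ^ 3 / (1 + x ^ 6) * P (r ^ 3) t) := by simp only [A]; ring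
    rw [e, abs_mul, abs_of_nonneg (sub_nonneg.2
      (discPoissonKernel_weighted_cube_le h0 h1 hx0 hx t))]
    ring
  have hBabs : ∀ t, |B t| ≤ 2 * x ^ 4 * P (r ^ 4) t := by
    intro t
    have hP4 := discPoissonKernel_pos h40 h41 t
    simp only [B]
    rw [abs_mul, abs_mul, abs_of_pos hP4, abs_of_nonneg (by positivity)]
    have e1 : 2 * x ^ 4 / (1 + x ^ 8) ≤ 2 * x ^ 4 :=
      div_le_self (by positivity) (by linarith [show 0 ≤ x ^ 8 by positivity])
    calc 2 * x ^ 4 / (1 + x ^ 8) * (|Real.cos (n * t)| * P (r ^ 4) t)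
        ≤ 2 * x ^ 4 * (1 * P (r ^ 4) t) := by
          gcongr
          exact Real.abs_cos_le_one _
      _ = _ := by ring
  have hmeanA : (periodMean fun t => |A t|) =
      4 * x / (1 + x ^ 2) * (periodMean fun t => |Real.cos (n * t)| * P r t) -
      4 * x ^ 3 / (1 + x ^ 6) * (periodMean fun t => |Real.cos (n * t)| * P (r ^ 3) t) := by
    rw [funext hAabs, periodMean_sub (by fun_prop) (by fun_prop), periodMean_const_mul,
      periodMean_const_mul]
  have hmeanB : (periodMean fun t => |B t|) ≤ 2 * x ^ 4 := by
    refine (periodMean_mono (by fun_prop) (by fun_prop) hBabs).trans ?_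
    have := periodMean_cos_mul_discPoissonKernel h40 h41 0
    simp only [Nat.cast_zero, zero_mul, Real.cos_zero, one_mul, pow_zero] at this
    rw [periodMean_const_mul, this, mul_one]
  have hJ1 := abs_periodMean_abs_cos_mul_discPoissonKernel_sub_le h0.le h1 hn
  have hJ3 := abs_periodMean_abs_cos_mul_discPoissonKernel_sub_le h30 h31 hn
  have e3 : (r ^ 3) ^ n = x ^ 3 := by rw [hxdef, ← pow_mul, ← pow_mul, mul_comm]
  rw [e3] at hJ3
  have htotal : (periodMean fun t => |A t|) + (periodMean fun t => |B t|) ≤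
      8 / Real.pi * x * (1 - x ^ 2 / 10) := by
    rw [hmeanA]
    linarith [discPoissonKernel_bound_aux hx0 hx hJ1 hJ3]
  have hAbd : ∃ C, ∀ t, |A t| ≤ C := by
    refine ⟨4 * x / (1 + x ^ 2) * (1 * ((1 - r ^ 2) / (1 - r) ^ 2)), fun t => ?_⟩
    rw [hAabs]
    have h2 : 0 ≤ 4 * x ^ 3 / (1 + x ^ 6) * (|Real.cos (n * t)| * P (r ^ 3) t) :=
      mul_nonneg (by positivity) (mul_nonneg (abs_nonneg _) (discPoissonKernel_pos h30 h31 t).le)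
    have h3 : 4 * x / (1 + x ^ 2) * (|Real.cos (n * t)| * P r t) ≤
        4 * x / (1 + x ^ 2) * (1 * ((1 - r ^ 2) / (1 - r) ^ 2)) :=
      mul_le_mul_of_nonneg_left (mul_le_mul (Real.abs_cos_le_one _)
        (discPoissonKernel_le h0.le h1 t) (discPoissonKernel_pos h0.le h1 t).le zero_le_one)
        (by positivity)
    linarith
  have hBbd : ∃ C, ∀ t, |B t| ≤ C :=
    ⟨2 * x ^ 4 * ((1 - (r ^ 4) ^ 2) / (1 - r ^ 4) ^ 2), fun t => (hBabs t).trans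
      (mul_le_mul_of_nonneg_left (discPoissonKernel_le h40 h41 t) (by positivity))⟩
  obtain ⟨CA, hCA⟩ := hAbd
  obtain ⟨CB, hCB⟩ := hBbd
  let mA : ℕ → ℝ := fun k => periodMean fun t => Real.cos (k * t) * A t
  let mB : ℕ → ℝ := fun k => periodMean fun t => Real.cos (k * t) * B t
  have hmA : ∀ k, n ≤ k → mA k = 2 * r ^ k - 2 * (r ^ k) ^ 3 := by
    intro k hk
    have e : (fun t => Real.cos (k * t) * A t) = fun t =>
        4 * x / (1 + x ^ 2) * (Real.cos (k * t) * (Real.cos (n * t) * P r t)) -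
        4 * x ^ 3 / (1 + x ^ 6) * (Real.cos (k * t) * (Real.cos (n * t) * P (r ^ 3) t)) := by
      ext t; simp only [A]; ring
    simp only [mA]
    rw [e, periodMean_sub (by fun_prop) (by fun_prop), periodMean_const_mul, periodMean_const_mul,
      periodMean_cos_mul_cos_mul_discPoissonKernel h0.le h1 hk,
      periodMean_cos_mul_cos_mul_discPoissonKernel h30 h31 hk]
    obtain ⟨j, rfl⟩ := Nat.exists_eq_add_of_le hk
    have e1 : r ^ (n + j) = r ^ j * x := by rw [pow_add, mul_comm]
    have e2 : r ^ (n + j + n) = r ^ j * x ^ 2 := by rw [pow_add, e1]; ring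
    have e4 : (r ^ 3) ^ j = (r ^ j) ^ 3 := by rw [← pow_mul, ← pow_mul, mul_comm]
    have e5 : (r ^ 3) ^ (n + j + n) = (r ^ j * x ^ 2) ^ 3 := by
      rw [← e2, ← pow_mul, ← pow_mul, mul_comm]
    rw [Nat.add_sub_cancel_left, e2, e4, e5, e1]
    have d1 : (1 + x ^ 2) ≠ 0 := by positivity
    have d2 : (1 + x ^ 6) ≠ 0 := by positivity
    field_simp
    ring
  have hmB : ∀ k, n ≤ k → mB k = (r ^ k) ^ 4 := by
    intro k hk
    have e : (fun t => Real.cos (k * t) * B t) = fun t =>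
        2 * x ^ 4 / (1 + x ^ 8) * (Real.cos (k * t) * (Real.cos (n * t) * P (r ^ 4) t)) := by
      ext t; simp only [B]; ring
    simp only [mB]
    rw [e, periodMean_const_mul, periodMean_cos_mul_cos_mul_discPoissonKernel h40 h41 hk]
    obtain ⟨j, rfl⟩ := Nat.exists_eq_add_of_le hk
    have e1 : r ^ (n + j) = r ^ j * x := by rw [pow_add, mul_comm]
    have e2 : r ^ (n + j + n) = r ^ j * x ^ 2 := by rw [pow_add, e1]; ring
    have e4 : (r ^ 4) ^ j = (r ^ j) ^ 4 := by rw [← pow_mul, ← pow_mul, mul_comm]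
    have e5 : (r ^ 4) ^ (n + j + n) = (r ^ j * x ^ 2) ^ 4 := by
      rw [← e2, ← pow_mul, ← pow_mul, mul_comm]
    rw [Nat.add_sub_cancel_left, e4, e5, e1]
    have d1 : (1 + x ^ 8) ≠ 0 := by positivity
    field_simp
  -- With `s = r ^ k`, `(s⁻¹ + s)/2 · (2s - 2s³) = 1 - s⁴`, and `B` supplies the missing `s⁴`. Hence
  -- `d` vanishes from `n` on, and `∑ d k cos kθ` is a polynomial in `cos θ`.
  let d : ℕ → ℝ := fun k => b k - b k * (((r ^ k)⁻¹ + r ^ k) / 2) * mA k - b k * mB k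
  have hd : ∀ k, n ≤ k → d k = 0 := by
    intro k hk
    have hs : r ^ k ≠ 0 := (pow_pos h0 k).ne'
    simp only [d]
    rw [hmA k hk, hmB k hk]
    field_simp
    ring
  refine ⟨∑ k ∈ Finset.range n, C (d k) * Chebyshev.T ℝ k, ?_, fun θ => ?_⟩
  · refine lt_of_le_of_lt (natDegree_sum_le_of_forall_le _ _ (n := n - 1) fun k hk => ?_)
      (by omega)
    refine (natDegree_C_mul_le _ _).trans ?_
    rw [Chebyshev.natDegree_T, Int.natAbs_natCast]
    have := Finset.mem_range.1 hk
    omega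
  · have hA := hasSum_periodMean_convolution hbw hu hAc hCA θ
    have hB := hasSum_periodMean_convolution hb hG hBc hCB θ
    have hdiff := ((hG θ).sub hA).sub hB
    have hfin : HasSum (fun k : ℕ => d k * Real.cos (k * θ))
        (∑ k ∈ Finset.range n, d k * Real.cos (k * θ)) :=
      hasSum_sum_of_ne_finset_zero fun k hk => by
        rw [hd k (by simpa using hk), zero_mul]
    have heq := (hdiff.of_eq (g := fun k : ℕ => d k * Real.cos (k * θ))
      (fun k => by simp only [d, mA, mB]; ring) rfl).unique hfin
    have heval : (∑ k ∈ Finset.range n, C (d k) * Chebyshev.T ℝ k).eval (Real.cos θ) =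
        ∑ k ∈ Finset.range n, d k * Real.cos (k * θ) := by
      rw [eval_finsetSum]
      refine Finset.sum_congr rfl fun k _ => ?_
      rw [eval_mul, eval_C, Chebyshev.T_real_cos]
      simp
    rw [heval, ← heq]
    have hA' := abs_periodMean_convolution_le huc hAc huK θ
    have hB' := abs_periodMean_convolution_le hGc hBc hGK θ
    calc _ = |(periodMean fun t => (u (θ - t) + u (θ + t)) / 2 * A t) +
          periodMean fun t => (G (θ - t) + G (θ + t)) / 2 * B t| := by congr 1; ring
      _ ≤ _ := abs_add_le _ _
      _ ≤ K * (periodMean fun t => |A t|) + K * periodMean fun t => |B t| := add_le_add hA' hB'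
      _ = K * ((periodMean fun t => |A t|) + periodMean fun t => |B t|) := by ring
      _ ≤ _ := mul_le_mul_of_nonneg_left htotal hK0

/-! ### Cosine series of periodic functions analytic in a strip -/

/-- Pointwise Fourier series of a continuous periodic function with summable coefficients. -/
lemma hasSum_fourier_of_periodic {g : ℝ → ℂ} (hg : Continuous g)
    (hper : Function.Periodic g (2 * Real.pi)) {c : ℤ → ℂ}
    (hc : ∀ k : ℤ, c k = (2 * Real.pi : ℝ)⁻¹ • ∫ t in (0 : ℝ)..2 * Real.pi,
      Complex.exp (-(k * Complex.I * t)) * g t) (hs : Summable c) (θ : ℝ) :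
    HasSum (fun k : ℤ => c k * Complex.exp (k * Complex.I * θ)) (g θ) := by
  have : Fact (0 < 2 * Real.pi) := ⟨Real.two_pi_pos⟩
  let f : C(AddCircle (2 * Real.pi), ℂ) := ⟨hper.lift, continuous_quot_lift _ hg⟩
  have hf : ∀ t : ℝ, f (t : AddCircle (2 * Real.pi)) = g t := fun t => hper.lift_coe t
  have hfou : ∀ (k : ℤ) (t : ℝ), fourier k (t : AddCircle (2 * Real.pi)) =
      Complex.exp (k * Complex.I * t) := by
    intro k t
    rw [fourier_coe_apply]
    congr 1
    have : (Real.pi : ℂ) ≠ 0 := by exact_mod_cast Real.pi_ne_zero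
    push_cast
    field_simp
  have hcoef : ∀ k, fourierCoeff f k = c k := by
    intro k
    rw [fourierCoeff_eq_intervalIntegral _ _ 0, hc, zero_add, one_div]
    congr 1
    refine intervalIntegral.integral_congr fun t _ => ?_
    simp only [hf, hfou, smul_eq_mul]
    push_cast
    ring_nf
  have h := has_pointwise_sum_fourier_series_of_summable (f := f)
    (by rw [funext hcoef]; exact hs) (θ : AddCircle (2 * Real.pi))
  rw [hf] at h
  simpa only [hcoef, hfou, smul_eq_mul] using h

section Strip

variable {Φ : ℂ → ℂ} {H K : ℝ}

/-- The Fourier integrals of a periodic analytic function do not depend on the horizontal line. -/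
lemma integral_exp_mul_shift (hd : ∀ ζ : ℂ, |ζ.im| < H → DifferentiableAt ℂ Φ ζ)
    (hper : ∀ ζ, Φ (ζ + 2 * Real.pi) = Φ ζ) (k : ℤ) {y : ℝ} (hy : |y| < H) :
    ∫ t in (0 : ℝ)..2 * Real.pi, Complex.exp (-(k * Complex.I * (t + y * Complex.I))) *
      Φ (t + y * Complex.I) =
    ∫ t in (0 : ℝ)..2 * Real.pi, Complex.exp (-(k * Complex.I * t)) * Φ t := by
  have h := Complex.integral_boundary_rect_eq_zero_of_differentiableOn
    (fun ζ => Complex.exp (-(k * Complex.I * ζ)) * Φ ζ) 0 ((2 * Real.pi : ℝ) + y * Complex.I)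
    (fun ζ hζ => by
      have him : ζ.im ∈ uIcc 0 y := by simpa using (Complex.mem_reProdIm.1 hζ).2
      have : |ζ.im| < H := by
        have := abs_sub_left_of_mem_uIcc him
        simp only [sub_zero] at this
        exact this.trans_lt hy
      exact (DifferentiableAt.mul (by fun_prop) (hd ζ this)).differentiableWithinAt)
  -- In Cauchy's theorem on the rectangle over one period, the two vertical sides cancel by
  -- periodicity.
  have hvert : ∀ s : ℝ, Complex.exp (-(k * Complex.I * (((2 * Real.pi : ℝ) : ℂ) + s * Complex.I))) *
      Φ (((2 * Real.pi : ℝ) : ℂ) + s * Complex.I) =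
      Complex.exp (-(k * Complex.I * (((0 : ℝ) : ℂ) + s * Complex.I))) *
      Φ (((0 : ℝ) : ℂ) + s * Complex.I) := by
    intro s
    have e1 : ((2 * Real.pi : ℝ) : ℂ) + s * Complex.I = s * Complex.I + 2 * Real.pi := by
      push_cast; ring
    have e2 : -(k * Complex.I * (s * Complex.I + 2 * Real.pi)) =
        -(k * Complex.I * (s * Complex.I)) + (-k : ℤ) * (2 * Real.pi * Complex.I) := by
      push_cast; ring
    rw [e1, hper, e2, Complex.exp_add, Complex.exp_int_mul_two_pi_mul_I, mul_one]
    simp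
  have e1 : (((2 * Real.pi : ℝ) : ℂ) + y * Complex.I).re = 2 * Real.pi := by simp
  have e2 : (((2 * Real.pi : ℝ) : ℂ) + y * Complex.I).im = y := by simp
  simp only [e1, e2, Complex.zero_re, Complex.zero_im] at h
  simp only [hvert] at h
  rw [add_sub_cancel_right, sub_eq_zero] at h
  simpa using h.symm

lemma continuous_comp_add_mul_I (hd : ∀ ζ : ℂ, |ζ.im| < H → DifferentiableAt ℂ Φ ζ) {y : ℝ}
    (hy : |y| < H) : Continuous fun t : ℝ => Φ (t + y * Complex.I) :=
  continuous_iff_continuousAt.2 fun t => by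
    have h1 : ContinuousAt Φ (t + y * Complex.I) := (hd _ (by simpa using hy)).continuousAt
    exact h1.comp (f := fun t : ℝ => (t : ℂ) + y * Complex.I) (by fun_prop)

/-- Cosine series of an even periodic function, analytic in a strip and real on the line. -/
lemma exists_cosine_series (hd : ∀ ζ : ℂ, |ζ.im| < H → DifferentiableAt ℂ Φ ζ)
    (hper : ∀ ζ, Φ (ζ + 2 * Real.pi) = Φ ζ) (heven : ∀ ζ, Φ (-ζ) = Φ ζ)
    (hreal : ∀ t : ℝ, (Φ t).im = 0) (hK : ∀ ζ : ℂ, |ζ.im| < H → ‖Φ ζ‖ ≤ K) {h : ℝ} (h0 : 0 < h)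
    (hH : h < H) :
    ∃ b : ℕ → ℝ, (Summable fun k => |b k|) ∧
      (Summable fun k => |b k * ((Real.exp (k * h) + Real.exp (-(k * h))) / 2)|) ∧
      ∀ y, |y| ≤ h → ∀ θ : ℝ, HasSum (fun k : ℕ => b k *
        ((Real.exp (k * y) + Real.exp (-(k * y))) / 2) * Real.cos (k * θ))
        (Φ (θ + y * Complex.I)).re := by
  -- Coefficients decaying like `e^{-|k| h'}` with `h' > h` remain summable after multiplication by
  -- `e^{|k| h}`.
  obtain ⟨h', hh', hH'⟩ := exists_between hH
  have hK0 : 0 ≤ K := (norm_nonneg _).trans (hK 0 (by simpa using h0.trans hH))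
  let a : ℤ → ℂ := fun k => (2 * Real.pi : ℝ)⁻¹ • ∫ t in (0 : ℝ)..2 * Real.pi,
      Complex.exp (-(k * Complex.I * t)) * Φ t
  -- The Fourier coefficients on the line at height `y` are `e^{-ky} a k`. This gives both the
  -- decay, with `y = ±h'`, and the series on every line.
  have hshift : ∀ (k : ℤ) (y : ℝ), |y| < H → Complex.exp (-(k * y)) * a k =
      (2 * Real.pi : ℝ)⁻¹ • ∫ t in (0 : ℝ)..2 * Real.pi,
      Complex.exp (-(k * Complex.I * t)) * Φ (t + y * Complex.I) := by
    intro k y hy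
    simp only [a]
    rw [← integral_exp_mul_shift hd hper k hy, mul_smul_comm, ← intervalIntegral.integral_const_mul]
    congr 1
    refine intervalIntegral.integral_congr fun t _ => ?_
    rw [← mul_assoc, ← Complex.exp_add]
    congr 2
    linear_combination (-(k : ℂ) * y) * Complex.I_mul_I
  have hnorm : ∀ (k : ℤ) (y : ℝ), |y| < H → Real.exp (-(k * y)) * ‖a k‖ ≤ K := by
    intro k y hy
    have e : Real.exp (-(k * y)) = ‖Complex.exp (-(k * y))‖ := by
      rw [Complex.norm_exp]; congr 1
      simp
    rw [e, ← norm_mul, hshift k y hy, norm_smul]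
    have hle := intervalIntegral.norm_integral_le_of_norm_le_const (a := 0) (b := 2 * Real.pi)
      (f := fun t : ℝ => Complex.exp (-(k * Complex.I * t)) * Φ (t + y * Complex.I)) (C := K)
      (fun t _ => by
        have : ‖Complex.exp (-(k * Complex.I * t))‖ = 1 := by
          rw [Complex.norm_exp]; simp
        rw [norm_mul, this, one_mul]
        exact hK _ (by simpa using hy))
    rw [sub_zero, abs_of_pos Real.two_pi_pos] at hle
    rw [norm_inv, Real.norm_of_nonneg Real.two_pi_pos.le]
    calc (2 * Real.pi)⁻¹ * _ ≤ (2 * Real.pi)⁻¹ * (K * (2 * Real.pi)) :=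
          mul_le_mul_of_nonneg_left hle (inv_nonneg.2 Real.two_pi_pos.le)
      _ = K := by field_simp
  have hasymm : ∀ k, a (-k) = a k := by
    intro k
    simp only [a]
    congr 1
    have e := intervalIntegral.integral_comp_sub_left (a := 0) (b := 2 * Real.pi)
      (fun t : ℝ => Complex.exp (-((k : ℤ) * Complex.I * t)) * Φ t) (2 * Real.pi)
    rw [sub_self, sub_zero] at e
    rw [← e]
    refine intervalIntegral.integral_congr fun t _ => ?_
    have e1 : ((2 * Real.pi - t : ℝ) : ℂ) = -(t : ℂ) + 2 * Real.pi := by push_cast; ring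
    have e2 : -(k * Complex.I * (-(t : ℂ) + 2 * Real.pi)) =
        -(((-k : ℤ) : ℂ) * Complex.I * t) + (-k : ℤ) * (2 * Real.pi * Complex.I) := by
      push_cast; ring
    rw [e1, hper, heven, e2, Complex.exp_add, Complex.exp_int_mul_two_pi_mul_I, mul_one]
  have hareal : ∀ k, a k = ((a k).re : ℂ) := by
    intro k
    have hc0 : Continuous fun t : ℝ => Φ t := by
      simpa using continuous_comp_add_mul_I hd (y := 0) (by simpa using h0.trans hH)
    have hcE : ∀ k : ℤ, Continuous fun t : ℝ => Complex.exp (-(k * Complex.I * t)) * Φ t :=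
      fun k => Continuous.mul (by fun_prop) hc0
    have e : a k = (a k + a (-k)) / 2 := by rw [hasymm]; ring
    have e2 : a k + a (-k) = (((2 * Real.pi)⁻¹ * ∫ t in (0 : ℝ)..2 * Real.pi,
        2 * Real.cos (k * t) * (Φ t).re : ℝ) : ℂ) := by
      simp only [a]
      rw [← smul_add, ← intervalIntegral.integral_add
        ((hcE k).intervalIntegrable _ _) ((hcE (-k)).intervalIntegrable _ _), Complex.ofReal_mul,
        ← intervalIntegral.integral_ofReal, Complex.real_smul]
      congr 1
      refine intervalIntegral.integral_congr fun t _ => ?_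
      have e3 : Φ t = ((Φ t).re : ℂ) := Complex.ext (by simp) (by simp [hreal t])
      rw [← add_mul]
      conv_lhs => rw [e3]
      push_cast
      rw [Complex.two_cos]
      ring_nf
    rw [e, e2]
    norm_cast
  have hadecay : ∀ k : ℤ, ‖a k‖ ≤ K * Real.exp (-(|(k : ℝ)| * h')) := by
    intro k
    have hh0 : 0 < h' := h0.trans hh'
    have key : ∀ y : ℝ, |y| < H → -(k * y) = |(k : ℝ)| * h' →
        ‖a k‖ ≤ K * Real.exp (-(|(k : ℝ)| * h')) := by
      intro y hy hky
      have := hnorm k y hy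
      rw [hky] at this
      rw [Real.exp_neg, ← div_eq_mul_inv, le_div_iff₀ (Real.exp_pos _), mul_comm]
      exact this
    rcases le_total 0 (k : ℝ) with hk | hk
    · exact key (-h') (by rwa [abs_neg, abs_of_pos hh0]) (by rw [abs_of_nonneg hk]; ring)
    · exact key h' (by rwa [abs_of_pos hh0]) (by rw [abs_of_nonpos hk]; ring)
  have hgeo : Summable fun k : ℕ => K * Real.exp (-(h' - h)) ^ k :=
    (summable_geometric_of_lt_one (Real.exp_pos _).le
      ((Real.exp_lt_exp.2 (by linarith)).trans_eq Real.exp_zero)).mul_left K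
  have hgeoZ : Summable fun k : ℤ => K * Real.exp (-(|(k : ℝ)| * (h' - h))) := by
    have e : ∀ k : ℕ, K * Real.exp (-((k : ℝ) * (h' - h))) = K * Real.exp (-(h' - h)) ^ k := by
      intro k
      rw [← Real.exp_nat_mul]; ring_nf
    refine Summable.of_nat_of_neg ?_ ?_
    · refine hgeo.congr fun k => ?_
      rw [← e]; simp
    · refine hgeo.congr fun k => ?_
      rw [← e]; simp
  have hsumZ : ∀ y, |y| ≤ h → Summable fun k : ℤ => Complex.exp (-(k * y)) * a k := by
    intro y hy
    refine Summable.of_norm_bounded hgeoZ fun k => ?_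
    rw [norm_mul, Complex.norm_exp]
    have e : (-((k : ℂ) * y)).re = -(k * y) := by simp
    rw [e]
    calc Real.exp (-(k * y)) * ‖a k‖
        ≤ Real.exp (|(k : ℝ)| * h) * (K * Real.exp (-(|(k : ℝ)| * h'))) := by
          refine mul_le_mul (Real.exp_le_exp.2 ?_) (hadecay k) (norm_nonneg _) (Real.exp_pos _).le
          calc -((k : ℝ) * y) ≤ |(k : ℝ) * y| := neg_le_abs _
            _ = |(k : ℝ)| * |y| := abs_mul _ _
            _ ≤ _ := mul_le_mul_of_nonneg_left hy (abs_nonneg _)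
      _ = K * Real.exp (-(|(k : ℝ)| * (h' - h))) := by
          rw [mul_left_comm, ← Real.exp_add]; ring_nf
  -- Evenness and reality on the axis make `a k` real and symmetric, so the terms `±k` combine into
  -- one cosine with coefficient `2 a k`.
  let b : ℕ → ℝ := fun k => if k = 0 then (a 0).re else 2 * (a k).re
  have hbd : ∀ k : ℕ, |b k| ≤ 2 * (K * Real.exp (-(k * h'))) := by
    intro k
    have h1 : |(a k).re| ≤ K * Real.exp (-(k * h')) := by
      have := hadecay k
      simp only [Int.cast_natCast, Nat.abs_cast] at this
      exact (Complex.abs_re_le_norm _).trans this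
    simp only [b]
    split_ifs with hk
    · subst hk
      have := (abs_nonneg _).trans h1
      simp only [Nat.cast_zero] at h1 this ⊢
      have h2 : |(a 0).re| ≤ K * Real.exp (-(0 * h')) := h1
      linarith
    · rw [abs_mul, abs_two]
      exact mul_le_mul_of_nonneg_left h1 two_pos.le
  have hbw : ∀ k : ℕ, |b k * ((Real.exp (k * h) + Real.exp (-(k * h))) / 2)| ≤
      2 * (K * Real.exp (-(h' - h)) ^ k) := by
    intro k
    have hkh : 0 ≤ (k : ℝ) * h := by positivity
    have h1 : (Real.exp (k * h) + Real.exp (-(k * h))) / 2 ≤ Real.exp (k * h) := by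
      have := Real.exp_le_exp.2 (show -((k : ℝ) * h) ≤ k * h by linarith)
      linarith
    rw [abs_mul, abs_of_pos (by positivity :
      0 < (Real.exp (k * h) + Real.exp (-(k * h))) / 2)]
    calc _ ≤ 2 * (K * Real.exp (-(k * h'))) * Real.exp (k * h) :=
          mul_le_mul (hbd k) h1 (by positivity) (by positivity)
      _ = 2 * (K * Real.exp (-(h' - h)) ^ k) := by
          rw [mul_assoc, mul_assoc, ← Real.exp_add, ← Real.exp_nat_mul]; ring_nf
  refine ⟨b, ?_, Summable.of_nonneg_of_le (fun _ => abs_nonneg _) hbw (hgeo.mul_left 2),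
    fun y hy θ => ?_⟩
  · refine Summable.of_nonneg_of_le (fun _ => abs_nonneg _) (fun k => (hbd k).trans ?_)
      (hgeo.mul_left 2)
    rw [← Real.exp_nat_mul]
    refine mul_le_mul_of_nonneg_left (mul_le_mul_of_nonneg_left (Real.exp_le_exp.2 ?_) hK0)
      two_pos.le
    have : 0 ≤ (k : ℝ) * h := by positivity
    linarith
  · have hyH : |y| < H := hy.trans_lt hH
    have hz := hasSum_fourier_of_periodic (continuous_comp_add_mul_I hd hyH)
      (fun t => by
        have : ((t + 2 * Real.pi : ℝ) : ℂ) + y * Complex.I = t + y * Complex.I + 2 * Real.pi := by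
          push_cast; ring
        simp only [this, hper]) (fun k => hshift k y hyH) (hsumZ y hy) θ
    have hre : ∀ k : ℤ, (Complex.exp (-(k * y)) * a k * Complex.exp (k * Complex.I * θ)).re =
        (a k).re * Real.exp (-(k * y)) * Real.cos (k * θ) := by
      intro k
      have e1 : Complex.exp (-((k : ℂ) * y)) = ((Real.exp (-(k * y)) : ℝ) : ℂ) := by push_cast; rfl
      have e2 : (k : ℂ) * Complex.I * θ = ((k * θ : ℝ) : ℂ) * Complex.I := by push_cast; ring
      rw [hareal k, e1, e2, ← Complex.ofReal_mul, Complex.re_ofReal_mul,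
        Complex.exp_ofReal_mul_I_re, Complex.ofReal_re]
      ring
    have hz' := (Complex.hasSum_re hz)
    simp only [hre] at hz'
    -- Pairing `k` with `-k` counts the constant term twice; one copy is removed.
    have hN := hz'.nat_add_neg.sub (hasSum_ite_eq (0 : ℕ) (a 0).re)
    refine hN.of_eq (fun k => ?_) (by simp)
    simp only [b, hasymm]
    split_ifs with hk
    · subst hk; simp
    · push_cast
      rw [neg_mul, neg_mul, neg_neg, Real.cos_neg]
      ring

end Strip

/-- Polynomial approximation of a function bounded by `K` on a Bernstein ellipse, in the cosine
parametrization. -/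
lemma exists_polynomial_approx_of_strip {Φ : ℂ → ℂ} {H K : ℝ}
    (hd : ∀ ζ : ℂ, |ζ.im| < H → DifferentiableAt ℂ Φ ζ)
    (hper : ∀ ζ, Φ (ζ + 2 * Real.pi) = Φ ζ) (heven : ∀ ζ, Φ (-ζ) = Φ ζ)
    (hreal : ∀ t : ℝ, (Φ t).im = 0) (hK : ∀ ζ : ℂ, |ζ.im| < H → ‖Φ ζ‖ ≤ K) {h : ℝ} (h0 : 0 < h)
    (hH : h < H) {n : ℕ} (hn : 1 ≤ n) (hx : Real.exp (-h) ^ n ≤ 1 / 2) :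
    ∃ p : ℝ[X], p.natDegree < n ∧ ∀ θ : ℝ, |(Φ θ).re - p.eval (Real.cos θ)| ≤
      K * (8 / Real.pi * Real.exp (-h) ^ n * (1 - (Real.exp (-h) ^ n) ^ 2 / 10)) := by
  obtain ⟨b, hb, hbw, hsum⟩ := exists_cosine_series hd hper heven hreal hK h0 hH
  have hw : ∀ k : ℕ, (Real.exp (k * h) + Real.exp (-(k * h))) / 2 =
      ((Real.exp (-h) ^ k)⁻¹ + Real.exp (-h) ^ k) / 2 := by
    intro k
    rw [← Real.exp_nat_mul, ← Real.exp_neg]; ring_nf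
  have hre : ∀ y, |y| < H → ∀ θ : ℝ, |(Φ (θ + y * Complex.I)).re| ≤ K := fun y hy θ =>
    (Complex.abs_re_le_norm _).trans (hK _ (by simpa using hy))
  have h0H : |(0 : ℝ)| < H := by rw [abs_zero]; exact h0.trans hH
  have hhH : |h| < H := by rwa [abs_of_pos h0]
  have hG : ∀ θ : ℝ, HasSum (fun k : ℕ => b k * Real.cos (k * θ)) (Φ θ).re := by
    intro θ
    have := hsum 0 (by rw [abs_zero]; exact h0.le) θ
    simp only [mul_zero, neg_zero, Real.exp_zero, Complex.ofReal_zero, zero_mul, add_zero] at this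
    refine this.of_eq (fun k => ?_) rfl
    ring
  refine exists_polynomial_approx_cosine_series (Real.exp_pos _)
    ((Real.exp_lt_exp.2 (by linarith)).trans_eq Real.exp_zero) hn hx hb
    (by simpa only [hw] using hbw) (G := fun θ => (Φ θ).re)
    (u := fun θ => (Φ (θ + h * Complex.I)).re) ?_ ?_ hG ?_ ?_ ?_ ?_
  · simpa [Function.comp_def] using Complex.continuous_re.comp (continuous_comp_add_mul_I hd h0H)
  · exact Complex.continuous_re.comp (continuous_comp_add_mul_I hd hhH)
  · intro θ
    simpa only [hw] using hsum h (abs_of_pos h0).le θ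
  · exact (norm_nonneg _).trans (hK 0 (by simpa using h0H))
  · intro θ
    simpa using hre 0 h0H θ
  · exact hre h hhH

/-! ### The Achieser–Stenger estimates and their optimal uniform consequence -/

section Main

variable {a b : ℝ} {M : ℕ} {W φ : ℝ → ℝ}

/-- The Achieser-Stenger estimate. -/
lemma abs_expSumError_lt_achieserStengerBound (hb : 0 < b) (hab : a < b) (hM : 1 ≤ M)
    (hW : MonotoneOn W (Icc a b))
    (hinc : ((M + 1 : ℕ) : ℕ∞) ≤ {t | IsPointOfIncrease W a b t}.encard)
    (hφ : IsVariableTransformation (a / b) φ) (hF : 1 < rhoA φ) {u c : Fin M → ℝ}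
    (hQ : IsGaussQuadrature M (fun s => W (b * φ s)) u c) {ρ : ℝ} (hρ : ρ ∈ rhoInterval φ) {x : ℝ}
    (hx : 0 ≤ x) :
    |expSumError W a b φ u c x| < achieserStengerBound W a b φ M ρ x := by
  have hf0 := laplaceStieltjes_zero_pos hab hW hinc
  set f0 := laplaceStieltjes W a b 0 with hf0def
  set m := (infRe φ ρ).toReal with hm
  set K := Real.exp (-b * x * m) with hKdef
  have hKpos : 0 < K := Real.exp_pos _
  have hρ0 : 0 < ρ := by linarith [hρ.1]
  set H := Real.log ρ with hH
  have hHpos : 0 < H := Real.log_pos hρ.1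
  have hπ := Real.pi_pos
  let Φ : ℂ → ℂ := fun ζ => Complex.exp (-(b * x : ℝ) * analyticContinuation φ (Complex.cos ζ))
  have hmem : ∀ ζ : ℂ, |ζ.im| < H → Complex.cos ζ ∈ bernsteinEllipse ρ := fun ζ hζ =>
    (cos_mem_bernsteinEllipse_coe hρ.1 ζ).2 ((Real.lt_log_iff_exp_lt hρ0).1 hζ)
  have hΦd : ∀ ζ : ℂ, |ζ.im| < H → DifferentiableAt ℂ Φ ζ := fun ζ hζ => by
    have h1 : ((Real.exp |ζ.im| : ℝ) : EReal) < rhoA φ :=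
      lt_of_lt_of_le (EReal.coe_lt_coe_iff.2 ((Real.lt_log_iff_exp_lt hρ0).1 hζ))
        (coe_le_rhoA_of_mem hρ)
    exact ((differentiableAt_continuation_cos hF h1).const_mul _).cexp
  have hΦK : ∀ ζ : ℂ, |ζ.im| < H → ‖Φ ζ‖ ≤ K := fun ζ hζ => by
    simp only [Φ]
    rw [Complex.norm_exp, ← Complex.ofReal_neg, Complex.re_ofReal_mul, hKdef, Real.exp_le_exp]
    have h1 := infRe_toReal_le hF hρ (hmem ζ hζ)
    have h2 : 0 ≤ b * x := mul_nonneg hb.le hx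
    nlinarith
  have hΦreal : ∀ t : ℝ, Φ t = ((Real.exp (-b * φ (Real.cos t) * x) : ℝ) : ℂ) := fun t => by
    simp only [Φ]
    rw [← Complex.ofReal_cos, analyticContinuation_ofReal hF (Real.cos_mem_Icc t)]
    push_cast
    ring_nf
  have hzpow : ρ ^ (-(2 * (M : ℤ))) = Real.exp (-H) ^ (2 * M) := by
    rw [zpow_neg, Real.exp_neg, Real.exp_log hρ0, inv_pow]
    norm_cast
  have hcos : ∀ {p : ℝ[X]} {ε : ℝ}, (∀ θ : ℝ, |(Φ θ).re - p.eval (Real.cos θ)| ≤ ε) →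
      ∀ s ∈ Icc (-1 : ℝ) 1, |Real.exp (-b * φ s * x) - p.eval s| ≤ ε := by
    intro p ε h s hs
    have := h (Real.arccos s)
    rwa [hΦreal, Complex.ofReal_re, Real.cos_arccos hs.1 hs.2] at this
  rw [achieserStengerBound, ← hf0def, ← hm, ← hKdef, hzpow]
  -- The kernel estimate needs `ρ^{-2M} ≤ 1/2`. Otherwise approximation by zero gives `2 K f(0)`,
  -- which is enough because `2 < 8/π`.
  rcases lt_or_ge (Real.exp (-H) ^ (2 * M)) (1 / 2) with hlt | hge
  · have hbound : ∀ h, 0 < h → h < H → Real.exp (-h) ^ (2 * M) ≤ 1 / 2 →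
        |expSumError W a b φ u c x| ≤ 2 * (K * (8 / Real.pi * Real.exp (-h) ^ (2 * M) *
          (1 - (Real.exp (-h) ^ (2 * M)) ^ 2 / 10))) * f0 := by
      intro h h0 hhH hh
      obtain ⟨p, hp, hpa⟩ := exists_polynomial_approx_of_strip (Φ := Φ) hΦd
        (fun ζ => by simp only [Φ, Complex.cos_add_two_pi])
        (fun ζ => by simp only [Φ, Complex.cos_neg])
        (fun t => by rw [hΦreal, Complex.ofReal_im]) hΦK h0 hhH (by omega) hh
      exact hQ.abs_expSumError_le hb hab hM hW hφ hp (hcos hpa)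
    have hcont : Continuous fun h => 2 * (K * (8 / Real.pi * Real.exp (-h) ^ (2 * M) *
          (1 - (Real.exp (-h) ^ (2 * M)) ^ 2 / 10))) * f0 := by fun_prop
    have hlim : |expSumError W a b φ u c x| ≤ 2 * (K * (8 / Real.pi * Real.exp (-H) ^ (2 * M) *
          (1 - (Real.exp (-H) ^ (2 * M)) ^ 2 / 10))) * f0 := by
      -- Strips of half-width `h < H = log ρ` are admissible; strictness is lost in the limit and
      -- recovered from the factor `1 - q²/10`.
      refine ge_of_tendsto ((hcont.tendsto H).mono_left (nhdsWithin_le_nhds (s := Iio H))) ?_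
      have hcont2 : Continuous fun h => Real.exp (-h) ^ (2 * M) := by fun_prop
      filter_upwards [self_mem_nhdsWithin,
        nhdsWithin_le_nhds ((hcont2.tendsto H).eventually (gt_mem_nhds hlt)),
        nhdsWithin_le_nhds (lt_mem_nhds hHpos)] with h h1 h2 h3
      exact hbound h h3 h1 (le_of_lt h2)
    refine hlim.trans_lt ?_
    have hq : 0 < Real.exp (-H) ^ (2 * M) := by positivity
    set q := Real.exp (-H) ^ (2 * M)
    have h1 : 0 < K * (8 / Real.pi * q) * f0 * (q ^ 2 / 10) := by positivity
    have e : 16 / Real.pi * q * K * f0 - 2 * (K * (8 / Real.pi * q * (1 - q ^ 2 / 10))) * f0 =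
        2 * (K * (8 / Real.pi * q) * f0 * (q ^ 2 / 10)) := by ring
    linarith
  · have hle := hQ.abs_expSumError_le hb hab hM hW hφ (x := x) (ε := K) (p := 0)
      (by rw [natDegree_zero]; omega) (hcos fun θ => by
        rw [eval_zero, sub_zero]
        exact (Complex.abs_re_le_norm _).trans (hΦK θ (by simpa using hHpos)))
    refine hle.trans_lt ?_
    have h2 : 2 < 16 / Real.pi * Real.exp (-H) ^ (2 * M) := by
      calc (2 : ℝ) < 16 / Real.pi * (1 / 2) := by
            rw [div_mul_eq_mul_div, lt_div_iff₀ hπ]; linarith [Real.pi_lt_four]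
        _ ≤ _ := mul_le_mul_of_nonneg_left hge (by positivity)
    exact mul_lt_mul_of_pos_right (mul_lt_mul_of_pos_right h2 hKpos) hf0

lemma IsVariableTransformation.left_le {r : ℝ} (hφ : IsVariableTransformation r φ) :
    ∀ s ∈ Icc (-1 : ℝ) 1, r ≤ φ s := fun s hs => by
  rw [← hφ.left]
  exact hφ.strictMonoOn.monotoneOn (by norm_num) hs hs.1

/-- Liouville's theorem excludes `rhoA φ = ⊤`, where `toReal` would give zero. -/
lemma rhoHat_eq_of_infRe_nonneg {r : ℝ} (hφ : IsVariableTransformation r φ) (hr : r < 1)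
    (hF : 1 < rhoA φ) (hpos : 0 ≤ infRe φ (rhoA φ)) : (rhoHat φ : EReal) = rhoA φ := by
  have htop := rhoA_ne_top_of_infRe_nonneg hF (by rw [hφ.left, hφ.right]; exact hr.ne) hpos
  rw [rhoHat, if_pos hpos, EReal.coe_toReal htop (ne_bot_of_gt hF)]

/-- These two facts make `rhoHat φ` an admissible parameter whose exponential factor is at most one
for every `x ≥ 0`. -/
lemma rhoHat_mem_rhoInterval {r : ℝ} (hφ : IsVariableTransformation r φ) (hr0 : 0 < r)
    (hr : r < 1) (hF : 1 < rhoA φ) : rhoHat φ ∈ rhoInterval φ ∧ 0 ≤ (infRe φ (rhoHat φ)).toReal := by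
  by_cases hpos : 0 ≤ infRe φ (rhoA φ)
  · have heq := rhoHat_eq_of_infRe_nonneg hφ hr hF hpos
    refine ⟨⟨?_, Or.inr ⟨heq, fun h => ?_⟩⟩, ?_⟩
    · have := hF
      rw [← heq] at this
      exact_mod_cast this
    · rw [h] at hpos; simp at hpos
    · rw [heq]; exact EReal.toReal_nonneg hpos
  · obtain ⟨h1, h2, h3⟩ := rhoZero_spec hF hr0 hφ.left_le hpos
    rw [rhoHat, if_neg hpos]
    exact ⟨⟨h1, Or.inl h2⟩, by rw [h3]; simp⟩

/-- The best uniform bound obtainable from the Achieser-Stenger estimates. -/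
lemma isLUB_sInf_achieserStengerBound (hb : 0 < b) (ha : 0 < a) (hab : a < b) (hM : 1 ≤ M)
    (hf0 : 0 < laplaceStieltjes W a b 0) (hφ : IsVariableTransformation (a / b) φ)
    (hF : 1 < rhoA φ) :
    IsLUB ((fun x => sInf ((fun ρ => achieserStengerBound W a b φ M ρ x) '' rhoInterval φ)) ''
          Ioi 0)
        (16 / Real.pi * rhoHat φ ^ (-(2 * (M : ℤ))) * laplaceStieltjes W a b 0) := by
  have hr0 : 0 < a / b := div_pos ha hb
  have hr1 : a / b < 1 := (div_lt_one hb).2 hab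
  obtain ⟨hmem, hm0⟩ := rhoHat_mem_rhoInterval hφ hr0 hr1 hF
  have hhat0 : 0 < rhoHat φ := by linarith [hmem.1]
  set f0 := laplaceStieltjes W a b 0 with hf0def
  have hπ := Real.pi_pos
  have hne : ∀ x, ((fun ρ => achieserStengerBound W a b φ M ρ x) '' rhoInterval φ).Nonempty :=
    fun x => ⟨_, _, hmem, rfl⟩
  have hbdd : ∀ x, BddBelow ((fun ρ => achieserStengerBound W a b φ M ρ x) '' rhoInterval φ) := by
    refine fun x => ⟨0, ?_⟩
    rintro _ ⟨ρ, hρ, rfl⟩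
    have : 0 < ρ := by linarith [hρ.1]
    simp only [achieserStengerBound, ← hf0def]
    positivity
  refine ⟨?_, fun B hB => ?_⟩
  · rintro _ ⟨x, hx, rfl⟩
    refine (csInf_le (hbdd x) ⟨_, hmem, rfl⟩).trans ?_
    simp only [achieserStengerBound, ← hf0def]
    refine mul_le_mul_of_nonneg_right (mul_le_of_le_one_right (by positivity) ?_) hf0.le
    rw [Real.exp_le_one_iff]
    have : 0 ≤ b * x * (infRe φ (rhoHat φ)).toReal :=
      mul_nonneg (mul_nonneg hb.le (le_of_lt hx)) hm0
    linarith
  · have hlow : ∀ x > 0, ∀ D, (∀ ρ ∈ rhoInterval φ, D ≤ achieserStengerBound W a b φ M ρ x) →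
        D ≤ B := by
      intro x hx D hD
      refine le_trans (le_csInf (hne x) ?_) (hB ⟨x, hx, rfl⟩)
      rintro _ ⟨ρ, hρ, rfl⟩
      exact hD ρ hρ
    by_cases hpos : 0 ≤ infRe φ (rhoA φ)
    · have heq := rhoHat_eq_of_infRe_nonneg hφ hr1 hF hpos
      -- Every admissible `ρ` satisfies `ρ ≤ ρ̂` and `m(ρ) ≤ φ(-1) = a/b`, so the infimum at `x` is
      -- at least the value written here, which tends to the claimed bound as `x → 0`.
      have hcont : Continuous fun x => 16 / Real.pi * rhoHat φ ^ (-(2 * (M : ℤ))) *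
          Real.exp (-b * x * (a / b)) * f0 := by fun_prop
      have hlim := (hcont.tendsto 0).mono_left (nhdsWithin_le_nhds (s := Ioi 0))
      simp only [mul_zero, zero_mul, Real.exp_zero, mul_one] at hlim
      refine le_of_tendsto hlim ?_
      filter_upwards [self_mem_nhdsWithin] with x hx
      refine hlow x hx _ fun ρ hρ => ?_
      have hρ0 : 0 < ρ := by linarith [hρ.1]
      have hle : ρ ≤ rhoHat φ := by
        have := coe_le_rhoA_of_mem hρ
        rw [← heq] at this
        exact_mod_cast this
      have hz : rhoHat φ ^ (-(2 * (M : ℤ))) ≤ ρ ^ (-(2 * (M : ℤ))) := by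
        rw [zpow_neg, zpow_neg]
        refine inv_anti₀ (by positivity) ?_
        exact_mod_cast pow_le_pow_left₀ hρ0.le hle (2 * M)
      have hmle := infRe_toReal_le_apply hF hρ (s := -1) (by norm_num)
      rw [hφ.left] at hmle
      simp only [achieserStengerBound, ← hf0def]
      have hbx : 0 ≤ b * x := mul_nonneg hb.le (le_of_lt hx)
      gcongr ?_ * f0
      refine mul_le_mul (mul_le_mul_of_nonneg_left hz (by positivity)) ?_ (Real.exp_pos _).le
        (by positivity)
      rw [Real.exp_le_exp]
      nlinarith
    · obtain ⟨k, hk, hslope⟩ := exists_slope_infRe hF hr0 hφ.left_le hpos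
      have hhat : rhoHat φ = rhoZero φ := by rw [rhoHat, if_neg hpos]
      have hM0 : (0 : ℝ) < M := by exact_mod_cast hM
      -- This `x` balances the two exponents: `b x k = 2M`, so the supporting line gives `-b x m(ρ)
      -- ≥ 2M (log ρ - log ρ̂)`, exactly offsetting `ρ^{-2M}`.
      refine hlow (2 * M / (b * k)) (by positivity) _ fun ρ hρ => ?_
      have hρ0 : 0 < ρ := by linarith [hρ.1]
      simp only [achieserStengerBound, ← hf0def]
      refine mul_le_mul_of_nonneg_right ?_ hf0.le
      rw [mul_assoc]
      refine mul_le_mul_of_nonneg_left ?_ (by positivity)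
      have hz : ∀ y : ℝ, 0 < y → y ^ (-(2 * (M : ℤ))) = Real.exp (-(2 * M * Real.log y)) := by
        intro y hy
        rw [← Real.rpow_intCast, Real.rpow_def_of_pos hy]
        push_cast
        ring_nf
      rw [hz _ hhat0, hz _ hρ0, ← Real.exp_add, Real.exp_le_exp, hhat]
      have h1 := mul_le_mul_of_nonneg_left (hslope ρ hρ) (by positivity : 0 ≤ 2 * (M : ℝ) / k)
      have e1 : 2 * (M : ℝ) / k * (k * (Real.log ρ - Real.log (rhoZero φ))) =
          2 * M * (Real.log ρ - Real.log (rhoZero φ)) := by field_simp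
      have e2 : -b * (2 * M / (b * k)) * (infRe φ ρ).toReal =
          2 * (M : ℝ) / k * -(infRe φ ρ).toReal := by field_simp
      rw [e2]
      rw [e1] at h1
      linarith

end Main

theorem theorem2 (a b : ℝ) (ha : 0 < a) (hab : a < b) (M : ℕ) (hM : 1 ≤ M)
    (W : ℝ → ℝ) (hW : MonotoneOn W (Icc a b))
    (hinc : ((M + 1 : ℕ) : ℕ∞) ≤ {t | IsPointOfIncrease W a b t}.encard)
    (φ : ℝ → ℝ) (hφ : IsVariableTransformation (a / b) φ) (hρ : 1 < rhoA φ) :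
    (∃ u c : Fin M → ℝ, IsGaussQuadrature M (fun s => W (b * φ s)) u c) ∧
    ∀ u c : Fin M → ℝ, IsGaussQuadrature M (fun s => W (b * φ s)) u c →
      -- the maximum error on `[0, ∞)` exists, is positive, and satisfies the bound
      (∃ m : ℝ, IsGreatest ((fun x => |expSumError W a b φ u c x|) '' Ici 0) m ∧ 0 < m ∧
        m < 16 / Real.pi * rhoHat φ ^ (-(2 * (M : ℤ))) * laplaceStieltjes W a b 0) ∧
      -- the Achieser-Stenger estimates, and the best uniform bound that they yield
      (∀ ρ ∈ rhoInterval φ, ∀ x > 0,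
        |expSumError W a b φ u c x| < achieserStengerBound W a b φ M ρ x) ∧
      IsLUB ((fun x => sInf ((fun ρ => achieserStengerBound W a b φ M ρ x) '' rhoInterval φ)) ''
          Ioi 0)
        (16 / Real.pi * rhoHat φ ^ (-(2 * (M : ℤ))) * laplaceStieltjes W a b 0) := by
  have hb : 0 < b := ha.trans hab
  have hr0 : 0 < a / b := div_pos ha hb
  have hr1 : a / b < 1 := (div_lt_one hb).2 hab
  refine ⟨exists_isGaussQuadrature hb hab hM hW hinc hφ, fun u c hQ => ⟨?_, fun ρ hρ' x hx => ?_,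
    isLUB_sInf_achieserStengerBound hb ha hab hM (laplaceStieltjes_zero_pos hab hW hinc) hφ hρ⟩⟩
  · obtain ⟨m, hm, hm0⟩ := exists_isGreatest_abs_expSumError ha hab hW hinc (φ := φ) (u := u)
      (c := c) fun ν => hr0.trans_le (hφ.left_le _ (Ioo_subset_Icc_self (hQ.mem_Ioo ν)))
    refine ⟨m, hm, hm0, ?_⟩
    obtain ⟨x, hx, rfl⟩ := hm.1
    obtain ⟨hmem, hhat0⟩ := rhoHat_mem_rhoInterval hφ hr0 hr1 hρ
    -- The estimate is applied at the maximizing `x`, which may be `0`, with `ρ = ρ̂`; strictness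
    -- thus passes to the maximum.
    refine (abs_expSumError_lt_achieserStengerBound hb hab hM hW hinc hφ hρ hQ hmem hx).trans_le ?_
    have h1 : 0 < rhoHat φ := by linarith [hmem.1]
    have h2 := Real.pi_pos
    refine mul_le_mul_of_nonneg_right (mul_le_of_le_one_right (by positivity) ?_)
      (laplaceStieltjes_zero_pos hab hW hinc).le
    rw [Real.exp_le_one_iff]
    have : 0 ≤ b * x * (infRe φ (rhoHat φ)).toReal := mul_nonneg (mul_nonneg hb.le hx) hhat0
    linarith
  · exact abs_expSumError_lt_achieserStengerBound hb hab hM hW hinc hφ hρ hQ hρ' (le_of_lt hx)
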